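/- **Setting.** An election instance $I=(d,n,m,x,t)$ consists of voters $x_1,\dots,x_n\in\mathbb Q^d$ and candidates $t_1,\dots,t_m\in\mathbb Q^d$ with $x_i\neq t_j$ for all $i,j$; here $d\ge 2$ and $n,m\ge 1$. The critical region of voter $i$ is the open Euclidean ball $B_i=\{t\in\mathbb R^d: \|x_i-t\|_2<\|x_i-t_j\|_2 \text{ for all } j\}$, and $\nu_2(t)=|\{i: t\in B_i\}|$. The problem $\mathrm{OCP}(\nu_2)$ asks for a point $t\in\mathbb R^d$ that maximises $\nu_2$. **Algorithm.** ModifiedBALLS3 works with balls given by a rational centre and a rational squared radius; the squared radius of $B_i$ is the squared distance from $x_i$ to the nearest candidate. All points stay in $\mathbb Q^d$; a recursive call is made on balls whose centres lie in a flat, given by hyperplanes with pairwise orthogonal normals. If the flat has dimension $2$ it calls ModifiedBALLS1. In higher dimension: 1. it computes the set $P$ of ordered pairs $(i,i')$ of balls that meet and are not contained in each other; 2. for each $(i,i')\in P$ it computes the hyperplane $h_{i,i'}$ that contains the intersection of the two spheres, projects the centres orthogonally onto $h_{i,i'}$, reduces the squared radii by the squared distances of the centres to $h_{i,i'}$, discards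 the balls that do not meet $h_{i,i'}$, and solves the resulting instance, of one dimension less, recursively; 3. for each $i$ it considers the centre of ball $i$ together with the set $S_i=\{i': B_{i'}\supseteq B_i\}$; 4. it returns the pair (point, voter set) with the largest voter set among those found. ModifiedBALLS1 (disks in a plane, in coordinates with respect to a rational orthogonal basis of the plane): for each disk $i$ it finds the disks that contain disk $i$ (including $i$ itself and disks equal to it) and those whose circle crosses that of $i$; it sorts the crossing points on the circle of $i$ clockwise by merge sort (at the same point, disks are left before others are entered), comparing points with coordinates $a+b\sqrt\delta$ ($a,b,\delta\in\mathbb Q$) by rational arithmetic, and sweeps along the arcs while maintaining the number of crossing disks that contain the current arc. (If no circle crosses that of $i$, the whole circle is the only arc.) For an arc and a disk $i$ with the largest total number of disks containing the arc or containing disk $i$, it recovers the set $S$ of these disks and returns $S$ with a rational point of $\bigcap S$: the centre of $i$ if no circle crosses that of $i$, and otherwise a point found on one of the lines through the two crossing points of the circle of $i$ with another circle, by intersecting the intervals that the disks of $S$ cut out on this line. **Cost.** The algorithm uses only the operations $+,-,\times,\div$ and comparisons on rational numbers, together with counters and accesses to list cells and array entries. Each such elementary operation counts as one step. In the bit cost,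 an operation on two rationals costs the square of the sum of their bit lengths (numerator plus denominator, in lowest terms), an operation on counters $a,b$ costs one plus their bit lengths, and an access costs one. **Proposition.** For all $d\ge2$ and $n,m\ge1$ and every election instance: 1. ModifiedBALLS3 returns a rational point $t$ that maximises $\nu_2$ over $\mathbb R^d$, a duplicate-free list of exactly the voters $i$ with $t\in B_i$, and their number $\nu_2(t)$. 2. There is an absolute constant $C$ such that the number of steps is at most $$C\bigl(n^{2d-4}(nd^2+d^3+n^2\log n)+nmd\bigr)$$ for all $d\ge 2$, $n,m\ge1$ and all instances. For each fixed dimension $d$ the number of steps is $O\bigl(n^{2d-4}(nd^2+d^3+n^2\log n)+nm\bigr)$, with a constant that depends only on $d$. 3. For each fixed dimension $d\ge2$ there is a polynomial $p$ such that the bit cost is at most $p(L)$ on every instance, where $L$ is the total bit length of the coordinates of the voters and candidates. -/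

import Mathlib

namespace OCP

/-! ## Elections, critical regions and the optimisation problem -/

/-- An election instance `(d, n, m, x, t)`: `n` voters and `m` candidates with rational positions,
no voter sitting on a candidate. -/
structure Election (d n m : ℕ) where
  voter : Fin n → Fin d → ℚ
  cand : Fin m → Fin d → ℚ
  disjoint : ∀ i j, voter i ≠ cand j

/-- A rational vector as a point of Euclidean space. -/
def embed {d : ℕ} (v : Fin d → ℚ) : EuclideanSpace ℝ (Fin d) :=
  WithLp.toLp 2 fun k => (v k : ℝ)

/-- The critical region of voter `i` for the Euclidean norm: the open ball of all positions that
are strictly closer to the voter than every existing candidate. -/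
def criticalRegion {d n m : ℕ} (I : Election d n m) (i : Fin n) :
    Set (EuclideanSpace ℝ (Fin d)) :=
  {t | ∀ j, ‖embed (I.voter i) - t‖ < ‖embed (I.voter i) - embed (I.cand j)‖}

/-- The vote count `ν₂`: the number of voters won by a new candidate at position `t`. -/
noncomputable def voteCount {d n m : ℕ} (I : Election d n m) (t : EuclideanSpace ℝ (Fin d)) : ℕ :=
  Set.ncard {i : Fin n | t ∈ criticalRegion I i}

/-- `t` is an optimal solution of `OCP(U)` on the instance `I`. -/
def SolvesOCP {d n m : ℕ} (U : Election d n m → EuclideanSpace ℝ (Fin d) → ℕ)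
    (I : Election d n m) (t : EuclideanSpace ℝ (Fin d)) : Prop :=
  ∀ t', U I t' ≤ U I t

/-! ## The model of computation

A computation returns a value together with two costs. `steps` is the number of elementary steps:
rational operations `+ - * /`, rational comparisons, operations on counters, and accesses to list
cells or array entries count one each. `bits` is the bit cost of the same run: an operation on
rationals is charged the square of the total bit length of its operands. There is no square root
and no other operation on numbers. -/

structure Comp (α : Type) where
  val : α
  steps : ℕ
  bits : ℕ

instance : Monad Comp where
  pure a := ⟨a, 0, 0⟩
  bind x f := ⟨(f x.val).val, x.steps + (f x.val).steps, x.bits + (f x.val).bits⟩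

/-- Bit length of a rational in lowest terms. -/
def bitLength (q : ℚ) : ℕ := Nat.size q.num.natAbs + Nat.size q.den

def opBits (a b : ℚ) : ℕ := (bitLength a + bitLength b) ^ 2

def tick : Comp Unit := ⟨(), 1, 1⟩

def qadd (a b : ℚ) : Comp ℚ := ⟨a + b, 1, opBits a b⟩
def qsub (a b : ℚ) : Comp ℚ := ⟨a - b, 1, opBits a b⟩
def qmul (a b : ℚ) : Comp ℚ := ⟨a * b, 1, opBits a b⟩
def qdiv (a b : ℚ) : Comp ℚ := ⟨a / b, 1, opBits a b⟩
def qlt (a b : ℚ) : Comp Bool := ⟨decide (a < b), 1, opBits a b⟩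

def nadd (a b : ℕ) : Comp ℕ := ⟨a + b, 1, 1 + Nat.size a + Nat.size b⟩
def nsub (a b : ℕ) : Comp ℕ := ⟨a - b, 1, 1 + Nat.size a + Nat.size b⟩
def nlt (a b : ℕ) : Comp Bool := ⟨decide (a < b), 1, 1 + Nat.size a + Nat.size b⟩

/-! ### Loops over lists (one step for each cell that is visited) -/

def mapC {α β : Type} (f : α → Comp β) : List α → Comp (List β)
  | [] => pure []
  | a :: l => do
    tick
    let b ← f a
    let bs ← mapC f l
    pure (b :: bs)

def foldC {α β : Type} (f : β → α → Comp β) : β → List α → Comp β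
  | b, [] => pure b
  | b, a :: l => do
    tick
    let b' ← f b a
    foldC f b' l

/-- Collects the results of `f` that are not `none`, in order. -/
def filterMapC {α β : Type} (f : α → Comp (Option β)) : List α → Comp (List β)
  | [] => pure []
  | a :: l => do
    tick
    let b ← f a
    let bs ← filterMapC f l
    match b with
    | some b => pure (b :: bs)
    | none => pure bs

def allC {α : Type} (f : α → Comp Bool) (l : List α) : Comp Bool :=
  foldC (fun ok a => do
    let b ← f a
    pure (ok && b)) true l

def lengthC {α : Type} (l : List α) : Comp ℕ :=
  foldC (fun k _ => nadd k 1) 0 l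

/-! ### Merge sort -/

def splitC {α : Type} : List α → Comp (List α × List α)
  | [] => pure ([], [])
  | [a] => do
    tick
    pure ([a], [])
  | a :: b :: l => do
    tick
    tick
    let p ← splitC l
    pure (a :: p.1, b :: p.2)

def mergeC {α : Type} (le : α → α → Comp Bool) : List α → List α → Comp (List α)
  | [], ys => pure ys
  | x :: xs, [] => pure (x :: xs)
  | x :: xs, y :: ys => do
    tick
    let b ← le x y
    if b then
      let l ← mergeC le xs (y :: ys)
      pure (x :: l)
    else
      let l ← mergeC le (x :: xs) ys
      pure (y :: l)
termination_by xs ys => xs.length + ys.length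

/-- The first argument only bounds the depth of the recursion. -/
def sortAux {α : Type} (le : α → α → Comp Bool) : ℕ → List α → Comp (List α)
  | 0, l => pure l
  | _ + 1, [] => pure []
  | _ + 1, [a] => pure [a]
  | k + 1, a :: b :: l => do
    let p ← splitC (a :: b :: l)
    let l₁ ← sortAux le k p.1
    let l₂ ← sortAux le k p.2
    mergeC le l₁ l₂

def sortC {α : Type} (le : α → α → Comp Bool) (l : List α) : Comp (List α) :=
  sortAux le l.length l

/-! ### Rational vectors, stored as arrays -/

/-- Fills an array entry by entry. -/
def tabulate {d : ℕ} (f : Fin d → Comp ℚ) : Comp (Fin d → ℚ) :=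
  ⟨fun k => (f k).val, ∑ k, ((f k).steps + 1), ∑ k, ((f k).bits + 1)⟩

def vsub {d : ℕ} (u v : Fin d → ℚ) : Comp (Fin d → ℚ) :=
  tabulate fun k => qsub (u k) (v k)

/-- `u + c • v` -/
def vaddMul {d : ℕ} (u : Fin d → ℚ) (c : ℚ) (v : Fin d → ℚ) : Comp (Fin d → ℚ) :=
  tabulate fun k => do
    let p ← qmul c (v k)
    qadd (u k) p

def dotC {d : ℕ} (u v : Fin d → ℚ) : Comp ℚ :=
  foldC (fun s k => do
    let p ← qmul (u k) (v k)
    qadd s p) 0 (List.finRange d)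

/-! ## Balls and their relative position -/

/-- The ball of voter `id` inside the current flat: centre and square of the radius. -/
structure Ball (d n : ℕ) where
  id : Fin n
  centre : Fin d → ℚ
  radSq : ℚ

/-- The squared distance of a voter to the nearest candidate. -/
def sqRadius {d n m : ℕ} (I : Election d n m) (i : Fin n) : Comp ℚ :=
  let sqDist : Fin m → Comp ℚ := fun j => do
    let w ← vsub (I.voter i) (I.cand j)
    dotC w w
  match List.finRange m with
  | [] => pure 0
  | j :: js => do
    let r ← sqDist j
    foldC (fun r j => do
      let s ← sqDist j
      let b ← qlt s r
      pure (if b then s else r)) r js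

inductive Position
  /-- the two spheres cross, so the balls meet and neither contains the other -/
  | crossing
  /-- the second open ball contains the first -/
  | inside
  /-- the first open ball strictly contains the second -/
  | outside
  /-- the open balls are disjoint -/
  | apart

/-- Relative position of two open balls, from the squared radii and the squared distance of the
centres: with `s = ρ + ρ' - D`, the spheres cross iff `s ^ 2 < 4 * ρ * ρ'`. -/
def position (ρ ρ' D : ℚ) : Comp Position := do
  let s ← qadd ρ ρ'
  let s ← qsub s D
  let s2 ← qmul s s
  let q ← qmul ρ ρ'
  let q4 ← qmul 4 q
  let cr ← qlt s2 q4
  if cr then pure .crossing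
  else
    let ap ← qlt s 0
    if ap then pure .apart
    else
      let lt ← qlt ρ' ρ
      pure (if lt then .outside else .inside)

def ballPosition {d n : ℕ} (b b' : Ball d n) : Comp Position := do
  let w ← vsub b'.centre b.centre
  let D ← dotC w w
  position b.radSq b'.radSq D

/-- An answer: a position and the voters it wins, with their number. -/
structure Answer (d n : ℕ) where
  point : Fin d → ℚ
  voters : List (Fin n)
  count : ℕ

/-- The better of two answers, the second one in case of a tie. -/
def better {d n : ℕ} : Option (Answer d n) → Option (Answer d n) → Comp (Option (Answer d n))
  | none, b => pure b
  | some a, none => pure (some a)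
  | some a, some b => do
    let lt ← nlt b.count a.count
    pure (some (if lt then a else b))

/-! ## ModifiedBALLS1: the planar base case

### Signs of expressions with one or two square roots, by rational arithmetic -/

def sgn (a : ℚ) : Comp ℤ := do
  let pos ← qlt 0 a
  if pos then pure 1
  else
    let neg ← qlt a 0
    pure (if neg then -1 else 0)

/-- The sign of `A + B * √δ`, where `0 < δ`. -/
def sgnSqrt (A B δ : ℚ) : Comp ℤ := do
  let a ← sgn A
  let b ← sgn B
  tick
  if b = 0 ∨ a = b then pure a
  else if a = 0 then pure b
  else
    let A2 ← qmul A A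
    let B2 ← qmul B B
    let B2δ ← qmul B2 δ
    let t ← qsub A2 B2δ
    let t ← sgn t
    pure (a * t)

/-- The sign of `A + B * √δ + C * √ε`, where `0 < δ` and `0 < ε`. -/
def sgnSqrt₂ (A B δ C ε : ℚ) : Comp ℤ := do
  let a ← sgnSqrt A B δ
  let c ← sgn C
  tick
  if c = 0 ∨ a = c then pure a
  else if a = 0 then pure c
  else
    let A2 ← qmul A A
    let B2 ← qmul B B
    let B2δ ← qmul B2 δ
    let C2 ← qmul C C
    let C2ε ← qmul C2 ε
    let t ← qadd A2 B2δ
    let t ← qsub t C2ε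
    let AB ← qmul A B
    let AB2 ← qmul 2 AB
    let t ← sgnSqrt t AB2 δ
    pure (a * t)

/-- The ball of voter `id` in a plane with orthogonal basis `(e₁, e₂)`: the centre is
`x * e₁ + y * e₂` relative to some origin of the plane. -/
structure Disk (n : ℕ) where
  id : Fin n
  x : ℚ
  y : ℚ
  radSq : ℚ

/-- The inner product of `p * e₁ + q * e₂` and `p' * e₁ + q' * e₂`, where `g₁ = ‖e₁‖²` and
`g₂ = ‖e₂‖²`. -/
def innerC (g₁ g₂ p q p' q' : ℚ) : Comp ℚ := do
  let s ← qmul p p'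
  let s ← qmul g₁ s
  let t ← qmul q q'
  let t ← qmul g₂ t
  qadd s t

/-- One of the two points where the circles of two disks meet, on the circle of the first one:
relative to its centre, the point has coordinates `x₀ + x₁ * √δ` and `y₀ + y₁ * √δ`. Going
clockwise around the first circle, one enters (`entry = true`) or leaves (`entry = false`) the
disk `other` at this point. -/
structure Event (n : ℕ) where
  other : Disk n
  entry : Bool
  x₀ : ℚ
  x₁ : ℚ
  y₀ : ℚ
  y₁ : ℚ
  δ : ℚ

/-- The common chord of two crossing disks. The centre of the second is `w = (p, q)` relative to
the first, and the chord lies on the line `{centre + α • w + s • w' : s}` for the vector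
`w' = (- g₂ * q, g₁ * p)` orthogonal to `w`, with endpoints at `s = ± √δ`. -/
structure Chord (n : ℕ) where
  other : Disk n
  p : ℚ
  q : ℚ
  p' : ℚ
  q' : ℚ
  /-- `‖w'‖²` -/
  normSq' : ℚ
  α : ℚ
  δ : ℚ

def chord {n : ℕ} (g₁ g₂ : ℚ) (b b' : Disk n) (p q D : ℚ) : Comp (Chord n) := do
  let κ ← qadd D b.radSq
  let κ ← qsub κ b'.radSq
  let κ ← qdiv κ 2
  let α ← qdiv κ D
  let p' ← qmul g₂ q
  let p' ← qsub 0 p'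
  let q' ← qmul g₁ p
  let E ← innerC g₁ g₂ p' q' p' q'
  let t ← qmul α κ
  let t ← qsub b.radSq t
  let δ ← qdiv t E
  pure ⟨b', p, q, p', q', E, α, δ⟩

/-- The endpoint of a chord where one enters, respectively leaves, the other disk. -/
def chordEnd {n : ℕ} (c : Chord n) (entry : Bool) : Comp (Event n) := do
  let x₀ ← qmul c.α c.p
  let y₀ ← qmul c.α c.q
  if entry then pure ⟨c.other, true, x₀, c.p', y₀, c.q', c.δ⟩
  else
    let x₁ ← qsub 0 c.p'
    let y₁ ← qsub 0 c.q'
    pure ⟨c.other, false, x₀, x₁, y₀, y₁, c.δ⟩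

/-- Compares two points of a circle in the clockwise order that starts at the leftmost point:
first the upper half by increasing abscissa, then the lower half by decreasing abscissa. The
result is `-1`, `0` or `1`. -/
def cmpEvent {n : ℕ} (e f : Event n) : Comp ℤ := do
  let ye ← sgnSqrt e.y₀ e.y₁ e.δ
  let yf ← sgnSqrt f.y₀ f.y₁ f.δ
  tick
  if 0 ≤ ye ∧ yf < 0 then pure (-1)
  else if ye < 0 ∧ 0 ≤ yf then pure 1
  else
    let A ← qsub e.x₀ f.x₀
    let C ← qsub 0 f.x₁
    let s ← sgnSqrt₂ A e.x₁ e.δ C f.δ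
    pure (if 0 ≤ ye then s else -s)

/-- Clockwise order of the events; at the same point, disks are left before others are entered. -/
def leEvent {n : ℕ} (e f : Event n) : Comp Bool := do
  let s ← cmpEvent e f
  tick
  pure (decide (s < 0) || (decide (s = 0) && (!e.entry || f.entry)))

/-- What the other disks look like from the circle of one disk: the disks that contain the given
disk, and the chords with those that cross it. -/
structure View (n : ℕ) where
  containing : List (Disk n)
  chords : List (Chord n)

def view {n : ℕ} (g₁ g₂ : ℚ) (disks : List (Disk n)) (b : Disk n) : Comp (View n) :=
  foldC (fun V b' => do
    let p ← qsub b'.x b.x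
    let q ← qsub b'.y b.y
    let D ← innerC g₁ g₂ p q p q
    let pos ← position b.radSq b'.radSq D
    match pos with
    | .crossing => do
      let c ← chord g₁ g₂ b b' p q D
      pure { V with chords := c :: V.chords }
    | .inside => pure { V with containing := b' :: V.containing }
    | _ => pure V) ⟨[], []⟩ disks

/-- The state of the sweep around one circle: the number of crossing disks that contain the
current arc, the events so far (latest first), the largest number so far, and the events that
lead to it. -/
structure Sweep (n : ℕ) where
  cur : ℕ
  past : List (Event n)
  best : ℕ
  bestPast : List (Event n)

def sweepStep {n : ℕ} (s : Sweep n) (e : Event n) : Comp (Sweep n) := do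
  let cur ← if e.entry then nadd s.cur 1 else nsub s.cur 1
  let past := e :: s.past
  let lt ← nlt s.best cur
  pure (if lt then ⟨cur, past, cur, past⟩ else ⟨cur, past, s.best, s.bestPast⟩)

/-- The best arc on the circle of a disk. -/
structure BestArc (n : ℕ) where
  disk : Disk n
  view : View n
  /-- the crossing disks that contain the arc before the first event -/
  first : List (Disk n)
  /-- the events between the start and the arc, latest first -/
  past : List (Event n)
  /-- the number of disks that contain the arc, and those that contain the whole disk -/
  count : ℕ

def bestArc {n : ℕ} (g₁ g₂ : ℚ) (disks : List (Disk n)) (b : Disk n) : Comp (BestArc n) := do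
  let V ← view g₁ g₂ disks b
  let ends ← mapC (fun c => do
    let e ← chordEnd c true
    let f ← chordEnd c false
    pure (e, f)) V.chords
  let first ← filterMapC (fun (p : Event n × Event n) => do
    let s ← cmpEvent p.2 p.1
    tick
    pure (if s < 0 then some p.1.other else none)) ends
  let events ← foldC (fun l (p : Event n × Event n) => pure (p.1 :: p.2 :: l)) [] ends
  let events ← sortC leEvent events
  let k ← lengthC first
  let s ← foldC sweepStep ⟨k, [], k, []⟩ events
  let c ← lengthC V.containing
  let total ← nadd c s.best
  pure ⟨b, V, first, s.bestPast, total⟩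

/-- The disks that contain the arc or the whole disk, by replaying the sweep up to the arc. -/
def members {n : ℕ} (A : BestArc n) : Comp (List (Disk n)) := do
  let events ← foldC (fun l e => pure (e :: l)) [] A.past
  let S ← foldC (fun S (e : Event n) =>
    if e.entry then pure (e.other :: S)
    else filterMapC (fun b => do
      tick
      pure (if b.id = e.other.id then none else some b)) S) A.first events
  foldC (fun S b => pure (b :: S)) S A.view.containing

/-- An open interval `(s - √σ, s + √σ)`, empty if `σ ≤ 0`. -/
structure Interval where
  s : ℚ
  σ : ℚ

/-- The trace of a disk on the line of a chord of the disk `b`. -/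
def trace {n : ℕ} (g₁ g₂ : ℚ) (b : Disk n) (c : Chord n) (b' : Disk n) : Comp Interval := do
  let t ← qmul c.α c.p
  let x ← qadd b.x t
  let x ← qsub b'.x x
  let t ← qmul c.α c.q
  let y ← qadd b.y t
  let y ← qsub b'.y y
  let t ← innerC g₁ g₂ x y c.p' c.q'
  let s ← qdiv t c.normSq'
  let st ← qmul s t
  let N ← innerC g₁ g₂ x y x y
  let h ← qsub b'.radSq N
  let h ← qadd h st
  let σ ← qdiv h c.normSq'
  pure ⟨s, σ⟩

def inInterval (r : ℚ) (J : Interval) : Comp Bool := do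
  let t ← qsub r J.s
  let t2 ← qmul t t
  qlt t2 J.σ

/-- A rational point in the intersection of the nonempty intervals `J :: Js`, if there is one: with `l` the
interval of largest left end and `r` the one of smallest right end, one of the two midpoints, or
the point of equal power with respect to `l` and `r`. -/
def commonPoint (J : Interval) (Js : List Interval) : Comp (Option ℚ) := do
  let l ← foldC (fun l K => do
    let A ← qsub K.s l.s
    let t ← sgnSqrt₂ A (-1) K.σ 1 l.σ
    pure (if 0 < t then K else l)) J Js
  let r ← foldC (fun r K => do
    let A ← qsub K.s r.s
    let t ← sgnSqrt₂ A 1 K.σ (-1) r.σ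
    pure (if t < 0 then K else r)) J Js
  let r2 ← qmul r.s r.s
  let l2 ← qmul l.s l.s
  let t ← qsub r2 l2
  let t ← qadd t l.σ
  let t ← qsub t r.σ
  let w ← qsub r.s l.s
  let w ← qmul 2 w
  let z ← sgn w
  tick
  let e ← if z = 0 then pure l.s else qdiv t w
  foldC (fun found a => do
    let ok ← allC (inInterval a) (J :: Js)
    pure (if ok then some a else found)) none [l.s, r.s, e]

/-- A rational point in the intersection of the given disks, which all meet the disk `b`: the
centre of `b` if no disk crosses `b`, and otherwise a point on the line of one of the chords. -/
def arcPoint {n : ℕ} (g₁ g₂ : ℚ) (b : Disk n) (chords : List (Chord n)) (S : List (Disk n)) :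
    Comp (Option (ℚ × ℚ)) :=
  match chords with
  | [] => pure (some (b.x, b.y))
  | chords => foldC (fun found c => do
      let Js ← mapC (trace g₁ g₂ b c) S
      match Js with
      | [] => pure found
      | J :: Js => do
        let nonempty ← allC (fun (K : Interval) => qlt 0 K.σ) (J :: Js)
        let a ← if nonempty then commonPoint J Js else pure none
        match a with
        | none => pure found
        | some a => do
          let t ← qmul c.α c.p
          let x ← qadd b.x t
          let t ← qmul a c.p'
          let x ← qadd x t
          let t ← qmul c.α c.q
          let y ← qadd b.y t
          let t ← qmul a c.q'
          let y ← qadd y t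
          pure (some (x, y))) none chords

/-- A hyperplane `{z : ⟪normal, z⟫ = offset}`, with `normSq = ‖normal‖²`. -/
structure Hyperplane (d : ℕ) where
  normal : Fin d → ℚ
  offset : ℚ
  normSq : ℚ

/-- An orthogonal basis of the common direction of hyperplanes with pairwise orthogonal normals,
with squared norms: orthogonalisation, without normalisation, of the standard basis. -/
def directionBasis {d : ℕ} (H : List (Hyperplane d)) : Comp (List ((Fin d → ℚ) × ℚ)) := do
  let N ← mapC (fun (h : Hyperplane d) => pure (h.normal, h.normSq)) H
  let remove : (Fin d) → (Fin d → ℚ) → (Fin d → ℚ) × ℚ → Comp (Fin d → ℚ) := fun k v a => do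
    let c ← qdiv (a.1 k) a.2
    let c ← qsub 0 c
    vaddMul v c a.1
  foldC (fun found k => do
    let v ← tabulate fun j => pure (if j = k then 1 else 0)
    let v ← foldC (remove k) v N
    let v ← foldC (remove k) v found
    let g ← dotC v v
    let pos ← qlt 0 g
    pure (if pos then (v, g) :: found else found)) [] (List.finRange d)

/-- ModifiedBALLS1, for balls whose centres lie in the plane that is the intersection of the
hyperplanes `H`. -/
def modifiedBALLS1 {d n : ℕ} (H : List (Hyperplane d)) :
    List (Ball d n) → Comp (Option (Answer d n))
  | [] => pure none
  | b₀ :: balls => do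
    let basis ← directionBasis H
    match basis with
    | [(e₁, g₁), (e₂, g₂)] => do
      let disks ← mapC (fun (b : Ball d n) => do
        let z ← vsub b.centre b₀.centre
        let s ← dotC z e₁
        let x ← qdiv s g₁
        let t ← dotC z e₂
        let y ← qdiv t g₂
        pure (Disk.mk b.id x y b.radSq)) (b₀ :: balls)
      let best ← foldC (fun (best : Option (BestArc n)) b => do
        let A ← bestArc g₁ g₂ disks b
        match best with
        | none => pure (some A)
        | some A' => do
          let lt ← nlt A'.count A.count
          pure (some (if lt then A else A'))) none disks
      match best with
      | none => pure none
      | some A => do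
        let S ← members A
        let ids ← mapC (fun (b : Disk n) => pure b.id) S
        let pt ← arcPoint g₁ g₂ A.disk A.view.chords S
        match pt with
        | none => pure none
        | some (x, y) => do
          let v ← vaddMul b₀.centre x e₁
          let v ← vaddMul v y e₂
          pure (some ⟨v, ids, A.count⟩)
    | _ => pure none

/-! ## ModifiedBALLS3 -/

/-- The pairs of balls that meet and are not contained in each other. -/
def crossingPairs {d n : ℕ} (balls : List (Ball d n)) : Comp (List (Ball d n × Ball d n)) :=
  foldC (fun P b => foldC (fun P b' => do
    let pos ← ballPosition b b'
    match pos with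
    | .crossing => pure ((b, b') :: P)
    | _ => pure P) P balls) [] balls

/-- The hyperplane that contains the intersection of the two spheres. -/
def radicalHyperplane {d n : ℕ} (b b' : Ball d n) : Comp (Hyperplane d) := do
  let a ← vsub b'.centre b.centre
  let D ← dotC a a
  let t ← qadd D b.radSq
  let t ← qsub t b'.radSq
  let t ← qdiv t 2
  let c ← dotC b.centre a
  let o ← qadd c t
  pure ⟨a, o, D⟩

/-- The trace of a ball on a hyperplane, if it is not empty. -/
def project {d n : ℕ} (h : Hyperplane d) (b : Ball d n) : Comp (Option (Ball d n)) := do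
  let t ← dotC h.normal b.centre
  let t ← qsub h.offset t
  let c ← qdiv t h.normSq
  let x ← vaddMul b.centre c h.normal
  let s ← qmul c t
  let r ← qsub b.radSq s
  let pos ← qlt 0 r
  pure (if pos then some ⟨b.id, x, r⟩ else none)

/-- The centre of a ball, with the voters whose balls contain that ball. -/
def centreAnswer {d n : ℕ} (balls : List (Ball d n)) (b : Ball d n) : Comp (Answer d n) := do
  let S ← filterMapC (fun b' => do
    let pos ← ballPosition b b'
    match pos with
    | .inside => pure (some b'.id)
    | _ => pure none) balls
  let k ← lengthC S
  pure ⟨b.centre, S, k⟩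

/-- ModifiedBALLS3 on balls whose centres lie in the flat of dimension `k + 2` that is the
intersection of the hyperplanes `H`; the planar case is ModifiedBALLS1. -/
def modifiedBALLS3 {d n : ℕ} :
    ℕ → List (Hyperplane d) → List (Ball d n) → Comp (Option (Answer d n))
  | 0, H, balls => modifiedBALLS1 H balls
  | k + 1, H, balls => do
    let P ← crossingPairs balls
    let best ← foldC (fun best (p : Ball d n × Ball d n) => do
      let h ← radicalHyperplane p.1 p.2
      let balls' ← filterMapC (project h) balls
      let ans ← modifiedBALLS3 k (h :: H) balls'
      better best ans) none P
    let best' ← foldC (fun best b => do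
      let ans ← centreAnswer balls b
      better best (some ans)) none balls
    better best' best

/-- ModifiedBALLS3 on an election instance. -/
def solveElection {d n m : ℕ} (I : Election d n m) : Comp (Option (Answer d n)) := do
  let balls ← mapC (fun i => do
    let r ← sqRadius I i
    pure (Ball.mk i (I.voter i) r)) (List.finRange n)
  modifiedBALLS3 (d - 2) [] balls

/-- The number of bits of an election instance. -/
def inputBits {d n m : ℕ} (I : Election d n m) : ℕ :=
  (∑ i, ∑ k, bitLength (I.voter i k)) + ∑ j, ∑ k, bitLength (I.cand j k)

/-- `n^(2d-4) (n d² + d³ + n² log n)` -/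
noncomputable def sweepBound (n d : ℕ) : ℝ :=
  (n : ℝ) ^ (2 * d - 4) * (n * d ^ 2 + d ^ 3 + n ^ 2 * Real.log n)

end OCP

/-!
The proof has two independent halves: the answer of `solveElection` is optimal, and the recursion
is cheap.

*Optimality.* Everything is expressed by the power of a point with respect to a sphere, which is
negative exactly on the open ball. The difference of two powers is an affine function whose zero set
is the radical hyperplane of the two spheres. Let `t` be a point of a flat that contains all
centres, and among the balls that contain `t` take the one with the largest power at `t`. Either
this ball is contained in all the others, and then its centre is as good as `t`; or, moving inside
it from `t` until another power becomes as large, one reaches a point which still lies in all these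
balls and, in addition, on the radical hyperplane of two of them that cross
(`exists_crossing_or_inside`, `exists_candidate`). The traces of the balls on a radical hyperplane
have the same powers at its points (`Ball.power_traceOn`, `depth_project`). Hence induction on the
dimension of the flat gives `modifiedBALLS3_correct` once the plane has been treated.

A plane is identified with `ℂ` by an orthogonal basis obtained from the standard basis
(`directionBasis_plane`, `Ball.power_toDisk`). An optimal intersection of disks has a boundary point
that lies on a single circle (`exists_boundary_point`), so some arc of some circle is contained in
or surrounded by the best number of disks (`exists_bestArc_ge`). Conversely, the arc found by the
sweep is a genuine one: the sweep visits the crossing points by decreasing argument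
(`cmpEvent_hasSign`), a crossing disk contains exactly the points between its entry and its exit
(`power_neg_iff_between`), and since exits precede entries at a common point, a prefix of the events
with the largest count is followed by a nonempty open arc (`key_lt_of_max`). Near a point of this
arc all disks of the set have a common point at which the disk of the circle has the largest power
(`members_spec`). By optimality, the argument of the first paragraph applies and yields a common
point on the line of one of the chords of this circle. On a line the disks cut out intervals with
rational centres and rational squared half-lengths; if they have a common point, one of the midpoints
of the two extreme intervals or their point of equal power is a rational one
(`exists_commonPoint`, `arcPoint_spec`).

The answer thus consists of distinct voters won by its point, and their number is the maximum of
`voteCount`; so no other voter is won by this point (`solveElection_correct`).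

*Cost.* A rational number has level `l` if its bit length is at most `B * 6 ^ l`. Each operation
raises the level by at most one, and no number that occurs depends on more than `inputLevel d`
nested operations, which is a function of `d` alone. A `Budget` collects such bounds, and
`Run M s x Q` states that `x` makes at most `s` steps, that its bit cost is at most `M` times the
number of its steps, and that its result satisfies `Q`; it is compatible with sequencing and with the list operations. A level of
the recursion spawns at most `n ^ 2` calls, which leads to the factor `n ^ (2 * d - 4)` in front of
the cost of the planar algorithm (`modifiedBALLS3_run`, `stepBound_le`). Since every instance fits
into some budget, the bound on the steps holds unconditionally; and with `B` taken as one plus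
the input length, the cost of one operation is polynomial in the input length in each fixed dimension
(`solveElection_cost`, `exists_polynomial_bits`).
-/

namespace OCP

/-! ### Bit lengths of rational numbers -/

theorem size_mul_le (a b : ℕ) : Nat.size (a * b) ≤ Nat.size a + Nat.size b := by
  rw [Nat.size_le, pow_add]
  have ha := Nat.lt_size_self a
  have hb := Nat.lt_size_self b
  rcases Nat.eq_zero_or_pos b with rfl | h
  · simp
  · exact Nat.mul_lt_mul_of_lt_of_le ha hb.le (by positivity)

theorem size_add_le (a b : ℕ) : Nat.size (a + b) ≤ Nat.size a + Nat.size b + 1 := by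
  rw [Nat.size_le]
  have ha := Nat.lt_size_self a
  have hb := Nat.lt_size_self b
  have h1 : 2 ^ Nat.size a ≤ 2 ^ (Nat.size a + Nat.size b) :=
    Nat.pow_le_pow_right (by norm_num) (by omega)
  have h2 : 2 ^ Nat.size b ≤ 2 ^ (Nat.size a + Nat.size b) :=
    Nat.pow_le_pow_right (by norm_num) (by omega)
  rw [pow_succ]
  omega

theorem size_le_self (a : ℕ) : Nat.size a ≤ a :=
  Nat.size_le.2 Nat.lt_two_pow_self

theorem bitLength_pos (q : ℚ) : 1 ≤ bitLength q := by
  have : 0 < Nat.size q.den := Nat.size_pos.2 q.pos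
  unfold bitLength
  omega

theorem bitLength_div_le (a b : ℤ) (hb : b ≠ 0) :
    bitLength ((a : ℚ) / b) ≤ Nat.size a.natAbs + Nat.size b.natAbs := by
  have h1 : Nat.size ((a : ℚ) / b).num.natAbs ≤ Nat.size a.natAbs := by
    rcases eq_or_ne a 0 with rfl | ha
    · simp
    · refine Nat.size_le_size (Nat.le_of_dvd (Int.natAbs_pos.2 ha) ?_)
      rw [Int.natAbs_dvd_natAbs, ← Rat.divInt_eq_div]
      exact Rat.num_dvd a hb
  have h2 : Nat.size ((a : ℚ) / b).den ≤ Nat.size b.natAbs := by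
    refine Nat.size_le_size (Nat.le_of_dvd (Int.natAbs_pos.2 hb) ?_)
    rw [← Int.natCast_dvd, ← Rat.divInt_eq_div]
    exact Rat.den_dvd a b
  unfold bitLength
  omega

theorem bitLength_neg (a : ℚ) : bitLength (-a) = bitLength a := by
  simp [bitLength]

theorem bitLength_add_le (a b : ℚ) : bitLength (a + b) ≤ 3 * (bitLength a + bitLength b) := by
  have hab : a + b = ((a.num * b.den + b.num * a.den : ℤ) : ℚ) / ((a.den * b.den : ℕ) : ℤ) := by
    have ha := Rat.num_div_den a
    have hb := Rat.num_div_den b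
    have ha' : (a.den : ℚ) ≠ 0 := by exact_mod_cast a.den_nz
    have hb' : (b.den : ℚ) ≠ 0 := by exact_mod_cast b.den_nz
    conv_lhs => rw [← ha, ← hb]
    push_cast
    field_simp
  have h0 : ((a.den * b.den : ℕ) : ℤ) ≠ 0 := by
    exact_mod_cast Nat.mul_ne_zero a.den_nz b.den_nz
  have h := bitLength_div_le (a.num * b.den + b.num * a.den) _ h0
  rw [← hab] at h
  have h1 : Nat.size (a.num * b.den + b.num * a.den).natAbs
      ≤ Nat.size (a.num.natAbs * b.den + b.num.natAbs * a.den) := by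
    refine Nat.size_le_size ((Int.natAbs_add_le _ _).trans ?_)
    simp [Int.natAbs_mul]
  have h2 := size_add_le (a.num.natAbs * b.den) (b.num.natAbs * a.den)
  have h3 := size_mul_le a.num.natAbs b.den
  have h4 := size_mul_le b.num.natAbs a.den
  have h5 := size_mul_le a.den b.den
  have h6 := bitLength_pos a
  rw [Int.natAbs_natCast] at h
  unfold bitLength at *
  omega

theorem bitLength_sub_le (a b : ℚ) : bitLength (a - b) ≤ 3 * (bitLength a + bitLength b) := by
  rw [sub_eq_add_neg, ← bitLength_neg b]
  exact bitLength_add_le a (-b)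

theorem bitLength_mul_le (a b : ℚ) : bitLength (a * b) ≤ 3 * (bitLength a + bitLength b) := by
  have hab : a * b = ((a.num * b.num : ℤ) : ℚ) / ((a.den * b.den : ℕ) : ℤ) := by
    have ha' : (a.den : ℚ) ≠ 0 := by exact_mod_cast a.den_nz
    have hb' : (b.den : ℚ) ≠ 0 := by exact_mod_cast b.den_nz
    conv_lhs => rw [← Rat.num_div_den a, ← Rat.num_div_den b]
    push_cast
    field_simp
  have h0 : ((a.den * b.den : ℕ) : ℤ) ≠ 0 := by
    exact_mod_cast Nat.mul_ne_zero a.den_nz b.den_nz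
  have h := bitLength_div_le (a.num * b.num) _ h0
  rw [← hab, Int.natAbs_natCast, Int.natAbs_mul] at h
  have h3 := size_mul_le a.num.natAbs b.num.natAbs
  have h5 := size_mul_le a.den b.den
  unfold bitLength at *
  omega

theorem bitLength_ratDiv_le (a b : ℚ) : bitLength (a / b) ≤ 3 * (bitLength a + bitLength b) := by
  rcases eq_or_ne b 0 with rfl | hb
  · have : bitLength (a / 0) = 1 := by simp [bitLength]
    have := bitLength_pos a
    omega
  have hab : a / b = ((a.num * b.den : ℤ) : ℚ) / ((a.den * b.num : ℤ) : ℤ) := by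
    have ha' : (a.den : ℚ) ≠ 0 := by exact_mod_cast a.den_nz
    have hb' : (b.den : ℚ) ≠ 0 := by exact_mod_cast b.den_nz
    have hb'' : (b.num : ℚ) ≠ 0 := by exact_mod_cast Rat.num_ne_zero.2 hb
    conv_lhs => rw [← Rat.num_div_den a, ← Rat.num_div_den b]
    push_cast
    field_simp
  have h0 : ((a.den * b.num : ℤ) : ℤ) ≠ 0 :=
    mul_ne_zero (by exact_mod_cast a.den_nz) (Rat.num_ne_zero.2 hb)
  have h := bitLength_div_le (a.num * b.den) _ h0
  rw [← hab, Int.natAbs_mul, Int.natAbs_mul, Int.natAbs_natCast, Int.natAbs_natCast] at h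
  have h3 := size_mul_le a.num.natAbs b.den
  have h5 := size_mul_le a.den b.num.natAbs
  unfold bitLength at *
  omega

/-! ### A calculus for costs -/

/-- `Run M s x Q`: the computation `x` makes at most `s` steps, its bit cost is at most `M` per
step, and its result satisfies `Q`. -/
structure Run {α : Type} (M s : ℕ) (x : Comp α) (Q : α → Prop) : Prop where
  steps_le : x.steps ≤ s
  bits_le : x.bits ≤ M * x.steps
  post : Q x.val

theorem Run.pure {α : Type} {M : ℕ} {a : α} {Q : α → Prop} (h : Q a) :
    Run M 0 (Pure.pure a : Comp α) Q :=
  ⟨le_rfl, Nat.zero_le _, h⟩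

/-- The cost of a sequence; `s'` bounds the number of steps of all that comes after `x`. -/
theorem Run.bind {α β : Type} {M s s' : ℕ} {x : Comp α} {f : α → Comp β} {Q : α → Prop}
    {Q' : β → Prop} (hx : Run M s x Q) (hf : ∀ a, Q a → Run M s' (f a) Q') :
    Run M (s + s') (x >>= f) Q' := by
  have h := hf _ hx.post
  refine ⟨Nat.add_le_add hx.steps_le h.steps_le, ?_, h.post⟩
  change x.bits + (f x.val).bits ≤ M * (x.steps + (f x.val).steps)
  rw [mul_add]
  exact Nat.add_le_add hx.bits_le h.bits_le

theorem Run.mono {α : Type} {M s s' : ℕ} {x : Comp α} {Q Q' : α → Prop} (hx : Run M s x Q)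
    (hs : s ≤ s') (hQ : ∀ a, Q a → Q' a) : Run M s' x Q' :=
  ⟨hx.steps_le.trans hs, hx.bits_le, hQ _ hx.post⟩

theorem Run.le {α : Type} {M s s' : ℕ} {x : Comp α} {Q : α → Prop} (hx : Run M s x Q)
    (hs : s ≤ s') : Run M s' x Q :=
  hx.mono hs fun _ h => h

theorem Run.ite {α : Type} {M s s' : ℕ} {c : Prop} [Decidable c] {x y : Comp α} {Q : α → Prop}
    (hx : c → Run M s x Q) (hy : ¬ c → Run M s' y Q) :
    Run M (max s s') (if c then x else y) Q := by
  split_ifs with h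
  · exact (hx h).le (le_max_left _ _)
  · exact (hy h).le (le_max_right _ _)

/-- Bounds on the numbers that a run may handle: the rational operations take operands of level
at most `Λ`, where a rational is of level `l` if its bit length is at most `B * 6 ^ l`; counters
are at most `N`; one operation then costs at most `M`. -/
structure Budget where
  B : ℕ
  Λ : ℕ
  N : ℕ
  M : ℕ
  one_le : 1 ≤ B
  rat_le : (2 * (B * 6 ^ Λ)) ^ 2 ≤ M
  counter_le : 1 + 2 * N ≤ M

/-- The bit length of `q` is at most `B * 6 ^ l`. A rational operation raises the level of its
operands by at most one. -/
def Budget.Lv (β : Budget) (l : ℕ) (q : ℚ) : Prop := bitLength q ≤ β.B * 6 ^ l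

variable {β : Budget}

theorem Budget.Lv.mono {l l' : ℕ} {q : ℚ} (h : β.Lv l q) (hl : l ≤ l') : β.Lv l' q :=
  h.trans (Nat.mul_le_mul_left _ (Nat.pow_le_pow_right (by norm_num) hl))

theorem Budget.lv_of_bitLength_le {l : ℕ} {q : ℚ} (h : bitLength q ≤ 6) : β.Lv (l + 1) q := by
  have h1 := β.one_le
  have h2 : 6 ^ 1 ≤ 6 ^ (l + 1) := Nat.pow_le_pow_right (by norm_num) (by omega)
  unfold Budget.Lv
  nlinarith

theorem Budget.lv_zero {l : ℕ} : β.Lv l 0 := by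
  have h1 := β.one_le
  have h2 : 0 < 6 ^ l := by positivity
  have h3 : bitLength 0 = 1 := by simp [bitLength]
  unfold Budget.Lv
  nlinarith

theorem Budget.opBits_le {l : ℕ} {a b : ℚ} (ha : β.Lv l a) (hb : β.Lv l b) (hl : l ≤ β.Λ) :
    opBits a b ≤ β.M := by
  refine le_trans ?_ β.rat_le
  have h1 := ha.mono hl
  have h2 := hb.mono hl
  unfold Budget.Lv at h1 h2
  unfold opBits
  exact Nat.pow_le_pow_left (by omega) 2

theorem Budget.one_le_M : 1 ≤ β.M := by
  have := β.counter_le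
  omega

theorem tick_run : Run β.M 1 tick fun _ => True :=
  ⟨le_rfl, by simpa [tick] using β.one_le_M, trivial⟩

theorem run_op {l : ℕ} {a b c : ℚ} (ha : β.Lv l a) (hb : β.Lv l b)
    (hl : l ≤ β.Λ) (hc : bitLength c ≤ 3 * (bitLength a + bitLength b)) :
    Run β.M 1 ⟨c, 1, opBits a b⟩ fun q => β.Lv (l + 1) q := by
  refine ⟨le_rfl, by simpa using β.opBits_le ha hb hl, ?_⟩
  unfold Budget.Lv at *
  rw [pow_succ]
  simp only
  nlinarith

/-- The operands may have any level up to `l`; the result then has level `l + 1`. -/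
theorem qadd_run (l : ℕ) {l₁ l₂ : ℕ} {a b : ℚ} (ha : β.Lv l₁ a) (hb : β.Lv l₂ b)
    (hl : l ≤ β.Λ := by omega) (h₁ : l₁ ≤ l := by omega) (h₂ : l₂ ≤ l := by omega) :
    Run β.M 1 (qadd a b) fun q => β.Lv (l + 1) q :=
  run_op (ha.mono h₁) (hb.mono h₂) hl (bitLength_add_le a b)

theorem qsub_run (l : ℕ) {l₁ l₂ : ℕ} {a b : ℚ} (ha : β.Lv l₁ a) (hb : β.Lv l₂ b)
    (hl : l ≤ β.Λ := by omega) (h₁ : l₁ ≤ l := by omega) (h₂ : l₂ ≤ l := by omega) :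
    Run β.M 1 (qsub a b) fun q => β.Lv (l + 1) q :=
  run_op (ha.mono h₁) (hb.mono h₂) hl (bitLength_sub_le a b)

theorem qmul_run (l : ℕ) {l₁ l₂ : ℕ} {a b : ℚ} (ha : β.Lv l₁ a) (hb : β.Lv l₂ b)
    (hl : l ≤ β.Λ := by omega) (h₁ : l₁ ≤ l := by omega) (h₂ : l₂ ≤ l := by omega) :
    Run β.M 1 (qmul a b) fun q => β.Lv (l + 1) q :=
  run_op (ha.mono h₁) (hb.mono h₂) hl (bitLength_mul_le a b)

theorem qdiv_run (l : ℕ) {l₁ l₂ : ℕ} {a b : ℚ} (ha : β.Lv l₁ a) (hb : β.Lv l₂ b)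
    (hl : l ≤ β.Λ := by omega) (h₁ : l₁ ≤ l := by omega) (h₂ : l₂ ≤ l := by omega) :
    Run β.M 1 (qdiv a b) fun q => β.Lv (l + 1) q :=
  run_op (ha.mono h₁) (hb.mono h₂) hl (bitLength_ratDiv_le a b)

theorem qlt_run (l : ℕ) {l₁ l₂ : ℕ} {a b : ℚ} (ha : β.Lv l₁ a) (hb : β.Lv l₂ b)
    (hl : l ≤ β.Λ := by omega) (h₁ : l₁ ≤ l := by omega) (h₂ : l₂ ≤ l := by omega) :
    Run β.M 1 (qlt a b) fun _ => True :=
  ⟨le_rfl, by simpa [qlt] using β.opBits_le (ha.mono h₁) (hb.mono h₂) hl, trivial⟩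

theorem counter_bits {a b : ℕ} (ha : a ≤ β.N) (hb : b ≤ β.N) :
    1 + Nat.size a + Nat.size b ≤ β.M := by
  have := β.counter_le
  have := size_le_self a
  have := size_le_self b
  omega

theorem nadd_run {a b : ℕ} (ha : a ≤ β.N) (hb : b ≤ β.N) :
    Run β.M 1 (nadd a b) fun c => c = a + b :=
  ⟨le_rfl, by simpa [nadd] using counter_bits ha hb, rfl⟩

theorem nsub_run {a b : ℕ} (ha : a ≤ β.N) (hb : b ≤ β.N) :
    Run β.M 1 (nsub a b) fun c => c = a - b :=
  ⟨le_rfl, by simpa [nsub] using counter_bits ha hb, rfl⟩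

theorem nlt_run {a b : ℕ} (ha : a ≤ β.N) (hb : b ≤ β.N) :
    Run β.M 1 (nlt a b) fun _ => True :=
  ⟨le_rfl, by simpa [nlt] using counter_bits ha hb, trivial⟩

/-! ### Costs of the list operations -/

theorem mapC_run {α γ : Type} {s : ℕ} {f : α → Comp γ} {Q : γ → Prop} (l : List α)
    (hf : ∀ a ∈ l, Run β.M s (f a) Q) :
    Run β.M (l.length * (s + 1)) (mapC f l)
      fun l' => l'.length = l.length ∧ ∀ b ∈ l', Q b := by
  induction l with
  | nil => exact (Run.pure (by simp)).le (Nat.zero_le _)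
  | cons a l ih =>
    refine Run.le (Run.bind tick_run fun _ _ => Run.bind (hf a (by simp)) fun b hb =>
      Run.bind (ih fun x hx => hf x (by simp [hx])) fun bs hbs => Run.pure ?_) ?_
    · refine ⟨by simp [hbs.1], ?_⟩
      simpa [hb] using hbs.2
    · simp only [List.length_cons]
      nlinarith

/-- The invariant may depend on the number of cells visited so far. -/
theorem foldC_run {α γ : Type} {s : ℕ} {f : γ → α → Comp γ} (Q : ℕ → γ → Prop) (l : List α)
    (hf : ∀ j b, j < l.length → Q j b → ∀ a ∈ l, Run β.M s (f b a) (Q (j + 1)))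
    {b : γ} (hb : Q 0 b) :
    Run β.M (l.length * (s + 1)) (foldC f b l) (Q l.length) := by
  induction l generalizing b Q with
  | nil => exact (Run.pure hb).le (Nat.zero_le _)
  | cons a l ih =>
    refine Run.le (Run.bind tick_run fun _ _ =>
      Run.bind (hf 0 b (by simp) hb a (by simp)) fun b' hb' =>
      ih (fun j => Q (j + 1)) (fun j b hj h x hx => hf _ b (by simpa using hj) h x (by simp [hx]))
        hb') ?_
    simp only [List.length_cons]
    nlinarith

theorem foldC_run' {α γ : Type} {s : ℕ} {f : γ → α → Comp γ} (Q : γ → Prop) (l : List α)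
    (hf : ∀ b, Q b → ∀ a ∈ l, Run β.M s (f b a) Q) {b : γ} (hb : Q b) :
    Run β.M (l.length * (s + 1)) (foldC f b l) Q :=
  foldC_run (fun _ => Q) l (fun _ b _ => hf b) hb

theorem filterMapC_run {α γ : Type} {s : ℕ} {f : α → Comp (Option γ)} {Q : γ → Prop} (l : List α)
    (hf : ∀ a ∈ l, Run β.M s (f a) fun o => ∀ b ∈ o, Q b) :
    Run β.M (l.length * (s + 1)) (filterMapC f l)
      fun l' => l'.length ≤ l.length ∧ ∀ b ∈ l', Q b := by
  induction l with
  | nil => exact (Run.pure (by simp)).le (Nat.zero_le _)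
  | cons a l ih =>
    refine Run.le (Run.bind (s' := s + (l.length * (s + 1) + 0)) tick_run fun _ _ =>
      Run.bind (hf a (by simp)) fun b hb =>
      Run.bind (ih fun x hx => hf x (by simp [hx])) fun bs hbs => ?_) ?_
    · cases b with
      | none => exact Run.pure ⟨hbs.1.trans (by simp), hbs.2⟩
      | some b =>
        refine Run.pure ⟨by simpa using hbs.1, ?_⟩
        simpa [hb b rfl] using hbs.2
    · simp only [List.length_cons]
      nlinarith

theorem allC_run {α : Type} {s : ℕ} {f : α → Comp Bool} (l : List α)
    (hf : ∀ a ∈ l, Run β.M s (f a) fun _ => True) :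
    Run β.M (l.length * (s + 1)) (allC f l) fun _ => True :=
  foldC_run' (fun _ => True) l
    (fun _ _ a ha => Run.bind (s' := 0) (hf a ha) fun _ _ => Run.pure trivial) trivial

theorem lengthC_run {α : Type} (l : List α) (hl : l.length ≤ β.N) :
    Run β.M (l.length * 2) (lengthC l) fun k => k = l.length :=
  foldC_run (fun j k => k = j) l
    (fun j k hj hk _ _ => (nadd_run (by omega) (by omega)).mono le_rfl (by omega)) rfl

theorem tabulate_run {d s : ℕ} {f : Fin d → Comp ℚ} {Q : ℚ → Prop}
    (hf : ∀ k, Run β.M s (f k) Q) :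
    Run β.M (d * (s + 1)) (tabulate f) fun v => ∀ k, Q (v k) := by
  refine ⟨?_, ?_, fun k => (hf k).post⟩
  · change ∑ k, ((f k).steps + 1) ≤ _
    refine (Finset.sum_le_card_nsmul _ _ (s + 1) fun k _ => ?_).trans (by simp)
    have := (hf k).steps_le
    omega
  · change ∑ k, ((f k).bits + 1) ≤ β.M * ∑ k, ((f k).steps + 1)
    rw [Finset.mul_sum]
    refine Finset.sum_le_sum fun k _ => ?_
    have h1 := (hf k).bits_le
    have h2 := β.one_le_M
    rw [mul_add]
    omega

theorem vsub_run {d : ℕ} (l : ℕ) {l₁ l₂ : ℕ} {u v : Fin d → ℚ} (hu : ∀ k, β.Lv l₁ (u k))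
    (hv : ∀ k, β.Lv l₂ (v k)) (hl : l ≤ β.Λ := by omega) (h₁ : l₁ ≤ l := by omega)
    (h₂ : l₂ ≤ l := by omega) :
    Run β.M (d * 2) (vsub u v) fun w => ∀ k, β.Lv (l + 1) (w k) :=
  tabulate_run fun k => qsub_run l (hu k) (hv k)

theorem vaddMul_run {d : ℕ} (l : ℕ) {l₁ l₂ l₃ : ℕ} {u v : Fin d → ℚ} {c : ℚ}
    (hu : ∀ k, β.Lv l₁ (u k)) (hc : β.Lv l₂ c) (hv : ∀ k, β.Lv l₃ (v k))
    (hl : l + 1 ≤ β.Λ := by omega)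
    (h₁ : l₁ ≤ l := by omega) (h₂ : l₂ ≤ l := by omega) (h₃ : l₃ ≤ l := by omega) :
    Run β.M (d * 3) (vaddMul u c v) fun w => ∀ k, β.Lv (l + 2) (w k) :=
  tabulate_run fun k => Run.bind (qmul_run l hc (hv k)) fun _ hp => qadd_run (l + 1) (hu k) hp

theorem dotC_run {d : ℕ} (l : ℕ) {l₁ l₂ : ℕ} {u v : Fin d → ℚ} (hu : ∀ k, β.Lv l₁ (u k))
    (hv : ∀ k, β.Lv l₂ (v k)) (hl : l + 1 + d ≤ β.Λ := by omega) (h₁ : l₁ ≤ l := by omega)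
    (h₂ : l₂ ≤ l := by omega) :
    Run β.M (d * 3) (dotC u v) fun q => β.Lv (l + 1 + d) q := by
  have := foldC_run (β := β) (s := 2) (f := fun s k => do
    let p ← qmul (u k) (v k)
    qadd s p) (fun j q => β.Lv (l + 1 + j) q) (List.finRange d)
    (fun j b hj hb k _ => by
      rw [List.length_finRange] at hj
      exact Run.bind (qmul_run l (hu k) (hv k)) fun p hp => qadd_run (l + 1 + j) hb hp)
    β.lv_zero
  rwa [List.length_finRange] at this

end OCP

namespace OCP
variable {β : Budget}

/-! ### Cost of merge sort -/

theorem splitC_run {α : Type} {P : α → Prop} : ∀ l : List α, (∀ a ∈ l, P a) →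
    Run β.M l.length (splitC l) fun p =>
      p.1.length = (l.length + 1) / 2 ∧ p.2.length = l.length / 2 ∧
        (∀ a ∈ p.1, P a) ∧ ∀ a ∈ p.2, P a
  | [], _ => (Run.pure (by simp)).le (Nat.zero_le _)
  | [a], h => (Run.bind tick_run fun _ _ => Run.pure (by simpa using h)).le (by simp)
  | a :: b :: l, h => by
    refine (Run.bind tick_run fun _ _ => Run.bind tick_run fun _ _ =>
      Run.bind (splitC_run l fun x hx => h x (by simp [hx])) fun p hp => Run.pure ?_).le
        (s := 1 + (1 + (l.length + 0))) (by simp; omega)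
    obtain ⟨h1, h2, h3, h4⟩ := hp
    refine ⟨by simp [h1]; omega, by simp [h2]; omega, ?_, ?_⟩
    · simpa [h a] using h3
    · simpa [h b] using h4

theorem mergeC_run {α : Type} {s : ℕ} {P : α → Prop} {le : α → α → Comp Bool}
    (hle : ∀ a b, P a → P b → Run β.M s (le a b) fun _ => True) (xs ys : List α)
    (hx : ∀ a ∈ xs, P a) (hy : ∀ a ∈ ys, P a) :
    Run β.M ((xs.length + ys.length) * (s + 1)) (mergeC le xs ys) fun l =>
      l.length = xs.length + ys.length ∧ ∀ a ∈ l, P a := by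
  fun_induction mergeC le xs ys with
  | case1 ys => exact (Run.pure ⟨by simp, hy⟩).le (Nat.zero_le _)
  | case2 x xs => exact (Run.pure ⟨by simp, hx⟩).le (Nat.zero_le _)
  | case3 x xs y ys ih1 ih2 =>
    have ih1 := ih1 (fun a ha => hx a (by simp [ha])) hy
    have ih2 := ih2 hx (fun a ha => hy a (by simp [ha]))
    refine (Run.bind tick_run fun _ _ => Run.bind (hle x y (hx x (by simp)) (hy y (by simp)))
      fun b _ => Run.ite (fun _ => Run.bind ih1 fun l hl => Run.pure ?_)
        (fun _ => Run.bind ih2 fun l hl => Run.pure ?_)).le ?_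
    · refine ⟨by simp [hl.1]; omega, ?_⟩
      simpa [hx x] using hl.2
    · refine ⟨by simp [hl.1]; omega, ?_⟩
      simpa [hy y] using hl.2
    · simp only [List.length_cons, add_zero]
      rw [show xs.length + (ys.length + 1) = xs.length + 1 + ys.length by ring, max_self]
      nlinarith

/-- Merge sort of a list of length at most `2 ^ j` has `j` rounds, each of which visits every
element a bounded number of times. -/
theorem sortAux_run {α : Type} {s : ℕ} {P : α → Prop} {le : α → α → Comp Bool}
    (hle : ∀ a b, P a → P b → Run β.M s (le a b) fun _ => True) (j : ℕ) :
    ∀ (k : ℕ) (l : List α), l.length ≤ 2 ^ j → (∀ a ∈ l, P a) →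
      Run β.M (l.length * j * (s + 2)) (sortAux le k l) fun l' =>
        l'.length = l.length ∧ ∀ a ∈ l', P a := by
  induction j with
  | zero =>
    intro k l hl h
    match k, l with
    | 0, l => exact (Run.pure ⟨rfl, h⟩).le (Nat.zero_le _)
    | _ + 1, [] => exact (Run.pure ⟨rfl, h⟩).le (Nat.zero_le _)
    | _ + 1, [a] => exact (Run.pure ⟨rfl, h⟩).le (Nat.zero_le _)
    | _ + 1, a :: b :: l => simp at hl
  | succ j ih =>
    intro k l hl h
    match k, l with
    | 0, l => exact (Run.pure ⟨rfl, h⟩).le (Nat.zero_le _)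
    | _ + 1, [] => exact (Run.pure ⟨rfl, h⟩).le (Nat.zero_le _)
    | _ + 1, [a] => exact (Run.pure ⟨rfl, h⟩).le (Nat.zero_le _)
    | k + 1, a :: b :: l =>
      set L := a :: b :: l with hL
      have key : ∀ p : List α × List α, (p.1.length = (L.length + 1) / 2 ∧
          p.2.length = L.length / 2 ∧ (∀ a ∈ p.1, P a) ∧ ∀ a ∈ p.2, P a) →
          Run β.M (L.length * j * (s + 2) + L.length * (s + 1)) (do
            let l₁ ← sortAux le k p.1
            let l₂ ← sortAux le k p.2
            mergeC le l₁ l₂) fun l' => l'.length = L.length ∧ ∀ a ∈ l', P a := by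
        rintro ⟨p, q⟩ ⟨h1, h2, h3, h4⟩
        simp only at h1 h2 h3 h4 ⊢
        have hsum : p.length + q.length = L.length := by omega
        rw [pow_succ] at hl
        refine (Run.bind (ih k p (by omega) h3) fun l₁ hl₁ =>
          Run.bind (s' := L.length * (s + 1)) (ih k q (by omega) h4) fun l₂ hl₂ => ?_).le ?_
        · have := mergeC_run hle l₁ l₂ hl₁.2 hl₂.2
          rw [hl₁.1, hl₂.1, hsum] at this
          exact this
        · rw [← hsum]
          nlinarith
      refine (Run.bind (splitC_run L h) key).le ?_
      nlinarith

theorem sortC_run {α : Type} {s j : ℕ} {P : α → Prop} {le : α → α → Comp Bool}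
    (hle : ∀ a b, P a → P b → Run β.M s (le a b) fun _ => True) (l : List α)
    (hl : l.length ≤ 2 ^ j) (h : ∀ a ∈ l, P a) :
    Run β.M (l.length * j * (s + 2)) (sortC le l) fun l' =>
      l'.length = l.length ∧ ∀ a ∈ l', P a :=
  sortAux_run hle j _ l hl h

/-! ### Cost of the geometric primitives -/

/-- All numbers that describe the ball have level at most `l`. -/
structure Ball.Lv {d n : ℕ} (β : Budget) (l : ℕ) (b : Ball d n) : Prop where
  centre : ∀ k, β.Lv l (b.centre k)
  radSq : β.Lv l b.radSq

/-- All numbers that describe the disk have level at most `l`. -/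
structure Disk.Lv {n : ℕ} (β : Budget) (l : ℕ) (b : Disk n) : Prop where
  x : β.Lv l b.x
  y : β.Lv l b.y
  radSq : β.Lv l b.radSq

/-- All numbers that describe the event have level at most `l`. -/
structure Event.Lv {n : ℕ} (β : Budget) (l : ℕ) (e : Event n) : Prop where
  other : e.other.Lv β l
  x₀ : β.Lv l e.x₀
  x₁ : β.Lv l e.x₁
  y₀ : β.Lv l e.y₀
  y₁ : β.Lv l e.y₁
  δ : β.Lv l e.δ

/-- All numbers that describe the chord have level at most `l`. -/
structure Chord.Lv {n : ℕ} (β : Budget) (l : ℕ) (c : Chord n) : Prop where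
  other : c.other.Lv β l
  p : β.Lv l c.p
  q : β.Lv l c.q
  p' : β.Lv l c.p'
  q' : β.Lv l c.q'
  normSq' : β.Lv l c.normSq'
  α : β.Lv l c.α
  δ : β.Lv l c.δ

/-- All numbers that describe the interval have level at most `l`. -/
structure Interval.Lv (β : Budget) (l : ℕ) (J : Interval) : Prop where
  s : β.Lv l J.s
  σ : β.Lv l J.σ

/-- All numbers that describe the hyperplane have level at most `l`. -/
structure Hyperplane.Lv {d : ℕ} (β : Budget) (l : ℕ) (h : Hyperplane d) : Prop where
  normal : ∀ k, β.Lv l (h.normal k)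
  offset : β.Lv l h.offset
  normSq : β.Lv l h.normSq

theorem Ball.Lv.mono {d n l l' : ℕ} {b : Ball d n} (h : b.Lv β l) (hl : l ≤ l') : b.Lv β l' :=
  ⟨fun k => (h.centre k).mono hl, h.radSq.mono hl⟩

theorem Disk.Lv.mono {n l l' : ℕ} {b : Disk n} (h : b.Lv β l) (hl : l ≤ l') : b.Lv β l' :=
  ⟨h.x.mono hl, h.y.mono hl, h.radSq.mono hl⟩

theorem Hyperplane.Lv.mono {d l l' : ℕ} {h : Hyperplane d} (hh : h.Lv β l) (hl : l ≤ l') :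
    h.Lv β l' :=
  ⟨fun k => (hh.normal k).mono hl, hh.offset.mono hl, hh.normSq.mono hl⟩

theorem position_run (l : ℕ) {l₁ l₂ l₃ : ℕ} {ρ ρ' D : ℚ} (h₁ : β.Lv l₁ ρ) (h₂ : β.Lv l₂ ρ')
    (h₃ : β.Lv l₃ D) (hl : l + 3 ≤ β.Λ := by omega) (hl₁ : l₁ ≤ l := by omega)
    (hl₂ : l₂ ≤ l := by omega) (hl₃ : l₃ ≤ l := by omega) :
    Run β.M 8 (position ρ ρ' D) fun _ => True := by
  refine (Run.bind (qadd_run l h₁ h₂) fun s hs => Run.bind (qsub_run (l + 1) hs h₃) fun s hs =>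
    Run.bind (qmul_run (l + 2) hs hs) fun s2 hs2 => Run.bind (qmul_run l h₁ h₂) fun q hq =>
    Run.bind (qmul_run (l + 1) (Budget.lv_of_bitLength_le (l := l) (by decide)) hq) fun q4 hq4 =>
    Run.bind (qlt_run (l + 3) hs2 hq4) fun cr _ => Run.ite (fun _ => Run.pure trivial) fun _ =>
    Run.bind (qlt_run (l + 2) hs (β.lv_zero (l := 0))) fun ap _ =>
      Run.ite (fun _ => Run.pure trivial) fun _ =>
    Run.bind (qlt_run l h₂ h₁) fun lt _ => Run.pure trivial).le (by omega)

theorem ballPosition_run {d n : ℕ} (l : ℕ) {b b' : Ball d n} (hb : b.Lv β l) (hb' : b'.Lv β l)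
    (hl : l + d + 5 ≤ β.Λ := by omega) :
    Run β.M (5 * d + 8) (ballPosition b b') fun _ => True :=
  (Run.bind (vsub_run l hb'.centre hb.centre) fun _ hw => Run.bind (dotC_run (l + 1) hw hw)
    fun _ hD => position_run (l + d + 2) hb.radSq hb'.radSq hD).le (by omega)

theorem sqRadius_run {d n m : ℕ} (I : Election d n m) (i : Fin n)
    (hv : ∀ i k, β.Lv 0 (I.voter i k)) (hc : ∀ j k, β.Lv 0 (I.cand j k))
    (hl : d + 5 ≤ β.Λ) :
    Run β.M (m * (5 * d + 2)) (sqRadius I i) fun r => β.Lv (d + 2) r := by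
  have hd : ∀ j, Run β.M (5 * d) (do
      let w ← vsub (I.voter i) (I.cand j)
      dotC w w) fun r => β.Lv (d + 2) r := fun j =>
    (Run.bind (vsub_run 0 (hv i) (hc j)) fun _ hw =>
      (dotC_run 1 hw hw).mono le_rfl fun _ h => h.mono (by omega)).le (by omega)
  have hlen := List.length_finRange (n := m)
  unfold sqRadius
  generalize List.finRange m = js at hlen
  cases js with
  | nil => exact (Run.pure β.lv_zero).le (Nat.zero_le _)
  | cons j js =>
    refine (Run.bind (hd j) fun r hr => foldC_run' (fun r => β.Lv (d + 2) r) js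
      (fun r hr j _ => Run.bind (hd j) fun s hs => Run.bind (qlt_run (d + 2) hs hr) fun b _ =>
        Run.pure ?_) hr).le ?_
    · split_ifs <;> assumption
    · rw [List.length_cons] at hlen
      have : (js.length + 1) * (5 * d + 2) = m * (5 * d + 2) := by rw [hlen]
      nlinarith

theorem sgn_run (l : ℕ) {l₁ : ℕ} {a : ℚ} (h : β.Lv l₁ a) (hl : l ≤ β.Λ := by omega)
    (hl₁ : l₁ ≤ l := by omega) : Run β.M 2 (sgn a) fun _ => True :=
  (Run.bind (qlt_run l (β.lv_zero (l := 0)) h) fun _ _ => Run.ite (fun _ => Run.pure trivial) fun _ =>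
    Run.bind (qlt_run l h (β.lv_zero (l := 0))) fun _ _ => Run.pure trivial).le (by omega)

theorem sgnSqrt_run (l : ℕ) {l₁ l₂ l₃ : ℕ} {A B δ : ℚ} (h₁ : β.Lv l₁ A) (h₂ : β.Lv l₂ B)
    (h₃ : β.Lv l₃ δ) (hl : l + 3 ≤ β.Λ := by omega) (hl₁ : l₁ ≤ l := by omega)
    (hl₂ : l₂ ≤ l := by omega) (hl₃ : l₃ ≤ l := by omega) :
    Run β.M 11 (sgnSqrt A B δ) fun _ => True := by
  refine (Run.bind (sgn_run l h₁) fun a _ => Run.bind (sgn_run l h₂) fun b _ =>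
    Run.bind tick_run fun _ _ => Run.ite (fun _ => Run.pure trivial) fun _ =>
    Run.ite (fun _ => Run.pure trivial) fun _ =>
    Run.bind (qmul_run l h₁ h₁) fun _ hA => Run.bind (qmul_run l h₂ h₂) fun _ hB =>
    Run.bind (qmul_run (l + 1) hB h₃) fun _ hB' => Run.bind (qsub_run (l + 2) hA hB') fun _ ht =>
    Run.bind (sgn_run (l + 3) ht) fun _ _ => Run.pure trivial).le (by omega)

theorem sgnSqrt₂_run (l : ℕ) {l₁ l₂ l₃ l₄ l₅ : ℕ} {A B δ C ε : ℚ} (h₁ : β.Lv l₁ A)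
    (h₂ : β.Lv l₂ B) (h₃ : β.Lv l₃ δ) (h₄ : β.Lv l₄ C) (h₅ : β.Lv l₅ ε)
    (hl : l + 7 ≤ β.Λ := by omega) (hl₁ : l₁ ≤ l := by omega) (hl₂ : l₂ ≤ l := by omega)
    (hl₃ : l₃ ≤ l := by omega) (hl₄ : l₄ ≤ l := by omega) (hl₅ : l₅ ≤ l := by omega) :
    Run β.M 34 (sgnSqrt₂ A B δ C ε) fun _ => True := by
  refine (Run.bind (sgnSqrt_run l h₁ h₂ h₃) fun a _ => Run.bind (sgn_run l h₄) fun b _ =>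
    Run.bind tick_run fun _ _ => Run.ite (fun _ => Run.pure trivial) fun _ =>
    Run.ite (fun _ => Run.pure trivial) fun _ =>
    Run.bind (qmul_run l h₁ h₁) fun _ hA => Run.bind (qmul_run l h₂ h₂) fun _ hB =>
    Run.bind (qmul_run (l + 1) hB h₃) fun _ hB' => Run.bind (qmul_run l h₄ h₄) fun _ hC =>
    Run.bind (qmul_run (l + 1) hC h₅) fun _ hC' => Run.bind (qadd_run (l + 2) hA hB') fun _ ht =>
    Run.bind (qsub_run (l + 3) ht hC') fun _ ht => Run.bind (qmul_run l h₁ h₂) fun _ hAB =>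
    Run.bind (qmul_run (l + 1) (Budget.lv_of_bitLength_le (l := l) (by decide)) hAB)
      fun _ hAB =>
    Run.bind (sgnSqrt_run (l + 4) ht hAB h₃) fun _ _ => Run.pure trivial).le (by omega)

theorem innerC_run (l : ℕ) {l₁ l₂ l₃ l₄ l₅ l₆ : ℕ} {g₁ g₂ p q p' q' : ℚ} (h₁ : β.Lv l₁ g₁)
    (h₂ : β.Lv l₂ g₂) (h₃ : β.Lv l₃ p) (h₄ : β.Lv l₄ q) (h₅ : β.Lv l₅ p') (h₆ : β.Lv l₆ q')
    (hl : l + 3 ≤ β.Λ := by omega) (hl₁ : l₁ ≤ l := by omega) (hl₂ : l₂ ≤ l := by omega)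
    (hl₃ : l₃ ≤ l := by omega) (hl₄ : l₄ ≤ l := by omega) (hl₅ : l₅ ≤ l := by omega)
    (hl₆ : l₆ ≤ l := by omega) :
    Run β.M 5 (innerC g₁ g₂ p q p' q') fun r => β.Lv (l + 3) r :=
  (Run.bind (qmul_run l h₃ h₅) fun _ hs => Run.bind (qmul_run (l + 1) h₁ hs) fun _ hs =>
    Run.bind (qmul_run l h₄ h₆) fun _ ht => Run.bind (qmul_run (l + 1) h₂ ht) fun _ ht =>
    qadd_run (l + 2) hs ht).le (by omega)

theorem chord_run {n : ℕ} (l : ℕ) {g₁ g₂ p q D : ℚ} {b b' : Disk n} (h₁ : β.Lv l g₁)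
    (h₂ : β.Lv l g₂) (hb : b.Lv β l) (hb' : b'.Lv β l) (hp : β.Lv l p) (hq : β.Lv l q)
    (hD : β.Lv l D) (hl : l + 7 ≤ β.Λ := by omega) :
    Run β.M 15 (chord g₁ g₂ b b' p q D) fun c => c.Lv β (l + 7) :=
  (Run.bind (qadd_run l hD hb.radSq) fun _ hκ => Run.bind (qsub_run (l + 1) hκ hb'.radSq)
    fun _ hκ => Run.bind (qdiv_run (l + 2) hκ (Budget.lv_of_bitLength_le (l := l) (by decide)))
    fun _ hκ => Run.bind (qdiv_run (l + 3) hκ hD) fun _ hα =>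
    Run.bind (qmul_run l h₂ hq) fun _ hp' =>
    Run.bind (qsub_run (l + 1) (β.lv_zero (l := 0)) hp') fun _ hp' =>
    Run.bind (qmul_run l h₁ hp) fun _ hq' =>
    Run.bind (innerC_run (l + 2) h₁ h₂ hp' hq' hp' hq') fun _ hE =>
    Run.bind (qmul_run (l + 4) hα hκ) fun _ ht => Run.bind (qsub_run (l + 5) hb.radSq ht)
    fun _ ht => Run.bind (qdiv_run (l + 6) ht hE) fun _ hδ =>
    Run.pure ⟨hb'.mono (by omega), hp.mono (by omega), hq.mono (by omega), hp'.mono (by omega),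
      hq'.mono (by omega), hE.mono (by omega), hα.mono (by omega), hδ⟩).le (by omega)

theorem chordEnd_run {n : ℕ} (l : ℕ) {c : Chord n} (hc : c.Lv β l) (entry : Bool)
    (hl : l + 1 ≤ β.Λ := by omega) :
    Run β.M 4 (chordEnd c entry) fun e => e.Lv β (l + 1) :=
  (Run.bind (qmul_run l hc.α hc.p) fun _ hx => Run.bind (qmul_run l hc.α hc.q) fun _ hy =>
    Run.ite (fun _ => Run.pure ⟨hc.other.mono (by omega), hx, hc.p'.mono (by omega), hy,
      hc.q'.mono (by omega), hc.δ.mono (by omega)⟩) fun _ =>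
    Run.bind (qsub_run l (β.lv_zero (l := 0)) hc.p') fun _ hx₁ =>
    Run.bind (qsub_run l (β.lv_zero (l := 0)) hc.q') fun _ hy₁ =>
    Run.pure ⟨hc.other.mono (by omega), hx, hx₁, hy, hy₁, hc.δ.mono (by omega)⟩).le (by omega)

theorem cmpEvent_run {n : ℕ} (l : ℕ) {e f : Event n} (he : e.Lv β l) (hf : f.Lv β l)
    (hl : l + 8 ≤ β.Λ := by omega) :
    Run β.M 59 (cmpEvent e f) fun _ => True :=
  (Run.bind (sgnSqrt_run l he.y₀ he.y₁ he.δ) fun _ _ =>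
    Run.bind (sgnSqrt_run l hf.y₀ hf.y₁ hf.δ) fun _ _ => Run.bind tick_run fun _ _ =>
    Run.ite (fun _ => Run.pure trivial) fun _ => Run.ite (fun _ => Run.pure trivial) fun _ =>
    Run.bind (qsub_run l he.x₀ hf.x₀) fun _ hA =>
    Run.bind (qsub_run l (β.lv_zero (l := 0)) hf.x₁) fun _ hC =>
    Run.bind (sgnSqrt₂_run (l + 1) hA he.x₁ he.δ hC hf.δ) fun _ _ => Run.pure trivial).le
    (by omega)

theorem leEvent_run {n : ℕ} (l : ℕ) {e f : Event n} (he : e.Lv β l) (hf : f.Lv β l)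
    (hl : l + 8 ≤ β.Λ := by omega) :
    Run β.M 60 (leEvent e f) fun _ => True :=
  (Run.bind (cmpEvent_run l he hf) fun _ _ => Run.bind tick_run fun _ _ => Run.pure trivial).le
    (by omega)

/-- The lists of a view of at most `k` disks. -/
structure View.Lv {n : ℕ} (β : Budget) (l k : ℕ) (V : View n) : Prop where
  containing : ∀ b ∈ V.containing, b.Lv β l
  chords : ∀ c ∈ V.chords, c.Lv β l
  length_le : V.containing.length + V.chords.length ≤ k

theorem view_run {n : ℕ} (l : ℕ) {g₁ g₂ : ℚ} {disks : List (Disk n)} {b : Disk n}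
    (h₁ : β.Lv l g₁) (h₂ : β.Lv l g₂) (hb : b.Lv β l) (hd : ∀ b ∈ disks, b.Lv β l)
    (hl : l + 11 ≤ β.Λ := by omega) :
    Run β.M (disks.length * 31) (view g₁ g₂ disks b)
      fun V => V.Lv β (l + 11) disks.length := by
  refine foldC_run (fun j (V : View n) => V.Lv β (l + 11) j) disks (fun j V _ hV b' hb' => ?_)
    ⟨by simp, by simp, by simp⟩
  have hb'' := hd b' hb'
  refine (Run.bind (s' := 29) (qsub_run l hb''.x hb.x) fun p hp =>
    Run.bind (s' := 28) (qsub_run l hb''.y hb.y)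
    fun q hq => Run.bind (s' := 23) (innerC_run (l + 1) h₁ h₂ hp hq hp hq) fun D hD =>
    Run.bind (s' := 15) (position_run (l + 4) hb.radSq hb''.radSq hD) fun pos _ => ?_).le (by omega)
  cases pos with
  | crossing =>
    refine Run.bind (s := 15) (chord_run (l + 4) (h₁.mono (by omega)) (h₂.mono (by omega))
      (hb.mono (by omega)) (hb''.mono (by omega)) (hp.mono (by omega)) (hq.mono (by omega))
      (hD.mono (by omega))) fun c hc => Run.pure ⟨hV.containing, ?_, ?_⟩
    · simpa [hc] using hV.chords
    · have := hV.length_le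
      simp only [List.length_cons]
      omega
  | inside =>
    refine (Run.pure ⟨?_, hV.chords, ?_⟩).le (Nat.zero_le _)
    · simpa [hb''.mono (show l ≤ l + 11 by omega)] using hV.containing
    · have := hV.length_le
      simp only [List.length_cons]
      omega
  | outside =>
    exact (Run.pure ⟨hV.containing, hV.chords, hV.length_le.trans (by omega)⟩).le (Nat.zero_le _)
  | apart =>
    exact (Run.pure ⟨hV.containing, hV.chords, hV.length_le.trans (by omega)⟩).le (Nat.zero_le _)

end OCP

namespace OCP
variable {β : Budget}

/-! ### Cost of the planar algorithm -/

/-- The sweep after `j` events, started with `k` disks. -/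
structure Sweep.Lv {n : ℕ} (β : Budget) (l k j : ℕ) (s : Sweep n) : Prop where
  cur_le : s.cur ≤ k + j
  best_le : s.best ≤ k + j
  past : ∀ e ∈ s.past, e.Lv β l
  bestPast : ∀ e ∈ s.bestPast, e.Lv β l
  past_length : s.past.length ≤ j
  bestPast_length : s.bestPast.length ≤ j

theorem sweepStep_run {n : ℕ} {l k j : ℕ} {s : Sweep n} {e : Event n} (hs : s.Lv β l k j)
    (he : e.Lv β l) (hN : k + j + 1 ≤ β.N) :
    Run β.M 2 (sweepStep s e) fun s => s.Lv β l k (j + 1) := by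
  have h1 := hs.cur_le
  have h2 := hs.best_le
  have h3 := hs.past_length
  have h4 := hs.bestPast_length
  have hp : ∀ x ∈ e :: s.past, x.Lv β l := by simpa [he] using hs.past
  have hcur : Run β.M 1 (if e.entry then nadd s.cur 1 else nsub s.cur 1)
      fun c => c ≤ k + (j + 1) :=
    (Run.ite (fun _ => (nadd_run (by omega) (by omega)).mono le_rfl (by omega))
      fun _ => (nsub_run (by omega) (by omega)).mono le_rfl (by omega)).le (by omega)
  have key : ∀ c, c ≤ k + (j + 1) → Run β.M 1 (do
      let lt ← nlt s.best c
      pure (if lt then (⟨c, e :: s.past, c, e :: s.past⟩ : Sweep n)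
        else ⟨c, e :: s.past, s.best, s.bestPast⟩)) fun s => s.Lv β l k (j + 1) := by
    intro c hc
    refine Run.bind (s' := 0) (nlt_run (by omega) (by omega)) fun b _ => Run.pure ?_
    split_ifs
    · exact ⟨hc, hc, hp, hp, by simpa using h3, by simpa using h3⟩
    · exact ⟨hc, by simp only; omega, hp, hs.bestPast, by simpa using h3, by simp only; omega⟩
  have := Run.bind hcur key
  unfold sweepStep
  cases h : e.entry
  · simp only [h, Bool.false_eq_true, if_false] at this ⊢
    exact this
  · simp only [h, if_true] at this ⊢
    exact this

/-- The best arc of a circle, found among `k` disks. -/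
structure BestArc.Lv {n : ℕ} (β : Budget) (l k : ℕ) (A : BestArc n) : Prop where
  disk : A.disk.Lv β l
  view : A.view.Lv β l k
  first : ∀ b ∈ A.first, b.Lv β l
  past : ∀ e ∈ A.past, e.Lv β l
  first_length : A.first.length ≤ k
  past_length : A.past.length ≤ 2 * k
  count_le : A.count ≤ 4 * k

theorem View.Lv.mono {n l l' k : ℕ} {V : View n} (h : V.Lv β l k) (hl : l ≤ l') : V.Lv β l' k :=
  ⟨fun b hb => (h.containing b hb).mono hl, fun c hc =>
    have h' := h.chords c hc
    ⟨h'.other.mono hl, h'.p.mono hl, h'.q.mono hl, h'.p'.mono hl, h'.q'.mono hl,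
      h'.normSq'.mono hl, h'.α.mono hl, h'.δ.mono hl⟩, h.length_le⟩

theorem bestArc_run {n : ℕ} (l : ℕ) {g₁ g₂ : ℚ} {disks : List (Disk n)} {b : Disk n} {j : ℕ}
    (h₁ : β.Lv l g₁) (h₂ : β.Lv l g₂) (hb : b.Lv β l) (hd : ∀ b ∈ disks, b.Lv β l)
    (hj : 2 * disks.length ≤ 2 ^ j) (hN : 4 * disks.length + 1 ≤ β.N)
    (hl : l + 20 ≤ β.Λ := by omega) :
    Run β.M (disks.length * (124 * j + 150) + 1) (bestArc g₁ g₂ disks b)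
      fun A => A.Lv β (l + 12) disks.length := by
  set k := disks.length with hk
  unfold bestArc
  refine Run.le (Run.bind (s' := 119 * k + 124 * (k * j) + 1) (view_run l h₁ h₂ hb hd)
    fun V hV => ?_) (by rw [← hk]; nlinarith)
  have hcl := hV.length_le
  set m := V.chords.length with hm
  have hends := mapC_run (β := β) (s := 8) (f := fun c : Chord n => do
      let e ← chordEnd c true
      let f ← chordEnd c false
      pure (e, f)) (Q := fun p : Event n × Event n => p.1.Lv β (l + 12) ∧ p.2.Lv β (l + 12))
    V.chords fun c hc => (Run.bind (chordEnd_run (l + 11) (hV.chords c hc) true) fun e he =>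
      Run.bind (chordEnd_run (l + 11) (hV.chords c hc) false) fun f hf =>
        Run.pure ⟨he, hf⟩).le (by omega)
  refine Run.le (Run.bind (s' := 110 * k + 124 * (k * j) + 1) hends fun ends hends => ?_) (by nlinarith)
  have hfirst := filterMapC_run (β := β) (s := 60) (f := fun p : Event n × Event n => do
      let s ← cmpEvent p.2 p.1
      tick
      pure (if s < 0 then some p.1.other else none)) (Q := fun b => b.Lv β (l + 12)) ends
    fun p hp => (Run.bind (cmpEvent_run (l + 12) (hends.2 p hp).2 (hends.2 p hp).1) fun s _ =>
      Run.bind tick_run fun _ _ => Run.pure (by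
        intro b hb
        split_ifs at hb with h
        · obtain rfl : p.1.other = b := by simpa using hb
          exact (hends.2 p hp).1.other
        · simp at hb)).le (by omega)
  refine Run.le (Run.bind (s' := 49 * k + 124 * (k * j) + 1) hfirst fun first hfirst => ?_)
    (by rw [hends.1]; nlinarith)
  rw [hends.1] at hfirst
  have hev := foldC_run (β := β) (s := 0)
    (f := fun l (p : Event n × Event n) => pure (p.1 :: p.2 :: l))
    (fun i (l' : List (Event n)) => l'.length = 2 * i ∧ ∀ e ∈ l', e.Lv β (l + 12)) ends
    (fun i l' _ hl' p hp => Run.pure ⟨by simp [hl'.1]; omega, by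
      simpa [(hends.2 p hp).1, (hends.2 p hp).2] using hl'.2⟩) (b := []) (by simp)
  refine Run.le (Run.bind (s' := 48 * k + 124 * (k * j) + 1) hev fun evs hevs => ?_)
    (by rw [hends.1]; nlinarith)
  rw [hends.1] at hevs
  have hsort := sortC_run (β := β) (s := 60) (j := j) (P := fun e : Event n => e.Lv β (l + 12))
    (le := leEvent) (fun e f he hf => leEvent_run (l + 12) he hf) evs (by omega) hevs.2
  refine Run.le (Run.bind (s' := 48 * k + 1) hsort fun evs' hevs' => ?_)
    (by
      have : evs.length * j ≤ 2 * k * j := Nat.mul_le_mul_right _ (by omega)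
      nlinarith)
  rw [hevs.1] at hevs'
  refine Run.le (Run.bind (s' := 46 * k + 1) (lengthC_run first (by omega)) fun c hc => ?_)
    (by omega)
  have hsw := foldC_run (β := β) (f := sweepStep) (fun j s => s.Lv β (l + 12) c j) evs'
    (fun i s hi hs e he => sweepStep_run hs (hevs'.2 e he) (by omega)) (b := ⟨c, [], c, []⟩)
    ⟨le_rfl, le_rfl, by simp, by simp, le_rfl, le_rfl⟩
  refine Run.le (Run.bind (s' := 40 * k + 1) hsw fun s hs => ?_) (by omega)
  have hs2 := hs.best_le
  have hs3 := hs.bestPast_length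
  refine Run.le (Run.bind (s' := 1) (lengthC_run V.containing (by omega)) fun c' hc' => ?_)
    (by omega)
  refine Run.bind (s' := 0) (nadd_run (by omega) (by omega)) fun t ht => Run.pure ?_
  exact ⟨hb.mono (by omega), hV.mono (by omega), hfirst.2, hs.bestPast, by simp only; omega,
    by simp only; omega, by simp only; omega⟩

theorem members_run {n l k : ℕ} {A : BestArc n} (hA : A.Lv β l k) :
    Run β.M (12 * k * k + 20 * k) (members A)
      fun S => S.length ≤ 4 * k ∧ ∀ b ∈ S, b.Lv β l := by
  have hp := hA.past_length
  have hf := hA.first_length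
  have hv := hA.view.length_le
  have hev := foldC_run (β := β) (s := 0) (f := fun l (e : Event n) => pure (e :: l))
    (fun i (l' : List (Event n)) => l'.length = i ∧ ∀ e ∈ l', e.Lv β l) A.past
    (fun i l' _ hl' p hp => Run.pure ⟨by simp [hl'.1], by
      simpa [hA.past p hp] using hl'.2⟩) (b := []) (by simp)
  refine Run.le (Run.bind (s' := 12 * k * k + 18 * k) hev fun evs hevs => ?_) (by nlinarith)
  have hS := foldC_run (β := β) (s := 6 * k)
    (f := fun S (e : Event n) => if e.entry then pure (e.other :: S)
      else filterMapC (fun b : Disk n => do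
        tick
        pure (if b.id = e.other.id then none else some b)) S)
    (fun i (S : List (Disk n)) => S.length ≤ k + i ∧ ∀ b ∈ S, b.Lv β l) evs
    (fun i S hi hS e he => by
      refine (Run.ite (fun _ => Run.pure ⟨by simp; omega, ?_⟩) fun _ =>
        ((filterMapC_run (s := 1) (Q := fun b : Disk n => b.Lv β l) S fun b hb =>
          Run.bind (s' := 0) tick_run fun _ _ => Run.pure ?_).mono le_rfl
          fun S' hS' => ⟨by omega, hS'.2⟩)).le (by omega)
      · intro b' hb'
        split_ifs at hb'
        · simp at hb'
        · obtain rfl : b = b' := by simpa using hb'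
          exact hS.2 b hb
      · simpa [(hevs.2 e he).other] using hS.2) (b := A.first) ⟨by omega, hA.first⟩
  refine Run.le (Run.bind (s' := k) hS fun S hS => ?_) (by
    have : evs.length * (6 * k + 1) ≤ 2 * k * (6 * k + 1) := Nat.mul_le_mul_right _ (by omega)
    nlinarith)
  refine (foldC_run (s := 0) (f := fun S (b : Disk n) => pure (b :: S))
    (fun i (S : List (Disk n)) => S.length ≤ 3 * k + i ∧ ∀ b ∈ S, b.Lv β l) A.view.containing
    (fun i S' hi hS' b hb => Run.pure ⟨by simp; omega, ?_⟩) ⟨by omega, hS.2⟩).mono (by omega)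
    fun S hS => ⟨by omega, hS.2⟩
  simpa [hA.view.containing b hb] using hS'.2

theorem trace_run {n : ℕ} (l : ℕ) {g₁ g₂ : ℚ} {b b' : Disk n} {c : Chord n}
    (h₁ : β.Lv l g₁) (h₂ : β.Lv l g₂) (hb : b.Lv β l) (hc : c.Lv β l) (hb' : b'.Lv β l)
    (hl : l + 10 ≤ β.Λ := by omega) :
    Run β.M 21 (trace g₁ g₂ b c b') fun J => J.Lv β (l + 10) :=
  (Run.bind (qmul_run l hc.α hc.p) fun _ ht => Run.bind (qadd_run (l + 1) hb.x ht) fun _ hx =>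
    Run.bind (qsub_run (l + 2) hb'.x hx) fun _ hx =>
    Run.bind (qmul_run l hc.α hc.q) fun _ ht => Run.bind (qadd_run (l + 1) hb.y ht) fun _ hy =>
    Run.bind (qsub_run (l + 2) hb'.y hy) fun _ hy =>
    Run.bind (innerC_run (l + 3) h₁ h₂ hx hy hc.p' hc.q') fun _ ht =>
    Run.bind (qdiv_run (l + 6) ht hc.normSq') fun _ hs =>
    Run.bind (qmul_run (l + 7) hs ht) fun _ hst =>
    Run.bind (innerC_run (l + 3) h₁ h₂ hx hy hx hy) fun _ hN =>
    Run.bind (qsub_run (l + 6) hb'.radSq hN) fun _ hh =>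
    Run.bind (qadd_run (l + 8) hh hst) fun _ hh =>
    Run.bind (qdiv_run (l + 9) hh hc.normSq') fun _ hσ =>
    Run.pure ⟨hs.mono (by omega), hσ⟩).le (by omega)

theorem inInterval_run (l : ℕ) {r : ℚ} {J : Interval} (hr : β.Lv l r) (hJ : J.Lv β l)
    (hl : l + 2 ≤ β.Λ := by omega) : Run β.M 3 (inInterval r J) fun _ => True :=
  (Run.bind (qsub_run l hr hJ.s) fun _ ht => Run.bind (qmul_run (l + 1) ht ht) fun _ ht =>
    qlt_run (l + 2) ht hJ.σ).le (by omega)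

theorem commonPoint_run (l : ℕ) {J : Interval} {Js : List Interval}
    (hJ : ∀ K ∈ J :: Js, K.Lv β l) (hl : l + 8 ≤ β.Λ := by omega) :
    Run β.M (84 * (J :: Js).length + 40) (commonPoint J Js)
      fun o => ∀ a ∈ o, β.Lv (l + 5) a := by
  have hJ0 : J.Lv β l := hJ J (by simp)
  have hJs : ∀ K ∈ Js, K.Lv β l := fun K hK => hJ K (by simp [hK])
  have hend : ∀ l₀ : Interval, l₀.Lv β l → ∀ r : Interval, r.Lv β l → ∀ e, β.Lv (l + 5) e →
      Run β.M (12 * (J :: Js).length + 3) (foldC (fun found a => do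
        let ok ← allC (inInterval a) (J :: Js)
        pure (if ok then some a else found)) none [l₀.s, r.s, e])
        fun o => ∀ a ∈ o, β.Lv (l + 5) a := by
    intro l₀ h0 r hr e he
    refine (foldC_run' (fun o : Option ℚ => ∀ a ∈ o, β.Lv (l + 5) a) [l₀.s, r.s, e]
      (fun o ho a ha => ?_) (by simp)).le
      (s := 3 * ((J :: Js).length * 4 + 0 + 1)) (by omega)
    have ha' : β.Lv (l + 5) a := by
      simp only [List.mem_cons, List.not_mem_nil, or_false] at ha
      rcases ha with rfl | rfl | rfl
      · exact h0.s.mono (by omega)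
      · exact hr.s.mono (by omega)
      · exact he
    refine Run.bind (allC_run (s := 3) _ fun K hK =>
      inInterval_run (l + 5) ha' ⟨(hJ K hK).s.mono (by omega), (hJ K hK).σ.mono (by omega)⟩)
      fun ok _ => Run.pure ?_
    split_ifs
    · simpa using ha'
    · exact ho
  have c1 : ∀ q : ℚ, bitLength q ≤ 6 → β.Lv (l + 1) q := fun q hq =>
    Budget.lv_of_bitLength_le hq
  unfold commonPoint
  refine Run.le (Run.bind (foldC_run' (s := 35) (fun l' : Interval => l'.Lv β l) Js
    (fun l' hl' K hK => (Run.bind (qsub_run l (hJs K hK).s hl'.s) fun A hA =>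
      Run.bind (sgnSqrt₂_run (l + 1) hA (c1 (-1) (by decide)) (hJs K hK).σ (c1 1 (by decide)) hl'.σ)
        fun t _ => Run.pure (by split_ifs; exacts [hJs K hK, hl'])).le (by omega)) hJ0)
    fun l₀ h0 => Run.bind (foldC_run' (s := 35) (fun l' : Interval => l'.Lv β l) Js
    (fun l' hl' K hK => (Run.bind (qsub_run l (hJs K hK).s hl'.s) fun A hA =>
      Run.bind (sgnSqrt₂_run (l + 1) hA (c1 1 (by decide)) (hJs K hK).σ (c1 (-1) (by decide)) hl'.σ)
        fun t _ => Run.pure (by split_ifs; exacts [hJs K hK, hl'])).le (by omega)) hJ0)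
    fun r hr => Run.bind (qmul_run l hr.s hr.s) fun _ hr2 =>
    Run.bind (qmul_run l h0.s h0.s) fun _ hl2 =>
    Run.bind (qsub_run (l + 1) hr2 hl2) fun _ ht => Run.bind (qadd_run (l + 2) ht h0.σ) fun _ ht =>
    Run.bind (qsub_run (l + 3) ht hr.σ) fun t ht => Run.bind (qsub_run l hr.s h0.s) fun _ hw =>
    Run.bind (qmul_run (l + 1) (c1 2 (by decide)) hw) fun w hw => Run.bind (sgn_run (l + 2) hw)
    fun z _ => Run.bind tick_run fun _ _ => Run.ite
      (fun _ => Run.bind (Run.pure (Q := fun e => β.Lv (l + 5) e) (h0.s.mono (by omega)))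
        fun e he => hend l₀ h0 r hr e he)
      (fun _ => Run.bind (qdiv_run (l + 4) ht hw) fun e he => hend l₀ h0 r hr e he)) ?_
  simp only [List.length_cons]
  omega

theorem arcPoint_run {n : ℕ} (l : ℕ) {g₁ g₂ : ℚ} {b : Disk n} {chords : List (Chord n)}
    {S : List (Disk n)} (h₁ : β.Lv l g₁) (h₂ : β.Lv l g₂) (hb : b.Lv β l)
    (hc : ∀ c ∈ chords, c.Lv β l) (hS : ∀ b ∈ S, b.Lv β l) (hl : l + 19 ≤ β.Λ := by omega) :
    Run β.M (chords.length * (108 * S.length + 60)) (arcPoint g₁ g₂ b chords S)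
      fun o => ∀ xy ∈ o, β.Lv (l + 18) xy.1 ∧ β.Lv (l + 18) xy.2 := by
  unfold arcPoint
  split
  · refine (Run.pure ?_).le (Nat.zero_le _)
    rintro xy hxy
    obtain rfl : (b.x, b.y) = xy := by simpa using hxy
    exact ⟨hb.x.mono (by omega), hb.y.mono (by omega)⟩
  · refine (foldC_run' (s := 108 * S.length + 55)
      (fun o : Option (ℚ × ℚ) => ∀ xy ∈ o, β.Lv (l + 18) xy.1 ∧ β.Lv (l + 18) xy.2) chords
      (fun found hfound c hcm => ?_) (by simp)).le (Nat.mul_le_mul_left _ (by omega))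
    have hc' := hc c hcm
    refine Run.le (Run.bind (mapC_run (s := 21) (Q := fun J : Interval => J.Lv β (l + 10)) S
      fun b' hb' => trace_run l h₁ h₂ hb hc' (hS b' hb')) fun Js hJs =>
      (?_ : Run _ (86 * S.length + 55) _ _)) (by omega)
    obtain ⟨hlen, hJs⟩ := hJs
    rcases Js with - | ⟨J, Js⟩
    · exact (Run.pure hfound).le (Nat.zero_le _)
    have hpt : ∀ o : Option ℚ, (∀ a ∈ o, β.Lv (l + 15) a) → Run β.M 8 (match o with
        | none => pure found
        | some a => do
          let t ← qmul c.α c.p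
          let x ← qadd b.x t
          let t ← qmul a c.p'
          let x ← qadd x t
          let t ← qmul c.α c.q
          let y ← qadd b.y t
          let t ← qmul a c.q'
          let y ← qadd y t
          pure (some (x, y)))
        fun o => ∀ xy ∈ o, β.Lv (l + 18) xy.1 ∧ β.Lv (l + 18) xy.2 := by
      intro o ho
      cases o with
      | none => exact (Run.pure hfound).le (Nat.zero_le _)
      | some a =>
        have ha := ho a rfl
        refine (Run.bind (qmul_run l hc'.α hc'.p) fun _ ht =>
          Run.bind (qadd_run (l + 1) hb.x ht) fun _ hx =>
          Run.bind (qmul_run (l + 15) ha hc'.p') fun _ ht =>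
          Run.bind (qadd_run (l + 16) hx ht) fun x hx => Run.bind (qmul_run l hc'.α hc'.q) fun _ ht =>
          Run.bind (qadd_run (l + 1) hb.y ht) fun _ hy =>
          Run.bind (qmul_run (l + 15) ha hc'.q') fun _ ht =>
          Run.bind (qadd_run (l + 16) hy ht) fun y hy => Run.pure ?_).le (by omega)
        rintro xy hxy
        obtain rfl : (x, y) = xy := by simpa using hxy
        exact ⟨hx.mono (by omega), hy.mono (by omega)⟩
    refine Run.le (Run.bind (allC_run (s := 1) (J :: Js) fun K hK =>
      qlt_run (l + 10) (β.lv_zero (l := 0)) (hJs K hK).σ) fun ok _ => Run.ite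
      (fun _ => Run.bind (commonPoint_run (l + 10) hJs) fun o ho => hpt o ho)
      (fun _ => Run.bind (Run.pure (Q := fun o : Option ℚ => ∀ a ∈ o, β.Lv (l + 15) a) (by simp))
        fun o ho => hpt o ho)) ?_
    rw [hlen]
    omega

end OCP

namespace OCP
variable {β : Budget}

/-- Level of the numbers that the orthogonalisation has produced after `k` vectors, starting from
level `l`. -/
def basisLevel (d l k : ℕ) : ℕ := l + 1 + k * (9 * d + 1)

theorem basisLevel_mono {d l k k' : ℕ} (h : k ≤ k') : basisLevel d l k ≤ basisLevel d l k' := by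
  have := Nat.mul_le_mul_right (9 * d + 1) h
  unfold basisLevel
  omega

theorem directionBasis_run {d : ℕ} (l : ℕ) {H : List (Hyperplane d)} (hH : ∀ h ∈ H, h.Lv β l)
    (hlen : H.length ≤ d) (hl : basisLevel d l d ≤ β.Λ) :
    Run β.M (15 * d ^ 3 + 15 * d ^ 2 + 10 * d) (directionBasis H) fun L =>
      ∀ a ∈ L, (∀ k, β.Lv (basisLevel d l d) (a.1 k)) ∧ β.Lv (basisLevel d l d) a.2 := by
  unfold directionBasis
  refine Run.le (Run.bind (s' := 15 * d ^ 3 + 15 * d ^ 2 + 9 * d) (mapC_run (s := 0)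
    (Q := fun a : (Fin d → ℚ) × ℚ => (∀ k, β.Lv l (a.1 k)) ∧ β.Lv l a.2) H fun h hh =>
    Run.pure ⟨(hH h hh).normal, (hH h hh).normSq⟩) fun N hN => ?_) (by omega)
  -- one projection raises the level by at most four
  have hrem : ∀ (m m' : ℕ) (k : Fin d) (A : List ((Fin d → ℚ) × ℚ)) (v : Fin d → ℚ), m' ≤ m →
      m + 4 * A.length ≤ β.Λ → (∀ a ∈ A, (∀ k, β.Lv m' (a.1 k)) ∧ β.Lv m' a.2) →
      (∀ k, β.Lv m (v k)) →
      Run β.M (A.length * (3 * d + 3)) (foldC (fun (v : Fin d → ℚ) (a : (Fin d → ℚ) × ℚ) => do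
        let c ← qdiv (a.1 k) a.2
        let c ← qsub 0 c
        vaddMul v c a.1) v A) fun v => ∀ k, β.Lv (m + 4 * A.length) (v k) := by
    intro m m' k A v hm hA hA' hv
    refine (foldC_run (s := 3 * d + 2) (fun j (v : Fin d → ℚ) => ∀ k : Fin d, β.Lv (m + 4 * j) (v k)) A
      (fun j v hj hv a ha => ?_) hv).le (by nlinarith)
    obtain ⟨h1, h2⟩ := hA' a ha
    refine (Run.bind (qdiv_run (m + 4 * j) (h1 k) h2) fun c hc =>
      Run.bind (qsub_run (m + 4 * j + 1) (β.lv_zero (l := 0)) hc) fun c hc =>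
      (vaddMul_run (m + 4 * j + 2) hv hc h1).mono le_rfl fun v hv k => hv k).le (by omega)
  have hstep := foldC_run (β := β) (s := 15 * d ^ 2 + 15 * d + 8)
      (f := fun (found : List ((Fin d → ℚ) × ℚ)) k => do
      let v ← tabulate fun j => pure (if j = k then 1 else 0)
      let v ← foldC (fun (v : Fin d → ℚ) (a : (Fin d → ℚ) × ℚ) => do
        let c ← qdiv (a.1 k) a.2
        let c ← qsub 0 c
        vaddMul v c a.1) v N
      let v ← foldC (fun (v : Fin d → ℚ) (a : (Fin d → ℚ) × ℚ) => do
        let c ← qdiv (a.1 k) a.2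
        let c ← qsub 0 c
        vaddMul v c a.1) v found
      let g ← dotC v v
      let pos ← qlt 0 g
      pure (if pos then (v, g) :: found else found))
    (fun j L => L.length ≤ j ∧ ∀ a ∈ L, (∀ k, β.Lv (basisLevel d l j) (a.1 k)) ∧
      β.Lv (basisLevel d l j) a.2) (List.finRange d) (fun j L hj hL k _ => ?_) (b := [])
      (by simp)
  · rw [List.length_finRange] at hstep
    refine hstep.mono ?_ fun L hL => hL.2
    nlinarith
  · rw [List.length_finRange] at hj
    set m := basisLevel d l j with hm
    have hm1 : basisLevel d l (j + 1) = m + 9 * d + 1 := by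
      unfold basisLevel at hm ⊢
      rw [hm]
      ring
    have hm2 : m + 9 * d + 1 ≤ β.Λ := hm1 ▸ (basisLevel_mono hj).trans hl
    have hlm : l + 1 ≤ m := by unfold basisLevel at hm; omega
    have hL1 := hL.1
    have hNl := hN.1
    refine Run.le (Run.bind (tabulate_run (s := 0) (Q := fun q => β.Lv (l + 1) q) fun j =>
      Run.pure (by
        split_ifs
        · exact Budget.lv_of_bitLength_le (by decide)
        · exact β.lv_zero)) fun v hv => Run.bind
      (hrem m l k N v (by omega) (by omega) hN.2 fun i => (hv i).mono hlm) fun v hv => Run.bind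
      (hrem (m + 4 * N.length) m k L v (by omega) (by omega) hL.2 hv) fun v hv => Run.bind
      (dotC_run (m + 8 * d) hv hv) fun g hg => Run.bind (qlt_run (m + 9 * d + 1)
        (β.lv_zero (l := 0)) hg) fun pos _ => Run.pure ⟨?_, ?_⟩) ?_
    · split_ifs
      · simpa using hL1
      · omega
    · rw [hm1]
      have hold : ∀ a ∈ L, (∀ k, β.Lv (m + 9 * d + 1) (a.1 k)) ∧ β.Lv (m + 9 * d + 1) a.2 :=
        fun a ha => ⟨fun k => ((hL.2 a ha).1 k).mono (by omega), (hL.2 a ha).2.mono (by omega)⟩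
      split_ifs
      · intro a ha
        rcases List.mem_cons.1 ha with rfl | ha
        · exact ⟨fun k => (hv k).mono (by omega), hg.mono (by omega)⟩
        · exact hold a ha
      · exact hold
    · have e1 : N.length * (3 * d + 3) ≤ d * (3 * d + 3) := Nat.mul_le_mul_right _ (by omega)
      have e2 : L.length * (3 * d + 3) ≤ d * (3 * d + 3) := Nat.mul_le_mul_right _ (by omega)
      nlinarith

/-- Level that the planar algorithm may reach on data of level `l`. -/
def planeLevel (d l : ℕ) : ℕ := basisLevel d l d + d + 50

/-- Number of steps of the planar algorithm, up to a constant factor. -/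
def planeSteps (n d : ℕ) : ℕ := n * d + d ^ 3 + n ^ 2 * (Nat.clog 2 n + 1)

theorem modifiedBALLS1_run {d n : ℕ} (l k : ℕ) {H : List (Hyperplane d)} {balls : List (Ball d n)}
    (hH : ∀ h ∈ H, h.Lv β l) (hlen : H.length ≤ d) (hb : ∀ b ∈ balls, b.Lv β l)
    (hk : balls.length ≤ k) (hN : 4 * k + 1 ≤ β.N) (hd : 1 ≤ d) (hl : planeLevel d l ≤ β.Λ) :
    Run β.M (1000 * planeSteps k d) (modifiedBALLS1 H balls)
      fun o => ∀ a ∈ o, a.count ≤ 4 * k := by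
  unfold modifiedBALLS1
  split
  · exact (Run.pure (by simp)).le (Nat.zero_le _)
  rename_i b₀ balls
  set n' := (b₀ :: balls).length with hn'
  have hk1 : 1 ≤ k := le_trans (by simp [hn']) hk
  have hk2 : k * 1 ≤ k * k := Nat.mul_le_mul_left _ hk1
  have hd2 : d ^ 2 ≤ d ^ 3 := Nat.pow_le_pow_right hd (by norm_num)
  have hd1 : d ≤ d ^ 3 := by
    calc d = d ^ 1 := (pow_one d).symm
      _ ≤ d ^ 3 := Nat.pow_le_pow_right hd (by norm_num)
  have hkd : k * d ≥ d := Nat.le_mul_of_pos_left _ hk1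
  have hps : planeSteps k d = k * d + d ^ 3 + k * k * Nat.clog 2 k + k * k := by
    unfold planeSteps
    ring
  unfold planeLevel at hl
  set m := basisLevel d l d with hm
  have hlm : l ≤ m := by unfold basisLevel at hm; omega
  refine Run.le (Run.bind (s' := 950 * (planeSteps k d))
    (directionBasis_run l hH hlen (by omega)) fun L hL =>
    ?_) (by rw [hps]; nlinarith)
  split
  rotate_left
  · exact (Run.pure (by simp)).le (Nat.zero_le _)
  rename_i e₁ g₁ e₂ g₂
  obtain ⟨he₁, hg₁⟩ := hL (e₁, g₁) (by simp)
  obtain ⟨he₂, hg₂⟩ := hL (e₂, g₂) (by simp)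
  simp only at he₁ hg₁ he₂ hg₂
  set p := m + d + 3 with hp
  refine Run.le (Run.bind (s' := 930 * (planeSteps k d))
    (mapC_run (s := 8 * d + 2) (Q := fun b : Disk n => b.Lv β p)
    (b₀ :: balls) fun b hbm => ?_) fun disks hdisks => ?_) ?_
  · refine (Run.bind (vsub_run m ((hb b hbm).centre) ((hb b₀ (by simp)).centre)) fun z hz =>
      Run.bind (dotC_run (m + 1) hz he₁) fun s hs => Run.bind (qdiv_run (m + d + 2) hs hg₁)
      fun x hx => Run.bind (dotC_run (m + 1) hz he₂) fun t ht =>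
      Run.bind (qdiv_run (m + d + 2) ht hg₂) fun y hy => Run.pure
      ⟨hx.mono (by omega), hy.mono (by omega), (hb b hbm).radSq.mono (by omega)⟩).le (by omega)
  · obtain ⟨hdl, hdisks⟩ := hdisks
    rw [← hn'] at hdl
    have hclog : 2 * disks.length ≤ 2 ^ (Nat.clog 2 k + 1) := by
      have := Nat.le_pow_clog (b := 2) (by norm_num) k
      rw [pow_succ]
      omega
    have hdk : disks.length ≤ k := by omega
    set j := Nat.clog 2 k with hj
    refine Run.le (Run.bind (s' := 640 * (planeSteps k d))
      (foldC_run' (s := k * (124 * (j + 1) + 150) + 2)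
      (fun o : Option (BestArc n) => ∀ A ∈ o, A.Lv β (p + 12) disks.length) disks
      (fun o ho b hbm => ?_) (by simp)) fun best hbest => ?_) ?_
    · refine Run.le (Run.bind (s' := 1) (bestArc_run p (hg₁.mono (by omega)) (hg₂.mono (by omega))
        (hdisks b hbm) hdisks hclog (by omega)) fun A hA => ?_)
        (by
          have : disks.length * (124 * (j + 1) + 150) ≤ k * (124 * (j + 1) + 150) :=
            Nat.mul_le_mul_right _ hdk
          linarith)
      cases o with
      | none =>
        refine (Run.pure ?_).le (Nat.zero_le _)
        intro A' h
        obtain rfl : A = A' := by simpa using h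
        exact hA
      | some A' =>
        have hA' := ho A' rfl
        refine Run.bind (s' := 0) (nlt_run (hA'.count_le.trans (by omega))
          (hA.count_le.trans (by omega))) fun lt _ => Run.pure ?_
        intro A'' h
        obtain rfl : (if lt then A else A') = A'' := by simpa using h
        split_ifs
        exacts [hA, hA']
    · cases best with
      | none => exact (Run.pure (by simp)).le (Nat.zero_le _)
      | some A =>
        have hA := hbest A rfl
        simp only
        refine Run.le (Run.bind (s' := 600 * (planeSteps k d))
          ((members_run hA).mono (s' := 32 * (k * k)) ?_ fun _ h => h) fun S hS => ?_)
          (by rw [hps]; omega)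
        · have h1 : disks.length * disks.length ≤ k * k := Nat.mul_le_mul hdk hdk
          have h2 : 12 * disks.length * disks.length = 12 * (disks.length * disks.length) := by
            ring
          rw [h2]
          omega
        have hSk : S.length ≤ 4 * k := hS.1.trans (by omega)
        have hck : A.view.chords.length ≤ k := by
          have := hA.view.length_le
          omega
        refine Run.le (Run.bind (s' := 590 * (planeSteps k d)) (mapC_run (s := 0)
          (Q := fun _ => True) S fun b _ => Run.pure trivial) fun ids hids => ?_)
          (by rw [hps]; omega)
        refine Run.le (Run.bind (s' := 90 * (planeSteps k d)) (arcPoint_run (p + 12)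
          (hg₁.mono (by omega)) (hg₂.mono (by omega)) hA.disk hA.view.chords hS.2)
          fun pt hpt => ?_) ?_
        · cases pt with
          | none => exact (Run.pure (by simp)).le (Nat.zero_le _)
          | some xy =>
            obtain ⟨hx, hy⟩ := hpt xy rfl
            refine (Run.bind (vaddMul_run (p + 30) (hb b₀ (by simp)).centre hx he₁)
              fun v hv => Run.bind (vaddMul_run (p + 32) hv hy he₂) fun v hv =>
              Run.pure ?_).le (by rw [hps]; omega)
            intro a ha
            obtain rfl : (⟨v, ids, A.count⟩ : Answer d n) = a := by simpa using ha
            exact hA.count_le.trans (by omega)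
        · have h1 : A.view.chords.length * (108 * S.length + 60) ≤ k * (432 * k + 60) :=
            Nat.mul_le_mul hck (by omega)
          have h2 : k * (432 * k + 60) = 432 * (k * k) + 60 * k := by ring
          rw [hps]
          omega
    · rw [hps]
      have h1 : disks.length * (k * (124 * (j + 1) + 150) + 2 + 1)
          ≤ k * (k * (124 * (j + 1) + 150) + 2 + 1) := Nat.mul_le_mul_right _ hdk
      have h2 : k * (k * (124 * (j + 1) + 150) + 2 + 1)
          = 124 * (k * k * j) + 274 * (k * k) + 3 * k := by ring
      linarith [Nat.zero_le (k * k * j), Nat.zero_le (k * d), Nat.zero_le (d ^ 3)]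
  · rw [hps]
    have : n' * (8 * d + 2 + 1) ≤ k * (8 * d + 2 + 1) := Nat.mul_le_mul_right _ hk
    nlinarith

end OCP

namespace OCP
variable {β : Budget}

/-! ### Cost of the recursion -/

theorem crossingPairs_run {d n : ℕ} (l : ℕ) {balls : List (Ball d n)} (hb : ∀ b ∈ balls, b.Lv β l)
    (hl : l + d + 5 ≤ β.Λ := by omega) :
    Run β.M (balls.length * (balls.length * (5 * d + 9) + 1)) (crossingPairs balls) fun P =>
      P.length ≤ balls.length * balls.length ∧ ∀ p ∈ P, p.1.Lv β l ∧ p.2.Lv β l := by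
  refine foldC_run (fun i (P : List (Ball d n × Ball d n)) =>
    P.length ≤ i * balls.length ∧ ∀ p ∈ P, p.1.Lv β l ∧ p.2.Lv β l) balls
    (fun i P hi hP b hbm => ?_) (by simp)
  refine (foldC_run (s := 5 * d + 8) (fun j (P : List (Ball d n × Ball d n)) =>
    P.length ≤ i * balls.length + j ∧ ∀ p ∈ P, p.1.Lv β l ∧ p.2.Lv β l) balls
    (fun j P hj hP b' hbm' => ?_) (by simpa using hP)).mono le_rfl
    fun P hP => ⟨by rw [add_mul, one_mul]; exact hP.1, hP.2⟩
  refine Run.bind (s' := 0) (ballPosition_run l (hb b hbm) (hb b' hbm')) fun pos _ => ?_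
  cases pos with
  | crossing =>
    refine Run.pure ⟨by simpa [← add_assoc] using hP.1, ?_⟩
    simpa [hb b hbm, hb b' hbm'] using hP.2
  | inside => exact Run.pure ⟨by have := hP.1; omega, hP.2⟩
  | outside => exact Run.pure ⟨by have := hP.1; omega, hP.2⟩
  | apart => exact Run.pure ⟨by have := hP.1; omega, hP.2⟩

theorem radicalHyperplane_run {d n : ℕ} (l : ℕ) {b b' : Ball d n} (hb : b.Lv β l)
    (hb' : b'.Lv β l) (hl : l + d + 6 ≤ β.Λ := by omega) :
    Run β.M (8 * d + 4) (radicalHyperplane b b') fun h => h.Lv β (l + d + 6) :=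
  (Run.bind (vsub_run l hb'.centre hb.centre) fun _ ha => Run.bind (dotC_run (l + 1) ha ha)
    fun _ hD => Run.bind (qadd_run (l + d + 2) hD hb.radSq) fun _ ht =>
    Run.bind (qsub_run (l + d + 3) ht hb'.radSq) fun _ ht =>
    Run.bind (qdiv_run (l + d + 4) ht (Budget.lv_of_bitLength_le (l := l) (by decide)))
    fun _ ht => Run.bind (dotC_run (l + 1) hb.centre ha) fun _ hc =>
    Run.bind (qadd_run (l + d + 5) hc ht) fun _ ho =>
    Run.pure ⟨fun k => (ha k).mono (by omega), ho, hD.mono (by omega)⟩).le (by omega)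

theorem project_run {d n : ℕ} (l : ℕ) {h : Hyperplane d} {b : Ball d n} (hh : h.Lv β l)
    (hb : b.Lv β l) (hl : l + d + 5 ≤ β.Λ := by omega) :
    Run β.M (6 * d + 5) (project h b) fun o => ∀ b' ∈ o, b'.Lv β (l + d + 5) := by
  refine (Run.bind (dotC_run l hh.normal hb.centre) fun _ ht =>
    Run.bind (qsub_run (l + d + 1) hh.offset ht) fun _ ht =>
    Run.bind (qdiv_run (l + d + 2) ht hh.normSq) fun c hc =>
    Run.bind (vaddMul_run (l + d + 3) hb.centre hc hh.normal) fun x hx =>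
    Run.bind (qmul_run (l + d + 3) hc ht) fun _ hs =>
    Run.bind (qsub_run (l + d + 4) hb.radSq hs) fun r hr =>
    Run.bind (qlt_run (l + d + 5) (β.lv_zero (l := 0)) hr) fun pos _ => Run.pure ?_).le (by omega)
  intro b' hb'
  split_ifs at hb'
  · obtain rfl : (⟨b.id, x, r⟩ : Ball d n) = b' := by simpa using hb'
    exact ⟨hx, hr⟩
  · simp at hb'

theorem centreAnswer_run {d n : ℕ} (l : ℕ) {balls : List (Ball d n)} {b : Ball d n}
    (hb : ∀ b ∈ balls, b.Lv β l) (hbm : b ∈ balls) (hN : balls.length ≤ β.N)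
    (hl : l + d + 5 ≤ β.Λ := by omega) :
    Run β.M (balls.length * (5 * d + 11)) (centreAnswer balls b)
      fun a => a.count ≤ balls.length := by
  refine (Run.bind (s' := 2 * balls.length) (filterMapC_run (s := 5 * d + 8)
    (Q := fun _ : Fin n => True) balls fun b' hb' =>
    Run.bind (s' := 0) (ballPosition_run l (hb b hbm) (hb b' hb')) fun pos _ => ?_) fun S hS => ?_).le
    (by nlinarith)
  · cases pos <;> exact Run.pure (by simp)
  · refine (Run.bind (lengthC_run S (hS.1.trans hN)) fun k hk => Run.pure ?_).le
      (s := S.length * 2 + 0) (by omega)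
    rw [hk]
    exact hS.1

theorem better_run {d n k : ℕ} {o o' : Option (Answer d n)} (ho : ∀ a ∈ o, a.count ≤ k)
    (ho' : ∀ a ∈ o', a.count ≤ k) (hN : k ≤ β.N) :
    Run β.M 1 (better o o') fun o => ∀ a ∈ o, a.count ≤ k := by
  unfold better
  cases o with
  | none => exact (Run.pure ho').le (Nat.zero_le _)
  | some a =>
    cases o' with
    | none => exact (Run.pure ho).le (Nat.zero_le _)
    | some b =>
      have h1 := ho a rfl
      have h2 := ho' b rfl
      refine Run.bind (s' := 0) (nlt_run (h2.trans hN) (h1.trans hN)) fun lt _ => Run.pure ?_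
      split_ifs <;> simpa

/-- The instances of the recursive calls have data of this level. -/
def flatLevel (d l k : ℕ) : ℕ := l + k * (2 * d + 11)

theorem modifiedBALLS3_run {d n : ℕ} (hn : 1 ≤ n) (hd : 1 ≤ d) (hN : 4 * n + 1 ≤ β.N) (k : ℕ) :
    ∀ (l : ℕ) (H : List (Hyperplane d)) (balls : List (Ball d n)),
      (∀ h ∈ H, h.Lv β l) → H.length + k ≤ d → (∀ b ∈ balls, b.Lv β l) → balls.length ≤ n →
      planeLevel d (flatLevel d l k) ≤ β.Λ →
      Run β.M (n ^ (2 * k) * (1000 * planeSteps n d) + k * (100 * n ^ (2 * k + 1) * d))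
        (modifiedBALLS3 k H balls) fun o => ∀ a ∈ o, a.count ≤ 4 * n := by
  induction k with
  | zero =>
    intro l H balls hH hlen hb hbn hl
    simp only [flatLevel, zero_mul, add_zero] at hl
    refine (modifiedBALLS1_run l n hH (by omega) hb hbn hN hd hl).le (by simp)
  | succ k ih =>
    intro l H balls hH hlen hb hbn hl
    have hfl : flatLevel d (l + 2 * d + 11) k = flatLevel d l (k + 1) := by
      unfold flatLevel
      ring
    have hl2 : l + 2 * d + 11 ≤ β.Λ := by
      have : flatLevel d l (k + 1) ≤ β.Λ := by
        unfold planeLevel basisLevel at hl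
        omega
      unfold flatLevel at this
      nlinarith
    set T := n ^ (2 * k) * (1000 * planeSteps n d) + k * (100 * n ^ (2 * k + 1) * d) with hT
    have hnn : balls.length * balls.length ≤ n * n := Nat.mul_le_mul hbn hbn
    have hmul : ∀ {a b c : ℕ}, a ≤ b → a * c ≤ b * c := fun h => Nat.mul_le_mul_right _ h
    refine (Run.bind (s := n * (n * (5 * d + 9) + 1)) ((crossingPairs_run l hb).le
      (Nat.mul_le_mul hbn (by have := hmul (c := 5 * d + 9) hbn; omega))) fun P hP =>
      Run.bind (s := n * n * (8 * d + 4 + (n * (6 * d + 6) + (T + 1)) + 1))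
      ((foldC_run' (s := 8 * d + 4 + (n * (6 * d + 6) + (T + 1)))
        (fun o : Option (Answer d n) => ∀ a ∈ o, a.count ≤ 4 * n) P
        (fun o ho p hp => ?_) (by simp)).le (hmul (hP.1.trans hnn))) fun best hbest =>
      Run.bind (s := n * (n * (5 * d + 11) + 2)) ((foldC_run' (s := n * (5 * d + 11) + 1)
        (fun o : Option (Answer d n) => ∀ a ∈ o, a.count ≤ 4 * n) balls
        (fun o ho b hbm => ?_) (by simp)).le (hmul hbn)) fun best' hbest' =>
        better_run hbest' hbest (by omega)).le ?_
    · obtain ⟨h1, h2⟩ := hP.2 p hp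
      refine Run.bind (radicalHyperplane_run l h1 h2) fun h hh => Run.bind
        ((filterMapC_run (s := 6 * d + 5) (Q := fun b : Ball d n => b.Lv β (l + 2 * d + 11)) balls
        fun b hbm => (project_run (l + d + 6) hh ((hb b hbm).mono (by omega))).mono le_rfl
          fun o ho b' hb' => (ho b' hb').mono (by omega)).le (hmul hbn)) fun balls' hballs' =>
        Run.bind (ih (l + 2 * d + 11) (h :: H) balls' ?_ ?_ hballs'.2 (hballs'.1.trans hbn)
          (hfl ▸ hl)) fun ans hans => better_run ho hans (by omega)
      · simp only [List.mem_cons, forall_eq_or_imp]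
        exact ⟨hh.mono (by omega), fun h hh => (hH h hh).mono (by omega)⟩
      · simp only [List.length_cons]
        omega
    · refine Run.bind ((centreAnswer_run l hb hbm (by omega)).le (hmul hbn)) fun a ha =>
        better_run ho ?_ (by omega)
      intro a' ha'
      obtain rfl : a = a' := by simpa using ha'
      omega
    · have e1 : n ^ (2 * (k + 1)) = n * n * n ^ (2 * k) := by ring
      have e2 : n ^ (2 * (k + 1) + 1) = n * n * n ^ (2 * k + 1) := by ring
      have e3 : n * n * T = n ^ (2 * (k + 1)) * (1000 * planeSteps n d)
          + k * (100 * n ^ (2 * (k + 1) + 1) * d) := by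
        rw [hT, e1, e2]
        ring
      have e4 : n * n * (n * d) ≤ n ^ (2 * (k + 1) + 1) * d := by
        rw [e2, pow_succ]
        have : 1 ≤ n ^ (2 * k) := Nat.one_le_pow _ _ hn
        calc n * n * (n * d) = n * n * (1 * n) * d := by ring
          _ ≤ n * n * (n ^ (2 * k) * n) * d := by gcongr
      have e5 : n * n ≤ n * n * (n * d) := Nat.le_mul_of_pos_right _ (Nat.mul_pos hn hd)
      have e6 : n * n * d ≤ n * n * (n * d) := Nat.mul_le_mul_left _ (Nat.le_mul_of_pos_left _ hn)
      have e7 : n * n * n ≤ n * n * (n * d) := Nat.mul_le_mul_left _ (Nat.le_mul_of_pos_right _ hd)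
      have e8 : n * 1 ≤ n * n := Nat.mul_le_mul_left _ hn
      have e9 : (k + 1) * (100 * n ^ (2 * (k + 1) + 1) * d)
          = k * (100 * n ^ (2 * (k + 1) + 1) * d) + 100 * (n ^ (2 * (k + 1) + 1) * d) := by ring
      have e10 : n * (n * (5 * d + 9) + 1)
          + (n * n * (8 * d + 4 + (n * (6 * d + 6) + (T + 1)) + 1)
            + (n * (n * (5 * d + 11) + 2) + 1))
          = n * n * T + 18 * (n * n * d) + 26 * (n * n) + 6 * (n * n * (n * d))
            + 6 * (n * n * n) + 3 * n + 1 := by ring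
      rw [e9, e10]
      omega

/-- The level that the whole algorithm may reach on input data of level `0`. -/
def inputLevel (d : ℕ) : ℕ := planeLevel d (flatLevel d (d + 2) (d - 2))

theorem solveElection_run {d n m : ℕ} (hd : 2 ≤ d) (hn : 1 ≤ n) (I : Election d n m)
    (hN : 4 * n + 1 ≤ β.N) (hl : inputLevel d ≤ β.Λ) (hv : ∀ i k, β.Lv 0 (I.voter i k))
    (hc : ∀ j k, β.Lv 0 (I.cand j k)) :
    Run β.M (n * (m * (5 * d + 2) + 1) + (n ^ (2 * (d - 2)) * (1000 * planeSteps n d)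
      + (d - 2) * (100 * n ^ (2 * (d - 2) + 1) * d))) (solveElection I) fun _ => True := by
  have hl' : d + 5 ≤ β.Λ := by
    unfold inputLevel planeLevel basisLevel at hl
    omega
  refine Run.bind ((mapC_run (s := m * (5 * d + 2)) (Q := fun b : Ball d n => b.Lv β (d + 2))
    (List.finRange n) fun i _ => Run.bind (s' := 0) (sqRadius_run I i hv hc hl') fun r hr =>
    Run.pure ⟨fun k => (hv i k).mono (by omega), hr⟩).le (by simp)) fun balls hballs => ?_
  exact (modifiedBALLS3_run hn (by omega) hN (d - 2) (d + 2) [] balls (by simp) (by simp)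
    hballs.2 (by simp [hballs.1]) hl).mono le_rfl fun _ _ => trivial

/-- A budget into which the whole run on `I` fits. -/
def electionBudget {d n m : ℕ} (I : Election d n m) : Budget where
  B := 1 + inputBits I
  Λ := inputLevel d
  N := 4 * n + 1
  M := (2 * ((1 + inputBits I) * 6 ^ inputLevel d)) ^ 2 + (1 + 2 * (4 * n + 1))
  one_le := by omega
  rat_le := Nat.le_add_right _ _
  counter_le := Nat.le_add_left _ _

theorem bitLength_voter_le {d n m : ℕ} (I : Election d n m) (i : Fin n) (k : Fin d) :
    bitLength (I.voter i k) ≤ inputBits I := by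
  refine le_trans ?_ (Nat.le_add_right _ _)
  refine le_trans ?_ (Finset.single_le_sum (f := fun i => ∑ k, bitLength (I.voter i k))
    (fun _ _ => Nat.zero_le _) (Finset.mem_univ i))
  exact Finset.single_le_sum (f := fun k => bitLength (I.voter i k))
    (fun _ _ => Nat.zero_le _) (Finset.mem_univ k)

theorem bitLength_cand_le {d n m : ℕ} (I : Election d n m) (j : Fin m) (k : Fin d) :
    bitLength (I.cand j k) ≤ inputBits I := by
  refine le_trans ?_ (Nat.le_add_left _ _)
  refine le_trans ?_ (Finset.single_le_sum (f := fun i => ∑ k, bitLength (I.cand i k))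
    (fun _ _ => Nat.zero_le _) (Finset.mem_univ j))
  exact Finset.single_le_sum (f := fun k => bitLength (I.cand j k))
    (fun _ _ => Nat.zero_le _) (Finset.mem_univ k)

/-- An upper bound for the number of steps. -/
def stepBound (d n m : ℕ) : ℕ :=
  n * (m * (5 * d + 2) + 1) + (n ^ (2 * (d - 2)) * (1000 * planeSteps n d)
      + (d - 2) * (100 * n ^ (2 * (d - 2) + 1) * d))

/-- Every instance fits into some budget, so the number of steps is bounded without any
restriction on the size of the numbers. -/
theorem solveElection_cost {d n m : ℕ} (hd : 2 ≤ d) (hn : 1 ≤ n) (I : Election d n m) :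
    Run (electionBudget I).M (stepBound d n m) (solveElection I) fun _ => True := by
  refine solveElection_run (β := electionBudget I) hd hn I le_rfl le_rfl (fun i k => ?_)
    fun j k => ?_
  · have := bitLength_voter_le I i k
    simp only [Budget.Lv, electionBudget, pow_zero, mul_one]
    omega
  · have := bitLength_cand_le I j k
    simp only [Budget.Lv, electionBudget, pow_zero, mul_one]
    omega

theorem le_inputBits_left {d n m : ℕ} (hd : 1 ≤ d) (I : Election d n m) : n ≤ inputBits I := by
  refine le_trans ?_ (Nat.le_add_right _ _)
  calc n ≤ ∑ _i : Fin n, ∑ _k : Fin d, 1 := by simpa using Nat.le_mul_of_pos_right n hd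
    _ ≤ _ := Finset.sum_le_sum fun i _ => Finset.sum_le_sum fun k _ => bitLength_pos _

theorem le_inputBits_right {d n m : ℕ} (hd : 1 ≤ d) (I : Election d n m) : m ≤ inputBits I := by
  refine le_trans ?_ (Nat.le_add_left _ _)
  calc m ≤ ∑ _i : Fin m, ∑ _k : Fin d, 1 := by simpa using Nat.le_mul_of_pos_right m hd
    _ ≤ _ := Finset.sum_le_sum fun i _ => Finset.sum_le_sum fun k _ => bitLength_pos _

theorem clog_le_self (n : ℕ) : Nat.clog 2 n ≤ n :=
  Nat.clog_le_of_le_pow Nat.lt_two_pow_self.le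

open Polynomial in
/-- The bit cost is at most the number of steps times the largest cost of one operation; both are
polynomial in the input length, which is at least `n` and `m`. -/
theorem exists_polynomial_bits (d : ℕ) (hd : 2 ≤ d) : ∃ p : Polynomial ℕ, ∀ (n m : ℕ), 1 ≤ n →
    1 ≤ m → ∀ I : Election d n m, (solveElection I).bits ≤ p.eval (inputBits I) := by
  -- the first factor bounds the cost of one operation, the second one the number of steps
  refine ⟨((C 2 * ((1 + X) * C (6 ^ inputLevel d))) ^ 2 + (1 + C 2 * (C 4 * X + 1))) *
    (X * (X * C (5 * d + 2) + 1) + (X ^ (2 * (d - 2)) * (C 1000 * (X * C d + C (d ^ 3)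
      + X ^ 2 * (X + 1))) + C (d - 2) * (C 100 * X ^ (2 * (d - 2) + 1) * C d))), ?_⟩
  intro n m hn _ I
  have h := solveElection_cost hd hn I
  have h1 := le_inputBits_left (by omega) I
  have h2 := le_inputBits_right (by omega) I
  have h3 := (clog_le_self n).trans h1
  refine h.bits_le.trans ((Nat.mul_le_mul_left _ h.steps_le).trans ?_)
  simp only [eval_mul, eval_add, eval_pow, eval_C, eval_X, eval_one, electionBudget, stepBound,
    planeSteps]
  gcongr

theorem clog_le_log (n : ℕ) (hn : 1 ≤ n) : (Nat.clog 2 n : ℝ) ≤ 3 * Real.log n := by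
  rcases hn.eq_or_lt with rfl | hn
  · simp
  have hl : (0.6931471803 : ℝ) < Real.log 2 := Real.log_two_gt_d9
  have hn2 : Real.log 2 ≤ Real.log n :=
    Real.log_le_log (by norm_num) (by exact_mod_cast hn)
  have h1 : 2 ^ (Nat.clog 2 n - 1) < n := Nat.pow_pred_clog_lt_self (by norm_num) hn
  have h2 : ((Nat.clog 2 n - 1 : ℕ) : ℝ) * Real.log 2 ≤ Real.log n := by
    rw [← Real.log_pow]
    exact Real.log_le_log (by positivity) (by exact_mod_cast h1.le)
  have h3 : 1 ≤ Nat.clog 2 n := Nat.clog_pos (by norm_num) hn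
  rw [Nat.cast_sub h3] at h2
  push_cast at h2
  nlinarith

theorem sweepBound_nonneg (n d : ℕ) : 0 ≤ sweepBound n d := by
  have := Real.log_natCast_nonneg n
  unfold sweepBound
  positivity

theorem planeSteps_le (n d : ℕ) (hn : 1 ≤ n) (hd : 1 ≤ d) :
    (planeSteps n d : ℝ) ≤ 7 * (n * d ^ 2 + d ^ 3 + n ^ 2 * Real.log n) := by
  have h1 := clog_le_log n hn
  have h0 := Real.log_natCast_nonneg n
  have hn' : (1 : ℝ) ≤ n := by exact_mod_cast hn
  have hd' : (1 : ℝ) ≤ d := by exact_mod_cast hd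
  have h2 : (n : ℝ) ^ 2 ≤ 3 * (n ^ 2 * Real.log n) + d ^ 3 := by
    have hd3 : (1 : ℝ) ≤ d ^ 3 := one_le_pow₀ hd'
    rcases hn.eq_or_lt with rfl | hn
    · simpa using hd3
    · have h3 : (1 : ℝ) ≤ Nat.clog 2 n := by exact_mod_cast Nat.clog_pos (by norm_num) hn
      nlinarith [sq_nonneg (n : ℝ)]
  have h3 : (n : ℝ) * d ≤ n * d ^ 2 := by
    have : (d : ℝ) ≤ d ^ 2 := by nlinarith
    gcongr
  have h4 : (n : ℝ) ^ 2 * Nat.clog 2 n ≤ n ^ 2 * (3 * Real.log n) := by gcongr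
  have h5 : (0 : ℝ) ≤ n ^ 2 * Real.log n := by positivity
  have h6 : (0 : ℝ) ≤ n * d ^ 2 := by positivity
  have h7 : (0 : ℝ) ≤ (d : ℝ) ^ 3 := by positivity
  unfold planeSteps
  push_cast
  nlinarith

theorem stepBound_le (d n m : ℕ) (hd : 2 ≤ d) (hn : 1 ≤ n) (hm : 1 ≤ m) :
    (stepBound d n m : ℝ) ≤ 7200 * (sweepBound n d + n * m * d) := by
  have h1 := planeSteps_le n d hn (by omega)
  have h0 := Real.log_natCast_nonneg n
  have hn' : (1 : ℝ) ≤ n := by exact_mod_cast hn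
  have hm' : (1 : ℝ) ≤ m := by exact_mod_cast hm
  have hd' : (2 : ℝ) ≤ d := by exact_mod_cast hd
  have e : 2 * d - 4 = 2 * (d - 2) := by omega
  unfold sweepBound stepBound
  rw [e]
  set k := 2 * (d - 2) with hk
  set P : ℝ := n * d ^ 2 + d ^ 3 + n ^ 2 * Real.log n with hP
  have h2 : ((d - 2 : ℕ) : ℝ) * (100 * n ^ (k + 1) * d) ≤ 100 * ((n : ℝ) ^ k * P) := by
    have h3 : ((d - 2 : ℕ) : ℝ) ≤ d := by exact_mod_cast Nat.sub_le d 2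
    have h4 : (n : ℝ) * d ^ 2 ≤ P := by
      rw [hP]
      have : (0 : ℝ) ≤ d ^ 3 + n ^ 2 * Real.log n := by positivity
      linarith
    calc ((d - 2 : ℕ) : ℝ) * (100 * n ^ (k + 1) * d) ≤ d * (100 * n ^ (k + 1) * d) := by gcongr
      _ = 100 * ((n : ℝ) ^ k * (n * d ^ 2)) := by ring
      _ ≤ _ := by gcongr
  have h5 : (n : ℝ) ^ k * (1000 * planeSteps n d) ≤ 7000 * ((n : ℝ) ^ k * P) := by
    calc (n : ℝ) ^ k * (1000 * planeSteps n d) ≤ (n : ℝ) ^ k * (1000 * (7 * P)) := by gcongr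
      _ = _ := by ring
  have h6 : (n : ℝ) * (m * (5 * d + 2) + 1) ≤ 7 * (n * m * d) := by
    have h7 : (1 : ℝ) ≤ m * d := by nlinarith
    have h8 : (m : ℝ) * (5 * d + 2) + 1 ≤ 7 * (m * d) := by nlinarith
    calc (n : ℝ) * (m * (5 * d + 2) + 1) ≤ n * (7 * (m * d)) := by gcongr
      _ = _ := by ring
  have h9 : (0 : ℝ) ≤ (n : ℝ) ^ k * P := by positivity
  have h10 : (0 : ℝ) ≤ (n : ℝ) * m * d := by positivity
  push_cast
  nlinarith

theorem exists_uniform_steps_bound : ∃ C : ℝ, ∀ (d n m : ℕ), 2 ≤ d → 1 ≤ n → 1 ≤ m →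
    ∀ I : Election d n m,
      ((solveElection I).steps : ℝ) ≤ C * (sweepBound n d + n * m * d) :=
  ⟨7200, fun d n m hd hn hm I => le_trans (by exact_mod_cast (solveElection_cost hd hn I).steps_le)
    (stepBound_le d n m hd hn hm)⟩

theorem exists_steps_bound_of_dimension (d : ℕ) (hd : 2 ≤ d) : ∃ C : ℝ, ∀ (n m : ℕ), 1 ≤ n →
    1 ≤ m → ∀ I : Election d n m,
      ((solveElection I).steps : ℝ) ≤ C * (sweepBound n d + n * m) := by
  obtain ⟨C, hC⟩ := exists_uniform_steps_bound
  refine ⟨|C| * d, fun n m hn hm I => (hC d n m hd hn hm I).trans ?_⟩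
  have hd' : (1 : ℝ) ≤ d := by exact_mod_cast (by omega : 1 ≤ d)
  have h0 := sweepBound_nonneg n d
  have h1 : (0 : ℝ) ≤ n * m := by positivity
  calc C * (sweepBound n d + n * m * d) ≤ |C| * (sweepBound n d + n * m * d) :=
        mul_le_mul_of_nonneg_right (le_abs_self C) (by positivity)
    _ ≤ |C| * (d * (sweepBound n d + n * m)) := by
        refine mul_le_mul_of_nonneg_left ?_ (abs_nonneg C)
        nlinarith
    _ = _ := by ring

end OCP

namespace OCP

/-! ### Powers of points with respect to balls -/

section Power

variable {E : Type*} [NormedAddCommGroup E]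

/-- The power of the point `t` with respect to the sphere with centre `c` and squared radius `ρ`;
it is negative exactly on the open ball. -/
def power (c : E) (ρ : ℝ) (t : E) : ℝ := ‖t - c‖ ^ 2 - ρ

/-- The spheres with squared radii `ρ`, `ρ'` and squared distance `D` of the centres cross. -/
def Crossing (ρ ρ' D : ℝ) : Prop := (ρ + ρ' - D) ^ 2 < 4 * (ρ * ρ')

/-- The ball with squared radius `ρ'` contains the one with squared radius `ρ`, where `D` is the
squared distance of the centres. -/
def Inside (ρ ρ' D : ℝ) : Prop := ¬ Crossing ρ ρ' D ∧ 0 ≤ ρ + ρ' - D ∧ ρ ≤ ρ'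

theorem power_nonneg_of_apart {c c' : E} {ρ ρ' : ℝ} {t : E}
    (h1 : ¬ Crossing ρ ρ' (‖c' - c‖ ^ 2)) (h2 : ρ + ρ' - ‖c' - c‖ ^ 2 < 0)
    (ht : power c ρ t < 0) : 0 ≤ power c' ρ' t := by
  by_contra! ht'
  have h3 : c' - c = (t - c) - (t - c') := by abel
  have h4 : ‖c' - c‖ ≤ ‖t - c‖ + ‖t - c'‖ := h3 ▸ norm_sub_le _ _
  have h5 : ‖c' - c‖ ^ 2 ≤ (‖t - c‖ + ‖t - c'‖) ^ 2 := pow_le_pow_left₀ (norm_nonneg _) h4 2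
  have h6 : 4 * (ρ * ρ') ≤ (ρ + ρ' - ‖c' - c‖ ^ 2) ^ 2 := not_lt.1 h1
  unfold power at ht ht'
  have h7 : (2 * ‖t - c‖ * ‖t - c'‖) ^ 2 ≤ 4 * (ρ * ρ') := by
    have : ‖t - c‖ ^ 2 * ‖t - c'‖ ^ 2 ≤ ρ * ρ' :=
      mul_le_mul (by linarith) (by linarith) (by positivity) (by linarith [sq_nonneg ‖t - c‖])
    nlinarith
  have h8 : 2 * ‖t - c‖ * ‖t - c'‖ ≤ ‖c' - c‖ ^ 2 - ρ - ρ' :=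
    abs_le_of_sq_le_sq' (by nlinarith) (by linarith) |>.2
  nlinarith

theorem crossing_iff {ρ ρ' D : ℝ} : Crossing ρ ρ' D ↔ (D + ρ - ρ') ^ 2 < 4 * (ρ * D) := by
  unfold Crossing
  constructor <;> intro h <;> nlinarith

theorem Crossing.pos {ρ ρ' D : ℝ} (h : Crossing ρ ρ' D) (hD : 0 ≤ D) : 0 < D := by
  rcases hD.eq_or_lt with rfl | hD
  · unfold Crossing at h
    nlinarith [sq_nonneg (ρ - ρ')]
  · exact hD

variable [InnerProductSpace ℝ E]

theorem power_sub_power (c c' : E) (ρ ρ' : ℝ) (t : E) :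
    power c ρ t - power c' ρ' t =
      2 * inner ℝ (t - c) (c' - c) - (‖c' - c‖ ^ 2 + ρ - ρ') := by
  have h : t - c' = (t - c) - (c' - c) := by abel
  unfold power
  rw [h, norm_sub_sq_real (t - c) (c' - c)]
  ring

theorem power_segment (c : E) (ρ : ℝ) (x y : E) (τ : ℝ) :
    power c ρ (x + τ • (y - x)) =
      (1 - τ) * power c ρ x + τ * power c ρ y - τ * (1 - τ) * ‖y - x‖ ^ 2 := by
  have h1 : x + τ • (y - x) - c = (x - c) + τ • (y - x) := by abel
  have h2 : y - c = (x - c) + (y - x) := by abel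
  unfold power
  rw [h1, h2, norm_add_sq_real, norm_add_sq_real, inner_smul_right, norm_smul, mul_pow,
    Real.norm_eq_abs, sq_abs]
  ring

theorem power_sub_power_segment (c c' : E) (ρ ρ' : ℝ) (x y : E) (τ : ℝ) :
    power c ρ (x + τ • (y - x)) - power c' ρ' (x + τ • (y - x)) =
      (1 - τ) * (power c ρ x - power c' ρ' x) + τ * (power c ρ y - power c' ρ' y) := by
  rw [power_segment, power_segment]
  ring

theorem power_segment_le {c : E} {ρ : ℝ} {x y : E} {τ : ℝ} (h0 : 0 ≤ τ) (h1 : τ ≤ 1) :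
    power c ρ (x + τ • (y - x)) ≤ (1 - τ) * power c ρ x + τ * power c ρ y := by
  rw [power_segment]
  have := mul_nonneg (mul_nonneg h0 (sub_nonneg.2 h1)) (sq_nonneg ‖y - x‖)
  linarith

/-- If a point of equal negative power exists, the two spheres cross, unless they are concentric. -/
theorem crossing_of_power_eq {c c' : E} {ρ ρ' : ℝ} {t : E} (hc : c' ≠ c)
    (heq : power c ρ t = power c' ρ' t) (hneg : power c ρ t < 0) :
    Crossing ρ ρ' (‖c' - c‖ ^ 2) := by
  rw [crossing_iff]
  have h := power_sub_power c c' ρ ρ' t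
  have h1 : ‖c' - c‖ ^ 2 + ρ - ρ' = 2 * inner ℝ (t - c) (c' - c) := by linarith
  have h2 := abs_real_inner_le_norm (t - c) (c' - c)
  have h3 : inner ℝ (t - c) (c' - c) ^ 2 ≤ ‖t - c‖ ^ 2 * ‖c' - c‖ ^ 2 := by
    rw [← mul_pow, ← sq_abs]
    exact pow_le_pow_left₀ (abs_nonneg _) h2 2
  have h4 : 0 < ‖c' - c‖ ^ 2 := by
    have := norm_pos_iff.2 (sub_ne_zero.2 hc)
    positivity
  unfold power at hneg
  rw [h1]
  nlinarith

theorem Inside.sq_le {ρ ρ' D : ℝ} (h : Inside ρ ρ' D) (hρ : 0 < ρ) :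
    4 * (ρ * D) ≤ (ρ' - ρ - D) ^ 2 ∧ 0 ≤ ρ' - ρ - D := by
  obtain ⟨h1, h2, h3⟩ := h
  have h4 : 4 * (ρ * ρ') ≤ (ρ + ρ' - D) ^ 2 := not_lt.1 h1
  refine ⟨by nlinarith, ?_⟩
  by_contra! h5
  nlinarith

/-- On the closed inner ball the power with respect to the outer ball is smaller. -/
theorem Inside.power_le {c c' : E} {ρ ρ' : ℝ} {t : E} (h : Inside ρ ρ' (‖c' - c‖ ^ 2))
    (hρ : 0 < ρ) (ht : power c ρ t ≤ 0) : power c' ρ' t ≤ power c ρ t := by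
  obtain ⟨h1, h2⟩ := h.sq_le hρ
  have h3 := power_sub_power c c' ρ ρ' t
  have h4 := abs_real_inner_le_norm (t - c) (c' - c)
  have h5 : inner ℝ (t - c) (c' - c) ^ 2 ≤ ‖t - c‖ ^ 2 * ‖c' - c‖ ^ 2 := by
    rw [← mul_pow, ← sq_abs]
    exact pow_le_pow_left₀ (abs_nonneg _) h4 2
  have h6 : ‖t - c‖ ^ 2 * ‖c' - c‖ ^ 2 ≤ ρ * ‖c' - c‖ ^ 2 := by
    unfold power at ht
    gcongr
    linarith
  have h7 : |2 * inner ℝ (t - c) (c' - c)| ≤ ρ' - ρ - ‖c' - c‖ ^ 2 :=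
    abs_le_of_sq_le_sq (by nlinarith) h2
  have := (abs_le.1 h7).1
  linarith

/-- Along a segment on which finitely many affine functions start nonnegative and one of them
ends negative, there is a first zero. -/
theorem exists_first_zero {ι : Type*} {S : Set ι} (hS : S.Finite) {g h : ι → ℝ}
    (hg : ∀ k ∈ S, 0 ≤ g k) (hh : ∃ k ∈ S, h k < 0) :
    ∃ τ : ℝ, 0 ≤ τ ∧ τ ≤ 1 ∧ (∃ k ∈ S, h k < 0 ∧ (1 - τ) * g k + τ * h k = 0) ∧
      ∀ k ∈ S, 0 ≤ (1 - τ) * g k + τ * h k := by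
  obtain ⟨k, ⟨hkS, hk⟩, hmin⟩ := Set.exists_min_image {k ∈ S | h k < 0}
    (fun k => g k / (g k - h k)) (hS.subset (Set.sep_subset _ _)) hh
  have hgk := hg k hkS
  have hpos : 0 < g k - h k := by linarith
  have hτ1 : g k / (g k - h k) ≤ 1 := (div_le_one hpos).2 (by linarith)
  have hτ0 : 0 ≤ g k / (g k - h k) := div_nonneg hgk hpos.le
  refine ⟨g k / (g k - h k), hτ0, hτ1, ⟨k, hkS, hk, ?_⟩, fun j hj => ?_⟩
  · field_simp
    ring
  · rcases lt_or_ge (h j) 0 with hj' | hj'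
    · have hle := hmin j ⟨hj, hj'⟩
      have hpos' : 0 < g j - h j := by linarith [hg j hj]
      rw [le_div_iff₀ hpos'] at hle
      linarith
    · exact add_nonneg (mul_nonneg (by linarith) (hg j hj)) (mul_nonneg hτ0 hj')

/-- The step behind the recursion. Let `t` lie in all balls of `S`, and let ball `i` have the
largest power at `t`. Unless ball `i` is contained in all balls of `S`, some ball of `S` crosses
it such that their radical hyperplane meets the intersection of `S`: moving from `t` towards a
point of ball `i` where another power is larger, stop when the power of `i` ceases to be the
largest. -/
theorem exists_crossing_or_inside {ι : Type*} {S : Set ι} (hS : S.Finite) {c : ι → E} {ρ : ι → ℝ}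
    (hρ : ∀ j ∈ S, 0 < ρ j) {F : Set E} (hF : ∀ x ∈ F, ∀ y ∈ F, ∀ τ : ℝ, x + τ • (y - x) ∈ F)
    (hc : ∀ j ∈ S, c j ∈ F) {t : E} (htF : t ∈ F) {i : ι} (hi : i ∈ S)
    (ht : power (c i) (ρ i) t < 0)
    (hmax : ∀ j ∈ S, power (c j) (ρ j) t ≤ power (c i) (ρ i) t) :
    (∀ j ∈ S, Inside (ρ i) (ρ j) (‖c j - c i‖ ^ 2)) ∨
      ∃ k ∈ S, Crossing (ρ i) (ρ k) (‖c k - c i‖ ^ 2) ∧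
        ∃ t' ∈ F, power (c i) (ρ i) t' = power (c k) (ρ k) t' ∧
          ∀ j ∈ S, power (c j) (ρ j) t' < 0 := by
  rw [or_iff_not_imp_left]
  intro hnot
  push Not at hnot
  obtain ⟨j, hj, hnj⟩ := hnot
  have hρi := hρ i hi
  have hρj := hρ j hj
  obtain ⟨q, hqF, hqi, hqj⟩ : ∃ q ∈ F, power (c i) (ρ i) q < 0 ∧
      power (c i) (ρ i) q < power (c j) (ρ j) q := by
    by_contra! hno
    apply hnj
    have hd := power_sub_power (c i) (c j) (ρ i) (ρ j) t
    have hmj := hmax j hj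
    rcases eq_or_ne (c j) (c i) with hcc | hcc
    · rw [hcc] at hmj
      rw [hcc, sub_self, inner_zero_right, norm_zero] at hd
      rw [hcc, sub_self, norm_zero]
      unfold Inside Crossing
      refine ⟨?_, by linarith, by nlinarith⟩
      nlinarith [sq_nonneg (ρ i - ρ j)]
    · set D := ‖c j - c i‖ ^ 2 with hD
      have hD0 : 0 < D := by
        have := norm_pos_iff.2 (sub_ne_zero.2 hcc)
        positivity
      have hline : ∀ μ : ℝ, μ ^ 2 * D < ρ i → 0 ≤ (2 * μ - 1) * D - ρ i + ρ j := by
        intro μ hμ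
        have h1 : c i + μ • (c j - c i) - c i = μ • (c j - c i) := by abel
        have h2 : power (c i) (ρ i) (c i + μ • (c j - c i)) = μ ^ 2 * D - ρ i := by
          unfold power
          rw [h1, norm_smul, mul_pow, Real.norm_eq_abs, sq_abs]
        have h3 := hno _ (hF _ (hc i hi) _ (hc j hj) μ) (by rw [h2]; linarith)
        have h4 := power_sub_power (c i) (c j) (ρ i) (ρ j) (c i + μ • (c j - c i))
        rw [h1, real_inner_smul_left, real_inner_self_eq_norm_sq, ← hD] at h4
        nlinarith
      have h0 := hline 0 (by simpa using hρi)
      refine ⟨fun hcr => ?_, by nlinarith, by nlinarith⟩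
      rw [crossing_iff] at hcr
      set m := ρ j - ρ i - D with hm
      have hm0 : 0 ≤ m := by linarith
      have h1 : m / (2 * D) < √(ρ i / D) := by
        apply Real.lt_sqrt_of_sq_lt
        rw [div_pow, div_lt_div_iff₀ (by positivity) hD0]
        nlinarith
      obtain ⟨μ, hμ1, hμ2⟩ := exists_between h1
      have hμ0 : 0 ≤ μ := le_trans (by positivity) hμ1.le
      have h2 := hline (-μ) (by
        have := (Real.lt_sqrt hμ0).1 hμ2
        rw [lt_div_iff₀ hD0] at this
        linarith)
      rw [div_lt_iff₀ (by positivity)] at hμ1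
      nlinarith
  obtain ⟨τ, hτ0, hτ1, ⟨k, hk, hk1, hk2⟩, hall⟩ := exists_first_zero hS
    (g := fun k => power (c i) (ρ i) t - power (c k) (ρ k) t)
    (h := fun k => power (c i) (ρ i) q - power (c k) (ρ k) q)
    (fun k hk => sub_nonneg.2 (hmax k hk)) ⟨j, hj, sub_neg.2 hqj⟩
  simp only [← power_sub_power_segment] at hk2 hall
  set t' := t + τ • (q - t) with ht'
  have hneg : power (c i) (ρ i) t' < 0 := by
    refine lt_of_le_of_lt (power_segment_le hτ0 hτ1) ?_
    rcases hτ0.eq_or_lt with h | h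
    · rw [← h]
      linarith
    · nlinarith
  have heq : power (c i) (ρ i) t' = power (c k) (ρ k) t' := sub_eq_zero.1 hk2
  refine ⟨k, hk, crossing_of_power_eq ?_ heq hneg, t', hF _ htF _ hqF _, heq,
    fun j hj => lt_of_le_of_lt (sub_nonneg.1 (hall j hj)) hneg⟩
  intro hcc
  have h1 := hmax k hk
  rw [hcc] at h1 hk1
  unfold power at h1 hk1
  linarith

end Power

end OCP

namespace OCP

/-! ### Values of computations -/

@[simp] theorem bind_val {α γ : Type} (x : Comp α) (f : α → Comp γ) :
    (x >>= f).val = (f x.val).val := rfl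

@[simp] theorem pure_val {α : Type} (a : α) : (pure a : Comp α).val = a := rfl

@[simp] theorem qadd_val (a b : ℚ) : (qadd a b).val = a + b := rfl
@[simp] theorem qsub_val (a b : ℚ) : (qsub a b).val = a - b := rfl
@[simp] theorem qmul_val (a b : ℚ) : (qmul a b).val = a * b := rfl
@[simp] theorem qdiv_val (a b : ℚ) : (qdiv a b).val = a / b := rfl
@[simp] theorem qlt_val (a b : ℚ) : (qlt a b).val = decide (a < b) := rfl
@[simp] theorem nadd_val (a b : ℕ) : (nadd a b).val = a + b := rfl
@[simp] theorem nsub_val (a b : ℕ) : (nsub a b).val = a - b := rfl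
@[simp] theorem nlt_val (a b : ℕ) : (nlt a b).val = decide (a < b) := rfl

theorem ite_val {α : Type} (c : Prop) [Decidable c] (x y : Comp α) :
    (if c then x else y).val = if c then x.val else y.val := by
  split_ifs <;> rfl

@[simp] theorem mapC_val {α γ : Type} (f : α → Comp γ) (l : List α) :
    (mapC f l).val = l.map fun a => (f a).val := by
  induction l with
  | nil => rfl
  | cons a l ih => simp [mapC, ih]

@[simp] theorem foldC_val {α γ : Type} (f : γ → α → Comp γ) (b : γ) (l : List α) :
    (foldC f b l).val = l.foldl (fun b a => (f b a).val) b := by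
  induction l generalizing b with
  | nil => rfl
  | cons a l ih => simp [foldC, ih]

@[simp] theorem filterMapC_val {α γ : Type} (f : α → Comp (Option γ)) (l : List α) :
    (filterMapC f l).val = l.filterMap fun a => (f a).val := by
  induction l with
  | nil => rfl
  | cons a l ih =>
    simp only [filterMapC, bind_val]
    rw [List.filterMap_cons, ← ih]
    cases (f a).val <;> rfl

@[simp] theorem allC_val {α : Type} (f : α → Comp Bool) (l : List α) :
    (allC f l).val = l.all fun a => (f a).val := by
  have h : ∀ b : Bool, (l.foldl (fun b a => b && (f a).val) b) = (b && l.all fun a => (f a).val) := by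
    induction l with
    | nil => simp
    | cons a l ih => intro b; simp [ih, Bool.and_assoc]
  simp [allC, h]

@[simp] theorem lengthC_val {α : Type} (l : List α) : (lengthC l).val = l.length := by
  have h : ∀ k : ℕ, l.foldl (fun k _ => k + 1) k = k + l.length := by
    induction l with
    | nil => simp
    | cons a l ih => intro k; simp [ih]; omega
  simp [lengthC, h]

@[simp] theorem tabulate_val {d : ℕ} (f : Fin d → Comp ℚ) :
    (tabulate f).val = fun k => (f k).val := rfl

@[simp] theorem vsub_val {d : ℕ} (u v : Fin d → ℚ) : (vsub u v).val = u - v := rfl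

@[simp] theorem vaddMul_val {d : ℕ} (u v : Fin d → ℚ) (c : ℚ) :
    (vaddMul u c v).val = u + c • v := rfl

@[simp] theorem dotC_val {d : ℕ} (u v : Fin d → ℚ) : (dotC u v).val = u ⬝ᵥ v := by
  have h : ∀ (l : List (Fin d)) (s : ℚ),
      l.foldl (fun s k => s + u k * v k) s = s + (l.map fun k => u k * v k).sum := by
    intro l
    induction l with
    | nil => simp
    | cons a l ih => intro s; simp [ih]; ring
  simp [dotC, h, dotProduct, Fin.sum_univ_def]

@[simp] theorem innerC_val (g₁ g₂ p q p' q' : ℚ) :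
    (innerC g₁ g₂ p q p' q').val = g₁ * (p * p') + g₂ * (q * q') := rfl

theorem position_crossing_iff {ρ ρ' D : ℚ} :
    (position ρ ρ' D).val = .crossing ↔ Crossing (ρ : ℝ) ρ' D := by
  have h : Crossing (ρ : ℝ) ρ' D ↔ (ρ + ρ' - D) * (ρ + ρ' - D) < 4 * (ρ * ρ') := by
    unfold Crossing
    rw [sq]
    exact_mod_cast Iff.rfl
  rw [h]
  simp only [position, bind_val, ite_val, qadd_val, qsub_val, qmul_val, qlt_val, pure_val,
    decide_eq_true_eq]
  split_ifs <;> simp_all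

theorem position_inside_iff {ρ ρ' D : ℚ} :
    (position ρ ρ' D).val = .inside ↔ Inside (ρ : ℝ) ρ' D := by
  have h : Inside (ρ : ℝ) ρ' D ↔ ¬ (ρ + ρ' - D) * (ρ + ρ' - D) < 4 * (ρ * ρ') ∧
      0 ≤ ρ + ρ' - D ∧ ρ ≤ ρ' := by
    unfold Inside Crossing
    rw [sq]
    exact_mod_cast Iff.rfl
  rw [h]
  simp only [position, bind_val, ite_val, qadd_val, qsub_val, qmul_val, qlt_val, pure_val,
    decide_eq_true_eq]
  split_ifs <;> simp_all

/-! ### Signs of expressions with square roots -/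

/-- `s` is `1`, `0` or `-1` according to the sign of `x`. -/
def HasSign (s : ℤ) (x : ℝ) : Prop := (0 < x ∧ s = 1) ∨ (x = 0 ∧ s = 0) ∨ (x < 0 ∧ s = -1)

theorem HasSign.neg {s : ℤ} {x : ℝ} (h : HasSign s x) : HasSign (-s) (-x) := by
  rcases h with ⟨h, rfl⟩ | ⟨rfl, rfl⟩ | ⟨h, rfl⟩
  · exact Or.inr (Or.inr ⟨by linarith, rfl⟩)
  · exact Or.inr (Or.inl ⟨by simp, rfl⟩)
  · exact Or.inl ⟨by linarith, by norm_num⟩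

theorem HasSign.pos_iff {s : ℤ} {x : ℝ} (h : HasSign s x) : 0 < s ↔ 0 < x := by
  rcases h with ⟨h, rfl⟩ | ⟨rfl, rfl⟩ | ⟨h, rfl⟩
  · simpa
  · simp
  · simpa using h.le

theorem HasSign.neg_iff {s : ℤ} {x : ℝ} (h : HasSign s x) : s < 0 ↔ x < 0 := by
  rcases h with ⟨h, rfl⟩ | ⟨rfl, rfl⟩ | ⟨h, rfl⟩
  · simpa using h.le
  · simp
  · simpa

theorem HasSign.eq_zero_iff {s : ℤ} {x : ℝ} (h : HasSign s x) : s = 0 ↔ x = 0 := by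
  rcases h with ⟨h, rfl⟩ | ⟨rfl, rfl⟩ | ⟨h, rfl⟩
  · simpa using h.ne'
  · simp
  · simpa using h.ne

theorem HasSign.nonneg_iff {s : ℤ} {x : ℝ} (h : HasSign s x) : 0 ≤ s ↔ 0 ≤ x := by
  rw [← not_lt, ← not_lt, h.neg_iff]

theorem HasSign.mul_pos {s : ℤ} {x c : ℝ} (h : HasSign s x) (hc : 0 < c) : HasSign s (c * x) := by
  rcases h with ⟨h, rfl⟩ | ⟨rfl, rfl⟩ | ⟨h, rfl⟩
  · exact Or.inl ⟨by positivity, rfl⟩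
  · exact Or.inr (Or.inl ⟨by simp, rfl⟩)
  · exact Or.inr (Or.inr ⟨by nlinarith, rfl⟩)

/-- If `x + y` and `x - y` have product `x ^ 2 - y ^ 2`, the sign of one factor is that of the
product times that of the other factor. -/
theorem HasSign.of_mul {a t : ℤ} {x y : ℝ} (hy : HasSign a y) (ha : a ≠ 0)
    (ht : HasSign t (x * y)) : HasSign (a * t) x := by
  rcases hy with ⟨hy, rfl⟩ | ⟨rfl, rfl⟩ | ⟨hy, rfl⟩
  · rw [one_mul]
    rcases ht with ⟨h, rfl⟩ | ⟨h, rfl⟩ | ⟨h, rfl⟩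
    · exact Or.inl ⟨by nlinarith, rfl⟩
    · exact Or.inr (Or.inl ⟨by simpa [hy.ne'] using h, rfl⟩)
    · exact Or.inr (Or.inr ⟨by nlinarith, rfl⟩)
  · exact absurd rfl ha
  · rw [neg_one_mul]
    rcases ht with ⟨h, rfl⟩ | ⟨h, rfl⟩ | ⟨h, rfl⟩
    · exact Or.inr (Or.inr ⟨by nlinarith, rfl⟩)
    · exact Or.inr (Or.inl ⟨by simpa [hy.ne] using h, rfl⟩)
    · exact Or.inl ⟨by nlinarith, rfl⟩

/-- The sign of a sum, when it is determined by the signs of the terms. -/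
theorem HasSign.add {a b : ℤ} {x y : ℝ} (hx : HasSign a x) (hy : HasSign b y)
    (h : b = 0 ∨ a = b) : HasSign a (x + y) := by
  rcases hx with ⟨hx, rfl⟩ | ⟨rfl, rfl⟩ | ⟨hx, rfl⟩ <;>
    rcases hy with ⟨hy, rfl⟩ | ⟨rfl, rfl⟩ | ⟨hy, rfl⟩ <;> simp at h
  · exact Or.inl ⟨by linarith, rfl⟩
  · exact Or.inl ⟨by linarith, rfl⟩
  · exact Or.inr (Or.inl ⟨by simp, rfl⟩)
  · exact Or.inr (Or.inr ⟨by linarith, rfl⟩)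
  · exact Or.inr (Or.inr ⟨by linarith, rfl⟩)

/-- The sign of a difference `x - y`, when `x` and `y` have opposite signs. -/
theorem HasSign.sub {a b : ℤ} {x y : ℝ} (hx : HasSign a x) (hy : HasSign b y)
    (h : ¬ (b = 0 ∨ a = b)) (ha : a ≠ 0) : HasSign a (x - y) := by
  rcases hx with ⟨hx, rfl⟩ | ⟨rfl, rfl⟩ | ⟨hx, rfl⟩ <;>
    rcases hy with ⟨hy, rfl⟩ | ⟨rfl, rfl⟩ | ⟨hy, rfl⟩ <;> simp at h ha
  · exact Or.inl ⟨by linarith, rfl⟩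
  · exact Or.inr (Or.inr ⟨by linarith, rfl⟩)

theorem sgn_hasSign (a : ℚ) : HasSign (sgn a).val a := by
  simp only [sgn, bind_val, ite_val, qlt_val, pure_val, decide_eq_true_eq]
  split_ifs with h1 h2
  · exact Or.inl ⟨by exact_mod_cast h1, rfl⟩
  · exact Or.inr (Or.inr ⟨by exact_mod_cast h2, rfl⟩)
  · have : a = 0 := le_antisymm (not_lt.1 h1) (not_lt.1 h2)
    exact Or.inr (Or.inl ⟨by exact_mod_cast this, rfl⟩)

theorem sgnSqrt_hasSign (A B : ℚ) {δ : ℚ} (hδ : 0 < δ) :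
    HasSign (sgnSqrt A B δ).val (A + B * √δ) := by
  have hδ' : 0 < √(δ : ℝ) := Real.sqrt_pos.2 (by exact_mod_cast hδ)
  have hsq : √(δ : ℝ) * √(δ : ℝ) = δ := Real.mul_self_sqrt (by exact_mod_cast hδ.le)
  have hA := sgn_hasSign A
  have hB : HasSign (sgn B).val (B * √δ) := by
    rw [mul_comm]
    exact (sgn_hasSign B).mul_pos hδ'
  simp only [sgnSqrt, bind_val, ite_val, qmul_val, qsub_val, pure_val]
  split_ifs with h1 h2
  · exact hA.add hB h1
  · rw [hA.eq_zero_iff] at h2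
    rwa [h2, zero_add]
  · refine (hA.sub hB h1 h2).of_mul h2 ?_
    have := sgn_hasSign (A * A - B * B * δ)
    convert this using 1
    push_cast
    linear_combination (-(B : ℝ) * B) * hsq

theorem sgnSqrt₂_hasSign (A B C : ℚ) {δ ε : ℚ} (hδ : 0 < δ) (hε : 0 < ε) :
    HasSign (sgnSqrt₂ A B δ C ε).val (A + B * √δ + C * √ε) := by
  have hsq : √(δ : ℝ) * √(δ : ℝ) = δ := Real.mul_self_sqrt (by exact_mod_cast hδ.le)
  have hsq' : √(ε : ℝ) * √(ε : ℝ) = ε := Real.mul_self_sqrt (by exact_mod_cast hε.le)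
  have hA := sgnSqrt_hasSign A B hδ
  have hC : HasSign (sgn C).val (C * √ε) := by
    rw [mul_comm]
    exact (sgn_hasSign C).mul_pos (Real.sqrt_pos.2 (by exact_mod_cast hε))
  simp only [sgnSqrt₂, bind_val, ite_val, qmul_val, qsub_val, qadd_val, pure_val]
  split_ifs with h1 h2
  · exact hA.add hC h1
  · rw [hA.eq_zero_iff] at h2
    rwa [h2, zero_add]
  · refine (hA.sub hC h1 h2).of_mul h2 ?_
    have := sgnSqrt_hasSign (A * A + B * B * δ - C * C * ε) (2 * (A * B)) hδ
    convert this using 1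
    push_cast
    linear_combination ((B : ℝ) * B) * hsq - ((C : ℝ) * C) * hsq'

/-! ### A common point of intervals -/

/-- A fold that keeps the element with the largest value finds a maximum. -/
theorem foldl_max {α : Type} (f : α → ℝ) (P : α → Prop) (upd : α → α → α)
    (hupd : ∀ a b, P a → P b → upd a b = if f a < f b then b else a) (l : List α) :
    ∀ a, (∀ b ∈ a :: l, P b) →
      l.foldl upd a ∈ a :: l ∧ ∀ b ∈ a :: l, f b ≤ f (l.foldl upd a) := by
  induction l with
  | nil => simp
  | cons b l ih =>
    intro a h
    have ha := h a (by simp)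
    have hb := h b (by simp)
    rw [List.foldl_cons, hupd a b ha hb]
    split_ifs with hlt
    · obtain ⟨h1, h2⟩ := ih b fun x hx => h x (List.mem_cons_of_mem _ hx)
      refine ⟨List.mem_cons_of_mem _ h1, ?_⟩
      intro x hx
      rcases List.mem_cons.1 hx with rfl | hx
      · exact hlt.le.trans (h2 b (by simp))
      · exact h2 x hx
    · obtain ⟨h1, h2⟩ := ih a fun x hx => h x (by
        rcases List.mem_cons.1 hx with rfl | hx <;> simp [*])
      refine ⟨?_, ?_⟩
      · rcases List.mem_cons.1 h1 with h1 | h1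
        · rw [h1]; simp
        · simp [h1]
      · intro x hx
        simp only [List.mem_cons] at hx
        rcases hx with rfl | rfl | hx
        · exact h2 x (by simp)
        · exact (not_lt.1 hlt).trans (h2 a (by simp))
        · exact h2 x (by simp [hx])

theorem inInterval_iff {r : ℚ} {J : Interval} :
    (inInterval r J).val = true ↔ (r - J.s) * (r - J.s) < J.σ := by
  simp [inInterval]

/-- Of two intervals with common points whose midpoints lie outside of the other one, the point of
equal power is a common point. -/
theorem equalPower_mem {s s' a d e : ℝ} {σ σ' : ℝ} (ha : s - a = √σ) (hσ : 0 < σ)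
    (hd : d - s' = √σ') (hσ' : 0 < σ') (hs : d ≤ s) (hs' : s' ≤ a) (had : a < d)
    (he : e = (s' * s' - s * s + σ - σ') / (2 * (s' - s))) : a < e ∧ e < d := by
  have h1 : (s - a) * (s - a) = σ := by rw [ha]; exact Real.mul_self_sqrt hσ.le
  have h2 : (d - s') * (d - s') = σ' := by rw [hd]; exact Real.mul_self_sqrt hσ'.le
  have h3 : 0 < 2 * (s - s') := by linarith
  have he' : e = (s * s - s' * s' - σ + σ') / (2 * (s - s')) := by
    rw [he, ← neg_div_neg_eq]
    congr 1 <;> ring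
  rw [he', lt_div_iff₀ h3, div_lt_iff₀ h3, ← h1, ← h2]
  constructor <;> nlinarith

theorem commonPoint_mem {J : Interval} {Js : List Interval} {a : ℚ}
    (h : (commonPoint J Js).val = some a) : ∀ K ∈ J :: Js, (a - K.s) * (a - K.s) < K.σ := by
  have key : ∀ (L : List ℚ) (o : Option ℚ),
      (∀ a ∈ o, ∀ K ∈ J :: Js, (a - K.s) * (a - K.s) < K.σ) →
      ∀ a ∈ L.foldl (fun found a => if ((J :: Js).all fun K => (inInterval a K).val) = true
        then some a else found) o, ∀ K ∈ J :: Js, (a - K.s) * (a - K.s) < K.σ := by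
    intro L
    induction L with
    | nil => exact fun o ho => ho
    | cons x L ih =>
      intro o ho
      refine ih _ ?_
      beta_reduce
      split_ifs with hx
      · rintro a ha K hK
        obtain rfl : x = a := by simpa using ha
        exact inInterval_iff.1 (List.all_eq_true.1 hx K hK)
      · exact ho
  unfold commonPoint at h
  simp only [bind_val, ite_val, foldC_val, pure_val, allC_val] at h
  split_ifs at h
  · exact key _ none (by simp) a h
  · exact key _ none (by simp) a h

/-- If the open intervals have a common real point, `commonPoint` finds a rational one. -/
theorem exists_commonPoint {J : Interval} {Js : List Interval} (hσ : ∀ K ∈ J :: Js, 0 < K.σ)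
    {x : ℝ} (hx : ∀ K ∈ J :: Js, (x - K.s) ^ 2 < K.σ) :
    ∃ a, (commonPoint J Js).val = some a := by
  have hσ' : ∀ K ∈ J :: Js, (0 : ℝ) < K.σ := fun K hK => by exact_mod_cast hσ K hK
  have hx' : ∀ K ∈ J :: Js, K.s - √K.σ < x ∧ x < K.s + √K.σ := fun K hK => by
    have : |x - K.s| < √K.σ := (Real.lt_sqrt (abs_nonneg _)).2 (by rw [sq_abs]; exact hx K hK)
    rw [abs_lt] at this
    constructor <;> linarith [this.1, this.2]
  -- the intervals with the largest left end and with the smallest right end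
  set l := Js.foldl (fun l K => if 0 < (sgnSqrt₂ (K.s - l.s) (-1) K.σ 1 l.σ).val then K else l) J
    with hl
  set r := Js.foldl (fun l K => if (sgnSqrt₂ (K.s - l.s) 1 K.σ (-1) l.σ).val < 0 then K else l) J
    with hr
  obtain ⟨hlm, hlmax⟩ := foldl_max (fun K : Interval => (K.s : ℝ) - √K.σ) (fun K => 0 < K.σ)
    (fun l K => if 0 < (sgnSqrt₂ (K.s - l.s) (-1) K.σ 1 l.σ).val then K else l)
    (fun l K h1 h2 => by
      have := (sgnSqrt₂_hasSign (K.s - l.s) (-1) 1 h2 h1).pos_iff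
      refine if_congr (this.trans ?_) rfl rfl
      push_cast
      constructor <;> intro h <;> linarith) Js J hσ
  obtain ⟨hrm, hrmin⟩ := foldl_max (fun K : Interval => -((K.s : ℝ) + √K.σ)) (fun K => 0 < K.σ)
    (fun l K => if (sgnSqrt₂ (K.s - l.s) 1 K.σ (-1) l.σ).val < 0 then K else l)
    (fun l K h1 h2 => by
      have := (sgnSqrt₂_hasSign (K.s - l.s) 1 (-1) h2 h1).neg_iff
      refine if_congr (this.trans ?_) rfl rfl
      push_cast
      constructor <;> intro h <;> linarith) Js J hσ
  rw [← hl] at hlm hlmax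
  rw [← hr] at hrm hrmin
  have hmem : ∀ a : ℚ, (l.s : ℝ) - √l.σ < a → (a : ℝ) < r.s + √r.σ →
      ((J :: Js).all fun K => (inInterval a K).val) = true := by
    intro a h1 h2
    rw [List.all_eq_true]
    intro K hK
    rw [inInterval_iff]
    have h3 := hlmax K hK
    have h4 := hrmin K hK
    have h5 : |(a : ℝ) - K.s| < √K.σ := abs_lt.2 ⟨by linarith, by linarith⟩
    rw [Real.lt_sqrt (abs_nonneg _), sq_abs, sq] at h5
    exact_mod_cast h5
  have hsome : ∀ e : ℚ, (∃ a ∈ [l.s, r.s, e], (l.s : ℝ) - √l.σ < a ∧ (a : ℝ) < r.s + √r.σ) →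
      ∃ a, [l.s, r.s, e].foldl (fun found a =>
        if ((J :: Js).all fun K => (inInterval a K).val) = true then some a else found) none
          = some a := by
    rintro e ⟨a, ha, h1, h2⟩
    have h3 := hmem a h1 h2
    simp only [List.foldl_cons, List.foldl_nil]
    simp only [List.mem_cons, List.not_mem_nil, or_false] at ha
    rcases ha with rfl | rfl | rfl
    · rw [if_pos h3]
      split_ifs <;> exact ⟨_, rfl⟩
    · rw [if_pos h3]
      split_ifs <;> exact ⟨_, rfl⟩
    · rw [if_pos h3]
      exact ⟨_, rfl⟩
  have hsl := Real.sqrt_pos.2 (hσ' l hlm)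
  have hsr := Real.sqrt_pos.2 (hσ' r hrm)
  have hlr : (l.s : ℝ) - √l.σ < r.s + √r.σ := (hx' l hlm).1.trans (hx' r hrm).2
  unfold commonPoint
  simp only [bind_val, ite_val, foldC_val, pure_val, allC_val, qsub_val, qmul_val, qadd_val,
    qdiv_val]
  rw [← hl, ← hr]
  split_ifs with hw
  · rw [(sgn_hasSign _).eq_zero_iff] at hw
    have hw' : (r.s : ℝ) = l.s := by push_cast at hw; linarith
    refine hsome _ ⟨l.s, by simp, by linarith, by linarith⟩
  · apply hsome
    by_cases h1 : (l.s : ℝ) < r.s + √r.σ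
    · exact ⟨l.s, by simp, by linarith, h1⟩
    by_cases h2 : (l.s : ℝ) - √l.σ < r.s
    · exact ⟨r.s, by simp, h2, by linarith⟩
    -- neither midpoint lies in the intersection: take the point with the same power with respect to
    -- the two extreme intervals
    refine ⟨_, List.mem_cons_of_mem _ (List.mem_cons_of_mem _ (List.mem_singleton_self _)), ?_⟩
    exact equalPower_mem (s := l.s) (s' := r.s) (by ring) (hσ' l hlm) (by ring) (hσ' r hrm)
      (by linarith) (by linarith) hlr (by push_cast; ring)

end OCP

namespace OCP
open ComplexConjugate

/-! ### Points of a circle in clockwise order -/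

theorem complex_inner_eq (z w : ℂ) : inner ℝ z w = z.re * w.re + z.im * w.im := by
  rw [Complex.inner]
  simp
  ring

theorem complex_norm_sq (z : ℂ) : ‖z‖ ^ 2 = z.re ^ 2 + z.im ^ 2 := by
  rw [← Complex.normSq_eq_norm_sq, Complex.normSq_apply]
  ring

theorem exists_pos_mul_eq_sin {u : ℝ} (h : |u| < Real.pi) : ∃ k > 0, Real.sin u = k * u := by
  rw [abs_lt] at h
  rcases lt_trichotomy u 0 with hu | rfl | hu
  · refine ⟨Real.sin u / u, div_pos_of_neg_of_neg (Real.sin_neg_of_neg_of_neg_pi_lt hu h.1) hu, ?_⟩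
    rw [div_mul_cancel₀ _ hu.ne]
  · exact ⟨1, one_pos, by simp⟩
  · refine ⟨Real.sin u / u, div_pos (Real.sin_pos_of_pos_of_lt_pi hu h.2) hu, ?_⟩
    rw [div_mul_cancel₀ _ hu.ne']

/-- The orientation of three points `x`, `y`, `z` of a circle around the origin is determined by
the order of their arguments. -/
theorem orientation_pos_iff {x y z : ℂ} {r : ℝ} (hr : 0 < r) (hx : ‖x‖ = r) (hy : ‖y‖ = r)
    (hz : ‖z‖ = r) :
    0 < (conj (y - x) * (z - x)).im ↔
      0 < (y.arg - x.arg) * (z.arg - y.arg) * (z.arg - x.arg) := by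
  have polar : ∀ {w : ℂ}, ‖w‖ = r → w.re = r * Real.cos w.arg ∧ w.im = r * Real.sin w.arg := by
    intro w hw
    rw [← hw, Complex.norm_mul_cos_arg, Complex.norm_mul_sin_arg]
    exact ⟨rfl, rfl⟩
  obtain ⟨hx1, hx2⟩ := polar hx
  obtain ⟨hy1, hy2⟩ := polar hy
  obtain ⟨hz1, hz2⟩ := polar hz
  have bound : ∀ v w : ℂ, |(v.arg - w.arg) / 2| < Real.pi := by
    intro v w
    have h1 := Complex.neg_pi_lt_arg v
    have h2 := Complex.arg_le_pi v
    have h3 := Complex.neg_pi_lt_arg w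
    have h4 := Complex.arg_le_pi w
    rw [abs_lt]
    constructor <;> linarith
  -- the orientation is a positive multiple of the product of the sines of the half differences,
  -- and these have the signs of the differences
  have htrig : ∀ a b c : ℝ,
      Real.sin (b - a) + Real.sin (c - b) - Real.sin (c - a) =
        4 * Real.sin ((b - a) / 2) * Real.sin ((c - b) / 2) * Real.sin ((c - a) / 2) := by
    intro a b c
    set u := (b - a) / 2 with hu
    set v := (c - b) / 2 with hv
    rw [show b - a = 2 * u by rw [hu]; ring, show c - b = 2 * v by rw [hv]; ring,
      show c - a = 2 * (u + v) by rw [hu, hv]; ring, show 2 * (u + v) / 2 = u + v by ring,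
      Real.sin_two_mul, Real.sin_two_mul, Real.sin_two_mul, Real.sin_add, Real.cos_add]
    have h1 := Real.sin_sq_add_cos_sq u
    have h2 := Real.sin_sq_add_cos_sq v
    linear_combination (-(2 * Real.sin v * Real.cos v)) * h1 - (2 * Real.sin u * Real.cos u) * h2
  have hcross : (conj (y - x) * (z - x)).im =
      r ^ 2 * (Real.sin (y.arg - x.arg) + Real.sin (z.arg - y.arg) - Real.sin (z.arg - x.arg)) := by
    simp only [Complex.mul_im, Complex.conj_re, Complex.conj_im, Complex.sub_re, Complex.sub_im]
    rw [hx1, hx2, hy1, hy2, hz1, hz2, Real.sin_sub, Real.sin_sub, Real.sin_sub]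
    ring
  obtain ⟨k₁, hk₁, e₁⟩ := exists_pos_mul_eq_sin (bound y x)
  obtain ⟨k₂, hk₂, e₂⟩ := exists_pos_mul_eq_sin (bound z y)
  obtain ⟨k₃, hk₃, e₃⟩ := exists_pos_mul_eq_sin (bound z x)
  rw [hcross, htrig, e₁, e₂, e₃]
  have : r ^ 2 * (4 * (k₁ * ((y.arg - x.arg) / 2)) * (k₂ * ((z.arg - y.arg) / 2)) *
      (k₃ * ((z.arg - x.arg) / 2))) = (r ^ 2 * k₁ * k₂ * k₃ / 2) *
        ((y.arg - x.arg) * (z.arg - y.arg) * (z.arg - x.arg)) := by ring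
  rw [this, mul_pos_iff_of_pos_left (by positivity)]

theorem arg_lt_arg_of_im_nonneg {z w : ℂ} (h0 : z ≠ 0) (h : ‖z‖ = ‖w‖) (hz : 0 ≤ z.im)
    (hw : 0 ≤ w.im) : z.arg < w.arg ↔ w.re < z.re := by
  have h0' : w ≠ 0 := by rwa [← norm_ne_zero_iff, ← h, norm_ne_zero_iff]
  have hpos : 0 < ‖w‖ := norm_pos_iff.2 h0'
  have hle : ∀ v : ℂ, ‖v‖ = ‖w‖ → v.re / ‖w‖ ∈ Set.Icc (-1 : ℝ) 1 := by
    intro v hv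
    have := abs_le.1 (Complex.abs_re_le_norm v)
    rw [hv] at this
    exact ⟨by rw [le_div_iff₀ hpos]; linarith [this.1], by rw [div_le_one hpos]; exact this.2⟩
  rw [Complex.arg_of_im_nonneg_of_ne_zero hz h0, Complex.arg_of_im_nonneg_of_ne_zero hw h0', h,
    Real.strictAntiOn_arccos.lt_iff_gt (hle z h) (hle w rfl)]
  exact div_lt_div_iff_of_pos_right hpos

theorem arg_lt_arg_of_im_neg {z w : ℂ} (h : ‖z‖ = ‖w‖) (hz : z.im < 0) (hw : w.im < 0) :
    z.arg < w.arg ↔ z.re < w.re := by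
  have h0' : w ≠ 0 := by rintro rfl; simp at hw
  have hpos : 0 < ‖w‖ := norm_pos_iff.2 h0'
  have hle : ∀ v : ℂ, ‖v‖ = ‖w‖ → v.re / ‖w‖ ∈ Set.Icc (-1 : ℝ) 1 := by
    intro v hv
    have := abs_le.1 (Complex.abs_re_le_norm v)
    rw [hv] at this
    exact ⟨by rw [le_div_iff₀ hpos]; linarith [this.1], by rw [div_le_one hpos]; exact this.2⟩
  rw [Complex.arg_of_im_neg hz, Complex.arg_of_im_neg hw, h, neg_lt_neg_iff,
    Real.strictAntiOn_arccos.lt_iff_gt (hle w rfl) (hle z h)]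
  exact div_lt_div_iff_of_pos_right hpos

/-- Two circles that are not concentric have at most two common points. -/
theorem finite_common_points {c c' : ℂ} (h : c' ≠ c) (ρ ρ' : ℝ) :
    {z | power c ρ z = 0 ∧ power c' ρ' z = 0}.Finite := by
  set w := c' - c with hw
  have hw0 : w ≠ 0 := sub_ne_zero.2 h
  have hD : 0 < ‖w‖ ^ 2 := by have := norm_pos_iff.2 hw0; positivity
  set D := ‖w‖ ^ 2 with hDdef
  set a := (D + ρ - ρ') / (2 * D) with ha
  set t := √(ρ / D - a ^ 2) with ht
  refine Set.Finite.subset (Set.toFinite {c + w * ⟨a, t⟩, c + w * ⟨a, -t⟩}) ?_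
  rintro z ⟨h1, h2⟩
  have h3 := power_sub_power c c' ρ ρ' z
  rw [h1, h2, ← hw, ← hDdef] at h3
  set u := (z - c) / w with hu
  have hzu : z - c = w * u := by rw [hu]; field_simp
  have hin : inner ℝ (z - c) w = D * u.re := by
    rw [hzu, complex_inner_eq, hDdef, complex_norm_sq]
    simp only [Complex.mul_re, Complex.mul_im]
    ring
  have hre : u.re = a := by
    rw [hin] at h3
    rw [ha]
    field_simp
    linarith
  have him : u.im ^ 2 = ρ / D - a ^ 2 := by
    unfold power at h1
    rw [hzu, norm_mul, mul_pow, ← hDdef, complex_norm_sq, hre] at h1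
    field_simp
    linarith
  have him' : u.im = t ∨ u.im = -t := by
    rw [ht, ← him, Real.sqrt_sq_eq_abs]
    rcases abs_choice u.im with h | h <;> rw [h] <;> simp
  have hz : z = c + w * u := by rw [← hzu]; ring
  rw [hz]
  rcases him' with h | h
  · left
    congr 2
    exact Complex.ext hre h
  · right
    rw [Set.mem_singleton_iff]
    congr 2
    exact Complex.ext hre h

/-! ### Disks, chords and events in the complex plane -/

/-- The point `x * e₁ + y * e₂` of a plane with orthogonal basis `(e₁, e₂)`, `‖e₁‖² = g₁`,
`‖e₂‖² = g₂`, as a complex number, so that distances are preserved. -/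
noncomputable def planePoint (g₁ g₂ : ℚ) (x y : ℝ) : ℂ := ⟨√g₁ * x, √g₂ * y⟩

/-- The centre of a disk as a complex number. -/
noncomputable def Disk.centre {n : ℕ} (g₁ g₂ : ℚ) (b : Disk n) : ℂ := planePoint g₁ g₂ b.x b.y

/-- The power of a point with respect to the boundary circle of a disk. -/
noncomputable def Disk.power {n : ℕ} (g₁ g₂ : ℚ) (b : Disk n) (z : ℂ) : ℝ :=
  OCP.power (b.centre g₁ g₂) b.radSq z

/-- The position of an event relative to the centre of the circle it lies on. -/
noncomputable def Event.point {n : ℕ} (g₁ g₂ : ℚ) (e : Event n) : ℂ :=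
  planePoint g₁ g₂ (e.x₀ + e.x₁ * √e.δ) (e.y₀ + e.y₁ * √e.δ)

/-- The clockwise order around a circle that starts at the leftmost point is the order of
decreasing arguments in `(-π, π]`. -/
noncomputable def Event.key {n : ℕ} (g₁ g₂ : ℚ) (e : Event n) : ℝ := -(e.point g₁ g₂).arg

/-- The event lies on the circle of radius `r`. -/
structure Event.OnCircle {n : ℕ} (g₁ g₂ : ℚ) (r : ℝ) (e : Event n) : Prop where
  δ_pos : 0 < e.δ
  norm_eq : ‖e.point g₁ g₂‖ = r

section
variable {n : ℕ} {g₁ g₂ : ℚ}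

theorem planePoint_norm_sq (h₁ : 0 < g₁) (h₂ : 0 < g₂) (x y : ℝ) :
    ‖planePoint g₁ g₂ x y‖ ^ 2 = g₁ * x ^ 2 + g₂ * y ^ 2 := by
  rw [complex_norm_sq, planePoint]
  simp only [mul_pow]
  rw [Real.sq_sqrt (by exact_mod_cast h₁.le), Real.sq_sqrt (by exact_mod_cast h₂.le)]

theorem planePoint_sub (x y x' y' : ℝ) :
    planePoint g₁ g₂ x y - planePoint g₁ g₂ x' y' = planePoint g₁ g₂ (x - x') (y - y') := by
  apply Complex.ext <;> simp [planePoint] <;> ring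

theorem Disk.power_planePoint (h₁ : 0 < g₁) (h₂ : 0 < g₂) (b : Disk n) (x y : ℝ) :
    b.power g₁ g₂ (planePoint g₁ g₂ x y) = g₁ * (x - b.x) ^ 2 + g₂ * (y - b.y) ^ 2 - b.radSq := by
  rw [Disk.power, OCP.power, Disk.centre, planePoint_sub, planePoint_norm_sq h₁ h₂]

theorem HasSign.congr {s : ℤ} {x y : ℝ} (h : HasSign s x) (h1 : 0 < x ↔ 0 < y)
    (h2 : x < 0 ↔ y < 0) : HasSign s y := by
  rcases h with ⟨h, rfl⟩ | ⟨rfl, rfl⟩ | ⟨h, rfl⟩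
  · exact Or.inl ⟨h1.1 h, rfl⟩
  · refine Or.inr (Or.inl ⟨le_antisymm ?_ ?_, rfl⟩)
    · exact not_lt.1 fun h => lt_irrefl _ (h1.2 h)
    · exact not_lt.1 fun h => lt_irrefl _ (h2.2 h)
  · exact Or.inr (Or.inr ⟨h2.1 h, rfl⟩)

theorem cmpEvent_hasSign (h₁ : 0 < g₁) (h₂ : 0 < g₂) {r : ℝ} (hr : 0 < r) {e f : Event n}
    (he : e.OnCircle g₁ g₂ r) (hf : f.OnCircle g₁ g₂ r) :
    HasSign (cmpEvent e f).val (e.key g₁ g₂ - f.key g₁ g₂) := by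
  have hs₁ : 0 < √(g₁ : ℝ) := Real.sqrt_pos.2 (by exact_mod_cast h₁)
  have hs₂ : 0 < √(g₂ : ℝ) := Real.sqrt_pos.2 (by exact_mod_cast h₂)
  have hye : HasSign (sgnSqrt e.y₀ e.y₁ e.δ).val (e.point g₁ g₂).im :=
    (sgnSqrt_hasSign e.y₀ e.y₁ he.δ_pos).mul_pos hs₂
  have hyf : HasSign (sgnSqrt f.y₀ f.y₁ f.δ).val (f.point g₁ g₂).im :=
    (sgnSqrt_hasSign f.y₀ f.y₁ hf.δ_pos).mul_pos hs₂
  have hx : HasSign (sgnSqrt₂ (e.x₀ - f.x₀) e.x₁ e.δ (0 - f.x₁) f.δ).val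
      ((e.point g₁ g₂).re - (f.point g₁ g₂).re) := by
    have := (sgnSqrt₂_hasSign (e.x₀ - f.x₀) e.x₁ (0 - f.x₁) he.δ_pos hf.δ_pos).mul_pos hs₁
    convert this using 1
    simp only [Event.point, planePoint]
    push_cast
    ring
  have hne : e.point g₁ g₂ ≠ 0 := by
    rw [← norm_pos_iff, he.norm_eq]
    exact hr
  have hnf : f.point g₁ g₂ ≠ 0 := by
    rw [← norm_pos_iff, hf.norm_eq]
    exact hr
  have hn : ‖e.point g₁ g₂‖ = ‖f.point g₁ g₂‖ := he.norm_eq.trans hf.norm_eq.symm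
  simp only [cmpEvent, bind_val, ite_val, pure_val, qsub_val, Event.key]
  simp only [hye.nonneg_iff, hyf.nonneg_iff, hye.neg_iff, hyf.neg_iff]
  split_ifs with c1 c2 c3
  · have h1 := Complex.arg_nonneg_iff.2 c1.1
    have h2 := Complex.arg_neg_iff.2 c1.2
    exact Or.inr (Or.inr ⟨by linarith, rfl⟩)
  · have h1 := Complex.arg_nonneg_iff.2 c2.2
    have h2 := Complex.arg_neg_iff.2 c2.1
    exact Or.inl ⟨by linarith, rfl⟩
  · have c4 : 0 ≤ (f.point g₁ g₂).im := not_lt.1 fun h => c1 ⟨c3, h⟩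
    refine hx.congr ?_ ?_
    · rw [sub_pos, ← arg_lt_arg_of_im_nonneg hne hn c3 c4]
      constructor <;> intro h <;> linarith
    · rw [sub_neg, ← arg_lt_arg_of_im_nonneg hnf hn.symm c4 c3]
      constructor <;> intro h <;> linarith
  · have c3 := not_le.1 c3
    have c4 : (f.point g₁ g₂).im < 0 := not_le.1 fun h => c2 ⟨c3, h⟩
    refine hx.neg.congr ?_ ?_
    · rw [neg_sub, sub_pos, ← arg_lt_arg_of_im_neg hn c3 c4]
      constructor <;> intro h <;> linarith
    · rw [neg_sub, sub_neg, ← arg_lt_arg_of_im_neg hn.symm c4 c3]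
      constructor <;> intro h <;> linarith

/-- The clockwise order of events, with exits before entries at the same point. -/
def Event.Before (g₁ g₂ : ℚ) (e f : Event n) : Prop :=
  e.key g₁ g₂ < f.key g₁ g₂ ∨ e.key g₁ g₂ = f.key g₁ g₂ ∧ (e.entry = true → f.entry = true)

theorem leEvent_iff (h₁ : 0 < g₁) (h₂ : 0 < g₂) {r : ℝ} (hr : 0 < r) {e f : Event n}
    (he : e.OnCircle g₁ g₂ r) (hf : f.OnCircle g₁ g₂ r) :
    (leEvent e f).val = true ↔ e.Before g₁ g₂ f := by
  have h := cmpEvent_hasSign h₁ h₂ hr he hf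
  simp only [leEvent, bind_val, pure_val, Bool.or_eq_true, Bool.and_eq_true, decide_eq_true_eq,
    h.neg_iff, h.eq_zero_iff, Event.Before, sub_neg, sub_eq_zero]
  cases e.entry <;> cases f.entry <;> simp

theorem Event.Before.trans {e f g : Event n} (h : e.Before g₁ g₂ f) (h' : f.Before g₁ g₂ g) :
    e.Before g₁ g₂ g := by
  rcases h with h | ⟨h, h1⟩ <;> rcases h' with h' | ⟨h', h2⟩
  · exact Or.inl (h.trans h')
  · exact Or.inl (h' ▸ h)
  · exact Or.inl (h ▸ h')
  · exact Or.inr ⟨h.trans h', h2 ∘ h1⟩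

theorem Event.before_total (e f : Event n) : e.Before g₁ g₂ f ∨ f.Before g₁ g₂ e := by
  unfold Event.Before
  rcases lt_trichotomy (e.key g₁ g₂) (f.key g₁ g₂) with h | h | h
  · exact Or.inl (Or.inl h)
  · cases he : e.entry <;> cases hf : f.entry <;> simp [h]
  · exact Or.inr (Or.inl h)

/-- The chord that the sweep around `b` computes for a disk that crosses `b`. -/
def chordOf (g₁ g₂ : ℚ) (b b' : Disk n) : Chord n :=
  (chord g₁ g₂ b b' (b'.x - b.x) (b'.y - b.y) (innerC g₁ g₂ (b'.x - b.x) (b'.y - b.y)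
    (b'.x - b.x) (b'.y - b.y)).val).val

/-- The endpoint of a chord where one enters the other disk when going clockwise. -/
def Chord.entryEvent (c : Chord n) : Event n := (chordEnd c true).val

/-- The endpoint of a chord where one leaves the other disk when going clockwise. -/
def Chord.exitEvent (c : Chord n) : Event n := (chordEnd c false).val

theorem Disk.centre_sub (b b' : Disk n) : b'.centre g₁ g₂ - b.centre g₁ g₂ =
    planePoint g₁ g₂ ((b'.x - b.x : ℚ) : ℝ) ((b'.y - b.y : ℚ) : ℝ) := by
  rw [Disk.centre, Disk.centre, planePoint_sub]
  push_cast
  rfl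

theorem Disk.centre_dist_sq (h₁ : 0 < g₁) (h₂ : 0 < g₂) (b b' : Disk n) :
    ‖b'.centre g₁ g₂ - b.centre g₁ g₂‖ ^ 2 = ((innerC g₁ g₂ (b'.x - b.x) (b'.y - b.y)
      (b'.x - b.x) (b'.y - b.y)).val : ℚ) := by
  rw [Disk.centre_sub, planePoint_norm_sq h₁ h₂, innerC_val]
  push_cast
  ring

/-- What the numbers of a chord mean: with `w` the difference of the centres, the radical line is
`{(α + i * s) * w : s}`, and the endpoints of the chord have `s = ± β`. -/
theorem chordOf_spec (h₁ : 0 < g₁) (h₂ : 0 < g₂) {b b' : Disk n}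
    (hc : Crossing (b.radSq : ℝ) b'.radSq (‖b'.centre g₁ g₂ - b.centre g₁ g₂‖ ^ 2)) :
    let w := b'.centre g₁ g₂ - b.centre g₁ g₂
    let c := chordOf g₁ g₂ b b'
    0 < ‖w‖ ^ 2 ∧ 0 < c.δ ∧ 0 < c.normSq' ∧
    (c.α : ℝ) * ‖w‖ ^ 2 = (‖w‖ ^ 2 + b.radSq - b'.radSq) / 2 ∧
    ∃ β > 0, ((c.α : ℝ) ^ 2 + β ^ 2) * ‖w‖ ^ 2 = b.radSq ∧
      c.entryEvent.point g₁ g₂ = ⟨c.α, β⟩ * w ∧ c.exitEvent.point g₁ g₂ = ⟨c.α, -β⟩ * w := by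
  intro w c
  have hD0 : 0 < ‖w‖ ^ 2 := hc.pos (by positivity)
  have hDq := Disk.centre_dist_sq h₁ h₂ b b'
  rw [crossing_iff] at hc
  change (‖w‖ ^ 2 + _ - _) ^ 2 < 4 * (_ * ‖w‖ ^ 2) at hc
  change ‖w‖ ^ 2 = _ at hDq
  have hw : w = planePoint g₁ g₂ ((b'.x - b.x : ℚ) : ℝ) ((b'.y - b.y : ℚ) : ℝ) :=
    Disk.centre_sub b b'
  have hg₁ : (0 : ℝ) < g₁ := by exact_mod_cast h₁
  have hg₂ : (0 : ℝ) < g₂ := by exact_mod_cast h₂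
  set p : ℚ := b'.x - b.x with hp
  set q : ℚ := b'.y - b.y with hq
  set D : ℚ := (innerC g₁ g₂ p q p q).val with hD
  have hDpq : D = g₁ * (p * p) + g₂ * (q * q) := rfl
  have hα : c.α = (D + b.radSq - b'.radSq) / 2 / D := rfl
  have hE : c.normSq' = g₁ * ((0 - g₂ * q) * (0 - g₂ * q)) + g₂ * (g₁ * p * (g₁ * p)) := rfl
  have hδ : c.δ = (b.radSq - (D + b.radSq - b'.radSq) / 2 / D *
      ((D + b.radSq - b'.radSq) / 2)) / c.normSq' := rfl
  rw [hDq] at hD0 hc ⊢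
  have hE' : c.normSq' = g₁ * g₂ * D := by rw [hE, hDpq]; ring
  have hDQ : 0 < D := by exact_mod_cast hD0
  have hE0 : 0 < c.normSq' := by rw [hE']; positivity
  have hcQ : (D + b.radSq - b'.radSq) ^ 2 < 4 * (b.radSq * D) := by exact_mod_cast hc
  have hδ0 : 0 < c.δ := by
    rw [hδ]
    apply div_pos _ hE0
    rw [sub_pos, div_div, div_mul_div_comm, div_lt_iff₀ (by positivity)]
    nlinarith
  have hδR : (0 : ℝ) < c.δ := by exact_mod_cast hδ0
  have hαD : (c.α : ℝ) * D = (D + b.radSq - b'.radSq) / 2 := by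
    rw [hα]
    push_cast
    field_simp
  refine ⟨hD0, hδ0, hE0, hαD, √c.δ * (√g₁ * √g₂), by positivity, ?_, ?_, ?_⟩
  · rw [mul_pow, mul_pow, Real.sq_sqrt hδR.le, Real.sq_sqrt hg₁.le, Real.sq_sqrt hg₂.le]
    have h3 : c.δ * (g₁ * g₂) * D = b.radSq - c.α * ((D + b.radSq - b'.radSq) / 2) := by
      rw [hδ, hE', hα]
      field_simp
    have h4 : (c.δ : ℝ) * (g₁ * g₂) * D = b.radSq - c.α * ((D + b.radSq - b'.radSq) / 2) := by
      exact_mod_cast h3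
    rw [add_mul, h4]
    linear_combination (c.α : ℝ) * hαD
  · have hpt : c.entryEvent.point g₁ g₂ = planePoint g₁ g₂
        (((c.α * p : ℚ) : ℝ) + ((0 - g₂ * q : ℚ) : ℝ) * √c.δ)
        (((c.α * q : ℚ) : ℝ) + ((g₁ * p : ℚ) : ℝ) * √c.δ) := rfl
    rw [hpt, hw]
    have e1 := Real.mul_self_sqrt hg₁.le
    have e2 := Real.mul_self_sqrt hg₂.le
    apply Complex.ext
    · simp only [planePoint, Complex.mul_re]
      push_cast
      linear_combination (√g₁ * q * √c.δ : ℝ) * e2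
    · simp only [planePoint, Complex.mul_im]
      push_cast
      linear_combination (-(√g₂ * p * √c.δ) : ℝ) * e1
  · have hpt : c.exitEvent.point g₁ g₂ = planePoint g₁ g₂
        (((c.α * p : ℚ) : ℝ) + ((0 - (0 - g₂ * q) : ℚ) : ℝ) * √c.δ)
        (((c.α * q : ℚ) : ℝ) + ((0 - g₁ * p : ℚ) : ℝ) * √c.δ) := rfl
    rw [hpt, hw]
    have e1 := Real.mul_self_sqrt hg₁.le
    have e2 := Real.mul_self_sqrt hg₂.le
    apply Complex.ext
    · simp only [planePoint, Complex.mul_re]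
      push_cast
      linear_combination (-(√g₁ * q * √c.δ) : ℝ) * e2
    · simp only [planePoint, Complex.mul_im]
      push_cast
      linear_combination (√g₂ * p * √c.δ : ℝ) * e1

end

end OCP

namespace OCP
open ComplexConjugate

section
variable {n : ℕ} {g₁ g₂ : ℚ}

/-! ### The events on a circle -/

theorem entryEvent_entry (c : Chord n) : c.entryEvent.entry = true := rfl
theorem exitEvent_entry (c : Chord n) : c.exitEvent.entry = false := rfl
theorem entryEvent_other (c : Chord n) : c.entryEvent.other = c.other := rfl
theorem exitEvent_other (c : Chord n) : c.exitEvent.other = c.other := rfl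

/-- The disk `b'` crosses the disk `b`. -/
def Disk.Crosses (g₁ g₂ : ℚ) (b b' : Disk n) : Prop :=
  Crossing (b.radSq : ℝ) b'.radSq (‖b'.centre g₁ g₂ - b.centre g₁ g₂‖ ^ 2)

theorem onCircle_of_crosses (h₁ : 0 < g₁) (h₂ : 0 < g₂) {b b' : Disk n}
    (hc : b.Crosses g₁ g₂ b') :
    (chordOf g₁ g₂ b b').entryEvent.OnCircle g₁ g₂ √b.radSq ∧
      (chordOf g₁ g₂ b b').exitEvent.OnCircle g₁ g₂ √b.radSq := by
  obtain ⟨hD, hδ, -, -, β, -, hβ, he, hx⟩ := chordOf_spec h₁ h₂ hc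
  refine ⟨⟨hδ, ?_⟩, ⟨hδ, ?_⟩⟩
  · rw [he, ← hβ, ← Real.sqrt_sq (norm_nonneg _), norm_mul, mul_pow, complex_norm_sq ⟨_, _⟩]
  · rw [hx, ← hβ, ← Real.sqrt_sq (norm_nonneg _), norm_mul, mul_pow, complex_norm_sq ⟨_, _⟩]
    simp

theorem key_entry_ne_key_exit (h₁ : 0 < g₁) (h₂ : 0 < g₂) {b b' : Disk n}
    (hc : b.Crosses g₁ g₂ b') :
    (chordOf g₁ g₂ b b').entryEvent.key g₁ g₂ ≠ (chordOf g₁ g₂ b b').exitEvent.key g₁ g₂ := by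
  obtain ⟨he, hx⟩ := onCircle_of_crosses h₁ h₂ hc
  obtain ⟨hD, hδ, -, -, β, hβ0, hβ, he', hx'⟩ := chordOf_spec h₁ h₂ hc
  intro h
  have h1 := Complex.ext_norm_arg (he.norm_eq.trans hx.norm_eq.symm) (neg_injective h)
  rw [he', hx'] at h1
  have hw : b'.centre g₁ g₂ - b.centre g₁ g₂ ≠ 0 := by
    intro h0
    simp [h0] at hD
  have h2 := congrArg Complex.im (mul_right_cancel₀ hw h1)
  simp only at h2
  linarith

/-- A point of the circle of `b` lies in a crossing disk if and only if, going clockwise, it lies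
between the entry into this disk and the exit from it. -/
theorem power_neg_iff_between (h₁ : 0 < g₁) (h₂ : 0 < g₂) {b b' : Disk n} (hb : 0 < b.radSq)
    (hc : b.Crosses g₁ g₂ b') {z : ℂ} (hz : ‖z‖ = √b.radSq) :
    let c := chordOf g₁ g₂ b b'
    b'.power g₁ g₂ (b.centre g₁ g₂ + z) < 0 ↔
      0 < (c.entryEvent.key g₁ g₂ - c.exitEvent.key g₁ g₂) *
        (c.exitEvent.key g₁ g₂ - -z.arg) * (c.entryEvent.key g₁ g₂ - -z.arg) := by
  intro c
  obtain ⟨he, hx⟩ := onCircle_of_crosses h₁ h₂ hc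
  obtain ⟨hD, hδ, -, hα, β, hβ0, hβ, he', hx'⟩ := chordOf_spec h₁ h₂ hc
  have hr : 0 < √(b.radSq : ℝ) := Real.sqrt_pos.2 (by exact_mod_cast hb)
  have ho := orientation_pos_iff hr he.norm_eq hx.norm_eq hz
  have hρ : ‖z‖ ^ 2 = b.radSq := by
    rw [hz, Real.sq_sqrt]
    exact_mod_cast hb.le
  set w := b'.centre g₁ g₂ - b.centre g₁ g₂ with hw
  have hpow := power_sub_power (b.centre g₁ g₂) (b'.centre g₁ g₂) b.radSq b'.radSq
    (b.centre g₁ g₂ + z)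
  have h0 : power (b.centre g₁ g₂) b.radSq (b.centre g₁ g₂ + z) = 0 := by
    rw [power, add_sub_cancel_left, hρ, sub_self]
  rw [h0, add_sub_cancel_left, ← hw, complex_inner_eq] at hpow
  have hlhs : b'.power g₁ g₂ (b.centre g₁ g₂ + z) < 0 ↔
      c.α * ‖w‖ ^ 2 < z.re * w.re + z.im * w.im := by
    rw [hα, Disk.power]
    constructor <;> intro h <;> linarith
  have hcross : (conj (c.exitEvent.point g₁ g₂ - c.entryEvent.point g₁ g₂) *
      (z - c.entryEvent.point g₁ g₂)).im =
        2 * β * (z.re * w.re + z.im * w.im - c.α * ‖w‖ ^ 2) := by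
    rw [he', hx', complex_norm_sq]
    simp only [Complex.mul_im, Complex.conj_re, Complex.conj_im, Complex.sub_re, Complex.sub_im,
      Complex.mul_re]
    ring
  rw [hlhs]
  change 0 < (conj (c.exitEvent.point g₁ g₂ - c.entryEvent.point g₁ g₂) *
    (z - c.entryEvent.point g₁ g₂)).im ↔ _ at ho
  rw [hcross, mul_pos_iff_of_pos_left (by positivity), sub_pos] at ho
  rw [ho]
  refine iff_of_eq (congrArg _ ?_)
  simp only [Event.key]
  ring

/-! ### The sweep around a circle -/

/-- The effect of an event on the set of disks that contain the current arc. -/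
def replayStep (S : List (Disk n)) (e : Event n) : List (Disk n) :=
  if e.entry then e.other :: S else S.filter fun b => b.id ≠ e.other.id

/-- The effect of an event on the number of disks that contain the current arc. -/
def countStep (k : ℕ) (e : Event n) : ℕ := if e.entry then k + 1 else k - 1

/-- Whether the disk of the chord `c` contains the arc after the events of `pre`. If the exit
comes before the entry in the sweep, the disk contains the arc at the start. -/
def Chord.Active (g₁ g₂ : ℚ) (c : Chord n) (pre : List (Event n)) : Prop :=
  if c.exitEvent.key g₁ g₂ < c.entryEvent.key g₁ g₂ then
    c.exitEvent ∈ pre → c.entryEvent ∈ pre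
  else c.entryEvent ∈ pre ∧ c.exitEvent ∉ pre

/-- The sorted list of the endpoints of the chords of one circle. -/
structure EventList (g₁ g₂ : ℚ) (cs : List (Chord n)) (evs : List (Event n)) : Prop where
  ids : (cs.map fun c => c.other.id).Nodup
  key_ne : ∀ c ∈ cs, c.entryEvent.key g₁ g₂ ≠ c.exitEvent.key g₁ g₂
  mem_iff : ∀ e, e ∈ evs ↔ ∃ c ∈ cs, e = c.entryEvent ∨ e = c.exitEvent
  nodup : evs.Nodup
  sorted : evs.Pairwise (Event.Before g₁ g₂)

theorem Event.Before.key_le {e f : Event n} (h : e.Before g₁ g₂ f) :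
    e.key g₁ g₂ ≤ f.key g₁ g₂ := by
  rcases h with h | h
  · exact h.le
  · exact h.1.le

theorem entryEvent_ne_exitEvent (c c' : Chord n) : c.entryEvent ≠ c'.exitEvent := by
  intro h
  have := congrArg Event.entry h
  simp [entryEvent_entry, exitEvent_entry] at this

theorem eq_of_id_eq {cs : List (Chord n)} (ids : (cs.map fun c => c.other.id).Nodup)
    {c c' : Chord n} (hc : c ∈ cs) (hc' : c' ∈ cs) (h : c.other.id = c'.other.id) : c = c' :=
  List.inj_on_of_nodup_map ids hc hc' h

namespace EventList
variable {cs : List (Chord n)} {evs : List (Event n)}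

theorem key_le_left (hE : EventList g₁ g₂ cs evs) {pre suf : List (Event n)} {e a : Event n}
    (h : evs = pre ++ e :: suf) (ha : a ∈ pre) : a.key g₁ g₂ ≤ e.key g₁ g₂ := by
  have := hE.sorted
  rw [h, List.pairwise_append] at this
  exact (this.2.2 a ha e (by simp)).key_le

theorem key_le_right (hE : EventList g₁ g₂ cs evs) {pre suf : List (Event n)} {e a : Event n}
    (h : evs = pre ++ e :: suf) (ha : a ∈ suf) : e.key g₁ g₂ ≤ a.key g₁ g₂ := by
  have := hE.sorted
  rw [h, List.pairwise_append, List.pairwise_cons] at this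
  exact (this.2.1.1 a ha).key_le

theorem notMem_left (hE : EventList g₁ g₂ cs evs) {pre suf : List (Event n)} {e : Event n}
    (h : evs = pre ++ e :: suf) : e ∉ pre := by
  have := hE.nodup
  rw [h, List.nodup_append] at this
  exact fun he => this.2.2 e he e (by simp) rfl

theorem mem_cases (hE : EventList g₁ g₂ cs evs) {pre suf : List (Event n)} {e : Event n}
    (h : evs = pre ++ e :: suf) {c : Chord n} (hc : c ∈ cs) :
    (c.entryEvent ∈ pre ∨ c.entryEvent = e ∨ c.entryEvent ∈ suf) ∧
      (c.exitEvent ∈ pre ∨ c.exitEvent = e ∨ c.exitEvent ∈ suf) := by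
  have h1 := (hE.mem_iff c.entryEvent).2 ⟨c, hc, Or.inl rfl⟩
  have h2 := (hE.mem_iff c.exitEvent).2 ⟨c, hc, Or.inr rfl⟩
  rw [h] at h1 h2
  simpa using And.intro h1 h2

theorem active_entry (hE : EventList g₁ g₂ cs evs) {pre suf : List (Event n)} {c : Chord n}
    (hc : c ∈ cs) (h : evs = pre ++ c.entryEvent :: suf) :
    ¬ c.Active g₁ g₂ pre ∧ c.Active g₁ g₂ (pre ++ [c.entryEvent]) := by
  have h1 := hE.notMem_left h
  have h2 := (hE.mem_cases h hc).2
  have h3 := entryEvent_ne_exitEvent c c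
  have h4 := hE.key_ne c hc
  have h5 : c.exitEvent ∈ pre → c.exitEvent.key g₁ g₂ ≤ c.entryEvent.key g₁ g₂ :=
    hE.key_le_left h
  have h6 : c.exitEvent ∈ suf → c.entryEvent.key g₁ g₂ ≤ c.exitEvent.key g₁ g₂ :=
    hE.key_le_right h
  unfold Chord.Active
  simp only [List.mem_append, List.mem_singleton, or_true]
  split_ifs with hlt
  · refine ⟨fun hh => ?_, fun _ => trivial⟩
    rcases h2 with h2 | h2 | h2
    · exact h1 (hh h2)
    · exact h3 h2.symm
    · exact absurd (h6 h2) (not_le.2 hlt)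
  · refine ⟨fun hh => h1 hh.1, trivial, ?_⟩
    rintro (hh | hh)
    · exact h4 (le_antisymm (not_lt.1 hlt) (h5 hh))
    · exact h3 hh.symm

theorem active_exit (hE : EventList g₁ g₂ cs evs) {pre suf : List (Event n)} {c : Chord n}
    (hc : c ∈ cs) (h : evs = pre ++ c.exitEvent :: suf) :
    c.Active g₁ g₂ pre ∧ ¬ c.Active g₁ g₂ (pre ++ [c.exitEvent]) := by
  have h1 := hE.notMem_left h
  have h2 := (hE.mem_cases h hc).1
  have h3 := entryEvent_ne_exitEvent c c
  have h4 := hE.key_ne c hc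
  have h5 : c.entryEvent ∈ pre → c.entryEvent.key g₁ g₂ ≤ c.exitEvent.key g₁ g₂ :=
    hE.key_le_left h
  have h6 : c.entryEvent ∈ suf → c.exitEvent.key g₁ g₂ ≤ c.entryEvent.key g₁ g₂ :=
    hE.key_le_right h
  unfold Chord.Active
  simp only [List.mem_append, List.mem_singleton, or_true]
  split_ifs with hlt
  · refine ⟨fun hh => absurd hh h1, fun hh => ?_⟩
    rcases hh trivial with hh | hh
    · exact absurd (h5 hh) (not_le.2 hlt)
    · exact h3 hh
  · refine ⟨⟨?_, h1⟩, fun hh => hh.2 trivial⟩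
    rcases h2 with h2 | h2 | h2
    · exact h2
    · exact absurd h2 h3
    · exact absurd (le_antisymm (not_lt.1 hlt) (h6 h2)) h4

theorem active_append_of_ne {pre : List (Event n)} {c : Chord n} {e : Event n}
    (h1 : c.entryEvent ≠ e) (h2 : c.exitEvent ≠ e) :
    c.Active g₁ g₂ (pre ++ [e]) ↔ c.Active g₁ g₂ pre := by
  unfold Chord.Active
  simp [h1, h2]

/-- The disks that contain the arc after the events of `pre`, and their number. -/
theorem replay_spec (hE : EventList g₁ g₂ cs evs) {first : List (Disk n)}
    (hf : (first.map Disk.id).Nodup)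
    (hfm : ∀ x, x ∈ first ↔
      ∃ c ∈ cs, x = c.other ∧ c.exitEvent.key g₁ g₂ < c.entryEvent.key g₁ g₂)
    (pre : List (Event n)) : ∀ suf, evs = pre ++ suf →
      ((pre.foldl replayStep first).map Disk.id).Nodup ∧
      (∀ x, x ∈ pre.foldl replayStep first ↔ ∃ c ∈ cs, x = c.other ∧ c.Active g₁ g₂ pre) ∧
      pre.foldl countStep first.length = (pre.foldl replayStep first).length := by
  induction pre using List.reverseRecOn with
  | nil =>
    intro suf h
    refine ⟨hf, ?_, rfl⟩
    intro x
    rw [List.foldl_nil, hfm]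
    simp [Chord.Active]
  | append_singleton pre e ih =>
    intro suf h
    rw [List.append_assoc, List.singleton_append] at h
    obtain ⟨h1, h2, h3⟩ := ih (e :: suf) h
    simp only [List.foldl_append, List.foldl_cons, List.foldl_nil]
    set S := pre.foldl replayStep first with hS
    obtain ⟨c, hc, rfl | rfl⟩ := (hE.mem_iff e).1 (by rw [h]; simp)
    · obtain ⟨h4, h5⟩ := hE.active_entry hc h
      have hid : ∀ c' ∈ cs, c' ≠ c → (c'.Active g₁ g₂ (pre ++ [c.entryEvent]) ↔
          c'.Active g₁ g₂ pre) := fun c' hc' hne => active_append_of_ne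
        (fun hh => hne (eq_of_id_eq hE.ids hc' hc (congrArg (fun e => e.other.id) hh)))
        (entryEvent_ne_exitEvent c c').symm
      simp only [replayStep, countStep, entryEvent_entry, if_true, entryEvent_other,
        List.map_cons, List.nodup_cons, List.length_cons, h3, and_true, h1]
      refine ⟨?_, ?_⟩
      · intro hmem
        obtain ⟨x, hx, hxid⟩ := List.mem_map.1 hmem
        obtain ⟨c', hc', rfl, hact⟩ := (h2 x).1 hx
        exact h4 (eq_of_id_eq hE.ids hc' hc hxid ▸ hact)
      · intro x
        rw [List.mem_cons, h2]
        constructor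
        · rintro (rfl | ⟨c', hc', rfl, hact⟩)
          · exact ⟨c, hc, rfl, h5⟩
          · rcases eq_or_ne c' c with rfl | hne
            · exact absurd hact h4
            · exact ⟨c', hc', rfl, (hid c' hc' hne).2 hact⟩
        · rintro ⟨c', hc', rfl, hact⟩
          rcases eq_or_ne c' c with rfl | hne
          · exact Or.inl rfl
          · exact Or.inr ⟨c', hc', rfl, (hid c' hc' hne).1 hact⟩
    · obtain ⟨h4, h5⟩ := hE.active_exit hc h
      have hid : ∀ c' ∈ cs, c' ≠ c → (c'.Active g₁ g₂ (pre ++ [c.exitEvent]) ↔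
          c'.Active g₁ g₂ pre) := fun c' hc' hne => active_append_of_ne
        (entryEvent_ne_exitEvent c' c)
        (fun hh => hne (eq_of_id_eq hE.ids hc' hc (congrArg (fun e => e.other.id) hh)))
      have hrep : replayStep S c.exitEvent = S.filter fun b => decide (b.id ≠ c.other.id) := rfl
      have hcnt : countStep S.length c.exitEvent = S.length - 1 := rfl
      rw [h3, hrep, hcnt]
      refine ⟨h1.sublist (List.filter_sublist.map _), ?_, ?_⟩
      · intro x
        rw [List.mem_filter, h2, decide_eq_true_eq]
        constructor
        · rintro ⟨⟨c', hc', rfl, hact⟩, hne⟩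
          have hne : c' ≠ c := by rintro rfl; exact hne rfl
          exact ⟨c', hc', rfl, (hid c' hc' hne).2 hact⟩
        · rintro ⟨c', hc', rfl, hact⟩
          have hne : c' ≠ c := by rintro rfl; exact h5 hact
          exact ⟨⟨c', hc', rfl, (hid c' hc' hne).1 hact⟩,
            fun hh => hne (eq_of_id_eq hE.ids hc' hc hh)⟩
      · have hmem : c.other.id ∈ S.map Disk.id :=
          List.mem_map_of_mem ((h2 c.other).2 ⟨c, hc, rfl, h4⟩)
        have hcount := List.count_eq_one_of_mem h1 hmem
        have hsum := List.length_eq_countP_add_countP (fun b : Disk n => b.id == c.other.id)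
          (l := S)
        rw [List.count, List.countP_map] at hcount
        have h6 : (S.filter fun b => decide (b.id ≠ c.other.id)).length =
            S.countP fun b => ¬ (b.id == c.other.id) = true := by
          rw [List.countP_eq_length_filter]
          congr 1
          apply List.filter_congr
          intro x _
          simp
        rw [h6]
        have h7 : S.countP (fun b => b.id == c.other.id) = 1 := hcount
        omega

/-- A disk that contains a point of the circle contains the arc at this point. -/
theorem active_of_between {pre suf : List (Event n)} (hE : EventList g₁ g₂ cs (pre ++ suf))
    {θ : ℝ} (hpre : ∀ e ∈ pre, e.key g₁ g₂ < θ) (hsuf : ∀ e ∈ suf, θ ≤ e.key g₁ g₂)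
    {c : Chord n} (hc : c ∈ cs)
    (h : 0 < (c.entryEvent.key g₁ g₂ - c.exitEvent.key g₁ g₂) *
      (c.exitEvent.key g₁ g₂ - θ) * (c.entryEvent.key g₁ g₂ - θ)) : c.Active g₁ g₂ pre := by
  have hmem : ∀ e, (e = c.entryEvent ∨ e = c.exitEvent) → (e ∈ pre ↔ e.key g₁ g₂ < θ) := by
    intro e he
    refine ⟨hpre e, fun hlt => ?_⟩
    rcases List.mem_append.1 ((hE.mem_iff e).2 ⟨c, hc, he⟩) with h | h
    · exact h
    · exact absurd (hsuf e h) (not_le.2 hlt)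
  unfold Chord.Active
  rw [hmem _ (Or.inl rfl), hmem _ (Or.inr rfl)]
  split_ifs with hlt
  · intro h1
    have : 0 < c.entryEvent.key g₁ g₂ - c.exitEvent.key g₁ g₂ := sub_pos.2 hlt
    by_contra! h2
    have h3 : (c.exitEvent.key g₁ g₂ - θ) * (c.entryEvent.key g₁ g₂ - θ) ≤ 0 :=
      mul_nonpos_of_nonpos_of_nonneg (by linarith) (by linarith)
    rw [mul_assoc] at h
    nlinarith
  · have h0 := lt_of_le_of_ne (not_lt.1 hlt) (hE.key_ne c hc)
    rw [mul_assoc] at h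
    have h1 : (c.exitEvent.key g₁ g₂ - θ) * (c.entryEvent.key g₁ g₂ - θ) < 0 := by
      by_contra! h2
      nlinarith
    rcases mul_neg_iff.1 h1 with h2 | h2
    · exact ⟨by linarith [h2.2], by linarith [h2.1]⟩
    · linarith [h2.1, h2.2]

/-- An arc strictly between two events is contained in the active disks. -/
theorem between_of_active {pre suf : List (Event n)} (hE : EventList g₁ g₂ cs (pre ++ suf))
    {θ : ℝ} (hpre : ∀ e ∈ pre, e.key g₁ g₂ < θ) (hsuf : ∀ e ∈ suf, θ < e.key g₁ g₂)
    {c : Chord n} (hc : c ∈ cs) (h : c.Active g₁ g₂ pre) :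
    0 < (c.entryEvent.key g₁ g₂ - c.exitEvent.key g₁ g₂) *
      (c.exitEvent.key g₁ g₂ - θ) * (c.entryEvent.key g₁ g₂ - θ) := by
  have hmem : ∀ e, (e = c.entryEvent ∨ e = c.exitEvent) →
      (e ∈ pre ∧ e.key g₁ g₂ < θ) ∨ (e ∉ pre ∧ θ < e.key g₁ g₂) := by
    intro e he
    rcases List.mem_append.1 ((hE.mem_iff e).2 ⟨c, hc, he⟩) with h | h
    · exact Or.inl ⟨h, hpre e h⟩
    · exact Or.inr ⟨fun h' => lt_asymm (hpre e h') (hsuf e h), hsuf e h⟩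
  unfold Chord.Active at h
  rw [mul_assoc]
  split_ifs at h with hlt
  · refine mul_pos (sub_pos.2 hlt) ?_
    rcases hmem _ (Or.inr rfl) with ⟨h1, h2⟩ | ⟨h1, h2⟩
    · rcases hmem _ (Or.inl rfl) with ⟨h3, h4⟩ | ⟨h3, h4⟩
      · exact mul_pos_of_neg_of_neg (by linarith) (by linarith)
      · exact absurd (h h1) h3
    · exact mul_pos (by linarith) (by linarith)
  · have h0 := lt_of_le_of_ne (not_lt.1 hlt) (hE.key_ne c hc)
    rcases hmem _ (Or.inr rfl) with ⟨h1, h2⟩ | ⟨h1, h2⟩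
    · exact absurd h1 h.2
    · rcases hmem _ (Or.inl rfl) with ⟨h3, h4⟩ | ⟨h3, h4⟩
      · exact mul_pos_of_neg_of_neg (by linarith)
          (mul_neg_of_pos_of_neg (by linarith) (by linarith))
      · exact absurd h.1 h3

/-- If no prefix of the sorted events leads to more disks than `pre`, the next event is at a
different point. At a common point, if the last event of `pre` is an exit, a larger number of disks
precedes it; if it is an entry, the next event is an entry too, since exits come first, and leads
to a larger number. -/
theorem key_lt_of_max {first : List (Disk n)} {pre suf : List (Event n)}
    (hE : EventList g₁ g₂ cs (pre ++ suf)) (hf : (first.map Disk.id).Nodup)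
    (hfm : ∀ x, x ∈ first ↔
      ∃ c ∈ cs, x = c.other ∧ c.exitEvent.key g₁ g₂ < c.entryEvent.key g₁ g₂)
    (hmax : ∀ p s, pre ++ suf = p ++ s →
      p.foldl countStep first.length ≤ pre.foldl countStep first.length) :
    ∀ e ∈ pre, ∀ f ∈ suf, e.key g₁ g₂ < f.key g₁ g₂ := by
  induction pre using List.reverseRecOn with
  | nil => simp
  | append_singleton pre e _ =>
    cases suf with
    | nil => simp
    | cons f suf =>
      have hassoc : pre ++ [e] ++ f :: suf = pre ++ e :: (f :: suf) := by simp
      have hef : e.Before g₁ g₂ f := by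
        have := hE.sorted
        rw [List.pairwise_append] at this
        exact this.2.2 e (by simp) f (by simp)
      have hlt : e.key g₁ g₂ < f.key g₁ g₂ := by
        rcases hef with h | ⟨h, h'⟩
        · exact h
        exfalso
        cases he : e.entry with
        | true =>
          have h1 := hmax (pre ++ [e] ++ [f]) suf (by simp)
          rw [List.foldl_append (l := pre ++ [e])] at h1
          simp [countStep, h' he] at h1
        | false =>
          have h1 := hmax pre (e :: f :: suf) (by simp)
          have h2 := hE.replay_spec hf hfm pre (e :: f :: suf) hassoc
          obtain ⟨c, hc, rfl | rfl⟩ := (hE.mem_iff e).1 (by simp)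
          · simp [entryEvent_entry] at he
          have h3 := (hE.active_exit hc hassoc).1
          have h4 := List.length_pos_of_mem ((h2.2.1 c.other).2 ⟨c, hc, rfl, h3⟩)
          rw [← h2.2.2] at h4
          rw [List.foldl_append] at h1
          simp only [List.foldl_cons, List.foldl_nil, countStep, he, Bool.false_eq_true,
            if_false] at h1
          omega
      intro a ha f' hf'
      have h1 : a.key g₁ g₂ ≤ e.key g₁ g₂ := by
        rcases List.mem_append.1 ha with ha | ha
        · exact hE.key_le_left hassoc ha
        · rw [List.mem_singleton.1 ha]
      have h2 : f.key g₁ g₂ ≤ f'.key g₁ g₂ := by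
        rcases List.mem_cons.1 hf' with rfl | hf'
        · exact le_rfl
        · exact hE.key_le_right (pre := pre ++ [e]) (e := f) (by simp) hf'
      linarith

end EventList

/-- The sweep finds a prefix of the events that leads to the largest number of disks. -/
theorem sweep_spec (k : ℕ) (l : List (Event n)) :
    let s := l.foldl (fun s e => (sweepStep s e).val) (⟨k, [], k, []⟩ : Sweep n)
    s.cur = l.foldl countStep k ∧ s.past = l.reverse ∧
      (∃ pre suf, l = pre ++ suf ∧ s.bestPast = pre.reverse ∧ s.best = pre.foldl countStep k) ∧
      ∀ p q, l = p ++ q → p.foldl countStep k ≤ s.best := by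
  induction l using List.reverseRecOn with
  | nil =>
    refine ⟨rfl, rfl, ⟨[], [], rfl, rfl, rfl⟩, ?_⟩
    intro p q h
    obtain ⟨rfl, rfl⟩ := List.append_eq_nil_iff.1 h.symm
    rfl
  | append_singleton l e ih =>
    intro s
    obtain ⟨h1, h2, ⟨pre, suf, h3, h4, h5⟩, h6⟩ := ih
    set t := l.foldl (fun s e => (sweepStep s e).val) (⟨k, [], k, []⟩ : Sweep n) with ht
    have hs : s = (if t.best < countStep t.cur e then
        (⟨countStep t.cur e, e :: t.past, countStep t.cur e, e :: t.past⟩ : Sweep n)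
        else ⟨countStep t.cur e, e :: t.past, t.best, t.bestPast⟩) := by
      change (l ++ [e]).foldl _ _ = _
      rw [List.foldl_append, ← ht]
      simp only [List.foldl_cons, List.foldl_nil, sweepStep, countStep]
      split_ifs <;> simp_all
    have hcur : countStep t.cur e = (l ++ [e]).foldl countStep k := by
      rw [List.foldl_append, ← h1]
      rfl
    have hpast : e :: t.past = (l ++ [e]).reverse := by simp [h2]
    have hsplit : ∀ p q, l ++ [e] = p ++ q → p = l ++ [e] ∨ ∃ q', l = p ++ q' := by
      intro p q h
      rcases List.eq_nil_or_concat q with rfl | ⟨q', x, rfl⟩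
      · left; simpa using h.symm
      · right
        rw [List.concat_eq_append, ← List.append_assoc] at h
        exact ⟨q', (List.append_inj' h rfl).1⟩
    rw [hs]
    split_ifs with hlt
    · refine ⟨hcur, hpast, ⟨l ++ [e], [], by simp, hpast, hcur⟩, ?_⟩
      intro p q h
      rcases hsplit p q h with rfl | ⟨q', h'⟩
      · exact hcur.ge
      · exact (h6 p q' h').trans hlt.le
    · refine ⟨hcur, hpast, ⟨pre, suf ++ [e], by simp [h3], h4, h5⟩, ?_⟩
      intro p q h
      rcases hsplit p q h with rfl | ⟨q', h'⟩
      · rw [← hcur]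
        exact not_lt.1 hlt
      · exact h6 p q' h'

end

end OCP

namespace OCP

/-! ### Correctness of merge sort -/

theorem splitC_spec {α : Type} : ∀ l : List α,
    ((splitC l).val.1 ++ (splitC l).val.2).Perm l ∧
      (splitC l).val.1.length = (l.length + 1) / 2 ∧ (splitC l).val.2.length = l.length / 2
  | [] => by simp [splitC]
  | [a] => by simp [splitC]
  | a :: b :: l => by
    obtain ⟨h1, h2, h3⟩ := splitC_spec l
    refine ⟨?_, ?_, ?_⟩
    · simp only [splitC, bind_val, pure_val, List.cons_append]
      refine List.Perm.cons a (List.perm_middle.trans (h1.cons b))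
    · simp [splitC, h2]; omega
    · simp [splitC, h3]; omega

theorem mergeC_perm {α : Type} (le : α → α → Comp Bool) (xs ys : List α) :
    (mergeC le xs ys).val.Perm (xs ++ ys) := by
  fun_induction mergeC le xs ys with
  | case1 ys => exact List.Perm.refl _
  | case2 x xs => simp
  | case3 x xs y ys ih1 ih2 =>
    simp only [bind_val, ite_val, pure_val]
    split_ifs
    · exact ih1.cons x
    · exact (ih2.cons y).trans List.perm_middle.symm

theorem mergeC_sorted {α : Type} {P : α → Prop} {R : α → α → Prop} {le : α → α → Comp Bool}
    (hle : ∀ a b, P a → P b → ((le a b).val = true ↔ R a b))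
    (htrans : ∀ a b c, R a b → R b c → R a c) (htotal : ∀ a b, R a b ∨ R b a) (xs ys : List α)
    (hx : ∀ a ∈ xs, P a) (hy : ∀ a ∈ ys, P a) (hxs : xs.Pairwise R) (hys : ys.Pairwise R) :
    (mergeC le xs ys).val.Pairwise R := by
  fun_induction mergeC le xs ys with
  | case1 ys => exact hys
  | case2 x xs => exact hxs
  | case3 x xs y ys ih1 ih2 =>
    have hxs' := List.pairwise_cons.1 hxs
    have hys' := List.pairwise_cons.1 hys
    have hxy := hle x y (hx x (by simp)) (hy y (by simp))
    simp only [bind_val, ite_val, pure_val]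
    split_ifs with hc
    · refine List.pairwise_cons.2 ⟨?_, ih1 (fun a ha => hx a (by simp [ha])) hy hxs'.2 hys⟩
      intro a ha
      have hR := hxy.1 hc
      rcases List.mem_append.1 ((mergeC_perm le _ _).subset ha) with h | h
      · exact hxs'.1 a h
      · rcases List.mem_cons.1 h with rfl | h
        · exact hR
        · exact htrans _ _ _ hR (hys'.1 a h)
    · refine List.pairwise_cons.2 ⟨?_, ih2 hx (fun a ha => hy a (by simp [ha])) hxs hys'.2⟩
      intro a ha
      have hR : R y x := (htotal x y).resolve_left fun h => hc (hxy.2 h)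
      rcases List.mem_append.1 ((mergeC_perm le _ _).subset ha) with h | h
      · rcases List.mem_cons.1 h with rfl | h
        · exact hR
        · exact htrans _ _ _ hR (hxs'.1 a h)
      · exact hys'.1 a h

theorem sortAux_spec {α : Type} {P : α → Prop} {R : α → α → Prop} {le : α → α → Comp Bool}
    (hle : ∀ a b, P a → P b → ((le a b).val = true ↔ R a b))
    (htrans : ∀ a b c, R a b → R b c → R a c) (htotal : ∀ a b, R a b ∨ R b a) :
    ∀ (k : ℕ) (l : List α), l.length ≤ k → (∀ a ∈ l, P a) →
      (sortAux le k l).val.Perm l ∧ (sortAux le k l).val.Pairwise R := by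
  intro k
  induction k with
  | zero =>
    intro l hl _
    obtain rfl : l = [] := List.length_eq_zero_iff.1 (by omega)
    simp [sortAux]
  | succ k ih =>
    intro l hl hP
    match l, hl, hP with
    | [], _, _ => simp [sortAux]
    | [a], _, _ => simp [sortAux]
    | a :: b :: l, hl, hP =>
      obtain ⟨h1, h2, h3⟩ := splitC_spec (a :: b :: l)
      simp only [List.length_cons] at h2 h3 hl
      simp only [sortAux, bind_val]
      set p := (splitC (a :: b :: l)).val with hp
      have hP1 : ∀ x ∈ p.1, P x := fun x hx => hP x (h1.subset (List.mem_append_left _ hx))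
      have hP2 : ∀ x ∈ p.2, P x := fun x hx => hP x (h1.subset (List.mem_append_right _ hx))
      obtain ⟨h4, h5⟩ := ih p.1 (by omega) hP1
      obtain ⟨h6, h7⟩ := ih p.2 (by omega) hP2
      exact ⟨(mergeC_perm le _ _).trans ((h4.append h6).trans h1),
        mergeC_sorted hle htrans htotal _ _ (fun x hx => hP1 x (h4.subset hx))
          (fun x hx => hP2 x (h6.subset hx)) h5 h7⟩

section
variable {n : ℕ} {g₁ g₂ : ℚ}

/-! ### The best arc on a circle -/

/-- The disk `b'` contains the disk `b`. -/
def Disk.Within (g₁ g₂ : ℚ) (b b' : Disk n) : Prop :=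
  Inside (b.radSq : ℝ) b'.radSq (‖b'.centre g₁ g₂ - b.centre g₁ g₂‖ ^ 2)

open scoped Classical in
theorem view_val (h₁ : 0 < g₁) (h₂ : 0 < g₂) (disks : List (Disk n)) (b : Disk n) :
    (view g₁ g₂ disks b).val = ⟨(disks.filter fun b' => b.Within g₁ g₂ b').reverse,
      ((disks.filter fun b' => b.Crosses g₁ g₂ b').map (chordOf g₁ g₂ b)).reverse⟩ := by
  have key : ∀ (l : List (Disk n)) (V : View n),
      (foldC (fun V b' => do
        let p ← qsub b'.x b.x
        let q ← qsub b'.y b.y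
        let D ← innerC g₁ g₂ p q p q
        let pos ← position b.radSq b'.radSq D
        match pos with
        | .crossing => do
          let c ← chord g₁ g₂ b b' p q D
          pure { V with chords := c :: V.chords }
        | .inside => pure { V with containing := b' :: V.containing }
        | _ => pure V) V l).val =
      ⟨(l.filter fun b' => b.Within g₁ g₂ b').reverse ++ V.containing,
        ((l.filter fun b' => b.Crosses g₁ g₂ b').map (chordOf g₁ g₂ b)).reverse ++ V.chords⟩ := by
    intro l
    induction l with
    | nil => intro V; rfl
    | cons b' l ih =>
      intro V
      have hD := Disk.centre_dist_sq h₁ h₂ b b'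
      have hcr : (position b.radSq b'.radSq (innerC g₁ g₂ (b'.x - b.x) (b'.y - b.y)
          (b'.x - b.x) (b'.y - b.y)).val).val = .crossing ↔ b.Crosses g₁ g₂ b' := by
        rw [position_crossing_iff, Disk.Crosses, hD]
      have hin : (position b.radSq b'.radSq (innerC g₁ g₂ (b'.x - b.x) (b'.y - b.y)
          (b'.x - b.x) (b'.y - b.y)).val).val = .inside ↔ b.Within g₁ g₂ b' := by
        rw [position_inside_iff, Disk.Within, hD]
      unfold foldC
      simp only [bind_val, qsub_val]
      rw [ih, List.filter_cons, List.filter_cons]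
      cases hpos : (position b.radSq b'.radSq (innerC g₁ g₂ (b'.x - b.x) (b'.y - b.y)
          (b'.x - b.x) (b'.y - b.y)).val).val with
      | crossing =>
        rw [hpos] at hcr hin
        have c1 := hcr.1 rfl
        have c2 : ¬ b.Within g₁ g₂ b' := fun h => by simpa using hin.2 h
        simp [c1, c2, chordOf]
      | inside =>
        rw [hpos] at hcr hin
        have c1 := hin.1 rfl
        have c2 : ¬ b.Crosses g₁ g₂ b' := fun h => by simpa using hcr.2 h
        simp [c1, c2]
      | outside =>
        rw [hpos] at hcr hin
        have c1 : ¬ b.Within g₁ g₂ b' := fun h => by simpa using hin.2 h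
        have c2 : ¬ b.Crosses g₁ g₂ b' := fun h => by simpa using hcr.2 h
        simp [c1, c2]
      | apart =>
        rw [hpos] at hcr hin
        have c1 : ¬ b.Within g₁ g₂ b' := fun h => by simpa using hin.2 h
        have c2 : ¬ b.Crosses g₁ g₂ b' := fun h => by simpa using hcr.2 h
        simp [c1, c2]
  have := key disks ⟨[], []⟩
  rw [List.append_nil, List.append_nil] at this
  exact this

theorem foldl_pairs_perm {α : Type} (l : List (α × α)) (acc : List α) :
    (l.foldl (fun l p => p.1 :: p.2 :: l) acc).Perm ((l.flatMap fun p => [p.1, p.2]) ++ acc) := by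
  induction l generalizing acc with
  | nil => exact List.Perm.refl _
  | cons p l ih =>
    rw [List.foldl_cons]
    refine (ih _).trans ?_
    rw [List.flatMap_cons, List.append_assoc]
    refine List.perm_append_comm.trans ?_
    exact List.Perm.cons _ (List.Perm.cons _ List.perm_append_comm)

/-- What `bestArc` returns: the events are sorted, and no prefix of them leads to more disks than
the one that is returned. -/
theorem bestArc_spec (h₁ : 0 < g₁) (h₂ : 0 < g₂) {disks : List (Disk n)}
    (hid : (disks.map Disk.id).Nodup) {b : Disk n} (hb : 0 < b.radSq) :
    let A := (bestArc g₁ g₂ disks b).val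
    A.disk = b ∧ A.view = (view g₁ g₂ disks b).val ∧ ∃ pre suf,
      EventList g₁ g₂ A.view.chords (pre ++ suf) ∧ A.past = pre.reverse ∧
      (A.first.map Disk.id).Nodup ∧
      (∀ x, x ∈ A.first ↔ ∃ c ∈ A.view.chords, x = c.other ∧
        c.exitEvent.key g₁ g₂ < c.entryEvent.key g₁ g₂) ∧
      A.count = A.view.containing.length + pre.foldl countStep A.first.length ∧
      ∀ p q, pre ++ suf = p ++ q →
        p.foldl countStep A.first.length ≤ pre.foldl countStep A.first.length := by
  classical
  intro A
  have hr : 0 < √(b.radSq : ℝ) := Real.sqrt_pos.2 (by exact_mod_cast hb)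
  set V := (view g₁ g₂ disks b).val with hV
  have hVc := congrArg View.chords (view_val h₁ h₂ disks b)
  rw [← hV] at hVc
  simp only at hVc
  have hcs : ∀ c ∈ V.chords, ∃ b', b.Crosses g₁ g₂ b' ∧ c = chordOf g₁ g₂ b b' := by
    intro c hc
    rw [hVc, List.mem_reverse, List.mem_map] at hc
    obtain ⟨b', hb', rfl⟩ := hc
    exact ⟨b', by simpa using (List.mem_filter.1 hb').2, rfl⟩
  have hon : ∀ c ∈ V.chords, c.entryEvent.OnCircle g₁ g₂ √b.radSq ∧
      c.exitEvent.OnCircle g₁ g₂ √b.radSq := by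
    intro c hc
    obtain ⟨b', hb', rfl⟩ := hcs c hc
    exact onCircle_of_crosses h₁ h₂ hb'
  have hids : (V.chords.map fun c => c.other.id).Nodup := by
    rw [hVc, List.map_reverse, List.nodup_reverse, List.map_map]
    exact hid.sublist (List.filter_sublist.map _)
  -- the list of events before sorting
  set ends := V.chords.map fun c => (c.entryEvent, c.exitEvent) with hends
  set evs₀ := ends.foldl (fun l p => p.1 :: p.2 :: l) ([] : List (Event n)) with hevs₀
  have hperm₀ : evs₀.Perm (V.chords.flatMap fun c => [c.entryEvent, c.exitEvent]) := by
    have := foldl_pairs_perm ends []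
    rwa [List.append_nil, hends, List.flatMap_map] at this
  have hmem₀ : ∀ e, e ∈ evs₀ ↔ ∃ c ∈ V.chords, e = c.entryEvent ∨ e = c.exitEvent := by
    intro e
    rw [hperm₀.mem_iff]
    simp
  have hon₀ : ∀ e ∈ evs₀, e.OnCircle g₁ g₂ √b.radSq := by
    intro e he
    obtain ⟨c, hc, rfl | rfl⟩ := (hmem₀ e).1 he
    exacts [(hon c hc).1, (hon c hc).2]
  obtain ⟨hperm, hsorted⟩ := sortAux_spec (le := leEvent)
    (P := fun e : Event n => e.OnCircle g₁ g₂ √b.radSq)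
    (R := Event.Before g₁ g₂) (fun e f he hf => leEvent_iff h₁ h₂ hr he hf)
    (fun _ _ _ => Event.Before.trans) Event.before_total evs₀.length evs₀ le_rfl hon₀
  set evs := (sortAux leEvent evs₀.length evs₀).val with hevs
  have hE : EventList g₁ g₂ V.chords evs := by
    refine ⟨hids, ?_, fun e => (hperm.mem_iff).trans (hmem₀ e), ?_, hsorted⟩
    · intro c hc
      obtain ⟨b', hb', rfl⟩ := hcs c hc
      exact key_entry_ne_key_exit h₁ h₂ hb'
    · rw [hperm.nodup_iff, hperm₀.nodup_iff, List.nodup_flatMap]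
      refine ⟨fun c _ => by simp [entryEvent_ne_exitEvent], ?_⟩
      rw [List.Nodup, List.pairwise_map] at hids
      refine hids.imp fun {c c'} hne => ?_
      have hne' : ∀ e ∈ [c.entryEvent, c.exitEvent], e.other.id = c.other.id := by
        simp [entryEvent_other, exitEvent_other]
      have hne'' : ∀ e ∈ [c'.entryEvent, c'.exitEvent], e.other.id = c'.other.id := by
        simp [entryEvent_other, exitEvent_other]
      intro e he he'
      exact hne ((hne' e he).symm.trans (hne'' e he'))
  set first := ends.filterMap fun p =>
    if (cmpEvent p.2 p.1).val < 0 then some p.1.other else none with hfirst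
  have hfirst' : first = (V.chords.filter fun c =>
      decide (c.exitEvent.key g₁ g₂ < c.entryEvent.key g₁ g₂)).map Chord.other := by
    rw [hfirst, hends, List.filterMap_map]
    have : ∀ l : List (Chord n), (∀ c ∈ l, c ∈ V.chords) →
        l.filterMap ((fun p : Event n × Event n =>
          if (cmpEvent p.2 p.1).val < 0 then some p.1.other else none) ∘
            fun c => (c.entryEvent, c.exitEvent)) =
          (l.filter fun c => decide (c.exitEvent.key g₁ g₂ < c.entryEvent.key g₁ g₂)).map
            Chord.other := by
      intro l
      induction l with
      | nil => simp
      | cons c l ih =>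
        intro hl
        have hc := hon c (hl c (by simp))
        have hs := (cmpEvent_hasSign h₁ h₂ hr hc.2 hc.1).neg_iff
        rw [sub_neg] at hs
        have ih := ih fun x hx => hl x (by simp [hx])
        rw [List.filterMap_cons, List.filter_cons, ih]
        by_cases hlt : c.exitEvent.key g₁ g₂ < c.entryEvent.key g₁ g₂
        · simp [hlt, hs, entryEvent_other]
        · simp [hlt, hs]
    exact this _ fun _ h => h
  obtain ⟨-, -, ⟨pre, suf, hps, hpast, hbest⟩, hmax⟩ := sweep_spec first.length evs
  set s := evs.foldl (fun s e => (sweepStep s e).val) (⟨first.length, [], first.length, []⟩ : Sweep n)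
    with hs
  have hA : A = ⟨b, V, first, s.bestPast, V.containing.length + s.best⟩ := by
    simp only [A, bestArc, bind_val, pure_val, mapC_val, filterMapC_val, foldC_val, lengthC_val,
      nadd_val, sortC]
    rfl
  rw [hA]
  refine ⟨rfl, rfl, pre, suf, hps ▸ hE, hpast, ?_, ?_, by rw [hbest], ?_⟩
  · simp only
    rw [hfirst', List.map_map]
    exact hids.sublist (List.filter_sublist.map _)
  · intro x
    simp only
    rw [hfirst']
    simp only [List.mem_map, List.mem_filter, decide_eq_true_eq]
    constructor
    · rintro ⟨c, ⟨h1, h2⟩, rfl⟩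
      exact ⟨c, h1, rfl, h2⟩
    · rintro ⟨c, h1, rfl, h2⟩
      exact ⟨c, ⟨h1, h2⟩, rfl⟩
  · intro p q h
    rw [← hbest]
    exact hmax p q (hps.trans h)

theorem foldl_cons_eq {α : Type} (l acc : List α) :
    l.foldl (fun S b => b :: S) acc = l.reverse ++ acc := by
  induction l generalizing acc with
  | nil => rfl
  | cons a l ih => simp [ih]

theorem members_val (A : BestArc n) : (members A).val =
    A.view.containing.reverse ++ A.past.reverse.foldl replayStep A.first := by
  have h : ∀ (S : List (Disk n)) (e : Event n), (if e.entry then pure (e.other :: S)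
      else filterMapC (fun b : Disk n => do
        tick
        pure (if b.id = e.other.id then none else some b)) S : Comp (List (Disk n))).val =
      replayStep S e := by
    intro S e
    rw [ite_val, replayStep, filterMapC_val, pure_val]
    congr 1
    rw [← List.filterMap_eq_filter]
    congr 1
    funext x
    simp [Option.guard]
  simp only [members, bind_val, foldC_val, pure_val, h, foldl_cons_eq, List.append_nil]

end

end OCP

namespace OCP

/-! ### Optimal points of disks in the plane -/

/-- A nonempty intersection of disks has a boundary point that lies on one circle only, up to
equal disks: among the infinitely many rays from an inner point, one does not leave the
intersection at one of the finitely many common points of two circles. -/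
theorem exists_boundary_point {ι : Type*} {S : Set ι} (hS : S.Finite) (hne : S.Nonempty)
    {c : ι → ℂ} {ρ : ι → ℝ} {z₀ : ℂ} (hz₀ : ∀ j ∈ S, power (c j) (ρ j) z₀ < 0) :
    ∃ b ∈ S, ∃ z, power (c b) (ρ b) z = 0 ∧
      ∀ j ∈ S, power (c j) (ρ j) z < 0 ∨ (c j = c b ∧ ρ j = ρ b) := by
  have hray : ∀ s : ℝ, ∃ τ : ℝ, 0 < τ ∧
      (∃ b ∈ S, power (c b) (ρ b) (z₀ + τ * ⟨1, s⟩) = 0) ∧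
      ∀ j ∈ S, power (c j) (ρ j) (z₀ + τ * ⟨1, s⟩) ≤ 0 := by
    intro s
    set u : ℂ := ⟨1, s⟩ with hu
    have hne' : hS.toFinset.Nonempty := by simpa using hne
    set G : ℝ → ℝ := fun τ =>
      hS.toFinset.sup' hne' fun j => power (c j) (ρ j) (z₀ + τ * u) with hG
    have hcont : Continuous G := by
      apply Continuous.finset_sup'_apply
      intro j _
      unfold power
      fun_prop
    have hG0 : G 0 < 0 := by
      rw [hG]
      simp only [Finset.sup'_lt_iff]
      intro j hj
      simpa using hz₀ j (by simpa using hj)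
    obtain ⟨j₀, hj₀⟩ := hne
    set T := ‖z₀ - c j₀‖ + √(ρ j₀) with hT
    have hρ : 0 < ρ j₀ := by
      have := hz₀ j₀ hj₀
      unfold power at this
      nlinarith [sq_nonneg ‖z₀ - c j₀‖]
    have hT0 : 0 < T := by
      have := Real.sqrt_pos.2 hρ
      have := norm_nonneg (z₀ - c j₀)
      linarith
    have hGT : 0 ≤ G T := by
      refine le_trans ?_ (Finset.le_sup' (fun j => power (c j) (ρ j) (z₀ + T * u))
        (hS.mem_toFinset.2 hj₀))
      have h1 : 1 ≤ ‖u‖ := by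
        have := Complex.abs_re_le_norm u
        simpa [hu] using this
      have h2 : T ≤ ‖(T : ℂ) * u‖ := by
        rw [norm_mul, Complex.norm_real, Real.norm_eq_abs, abs_of_pos hT0]
        exact le_mul_of_one_le_right hT0.le h1
      have h3 : ‖(T : ℂ) * u‖ ≤ ‖z₀ + T * u - c j₀‖ + ‖z₀ - c j₀‖ := by
        have : (T : ℂ) * u = (z₀ + T * u - c j₀) - (z₀ - c j₀) := by ring
        rw [this]
        convert norm_sub_le _ _ using 2
        ring_nf
      have h4 : √(ρ j₀) ≤ ‖z₀ + T * u - c j₀‖ := by linarith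
      have h5 := pow_le_pow_left₀ (Real.sqrt_nonneg _) h4 2
      rw [Real.sq_sqrt hρ.le] at h5
      unfold power
      linarith
    obtain ⟨τ, ⟨hτ0, -⟩, hτ⟩ := intermediate_value_Icc hT0.le hcont.continuousOn
      ⟨hG0.le, hGT⟩
    have hle : ∀ j ∈ S, power (c j) (ρ j) (z₀ + τ * u) ≤ 0 := fun j hj => by
      rw [← hτ]
      exact Finset.le_sup' (fun j => power (c j) (ρ j) (z₀ + τ * u)) (hS.mem_toFinset.2 hj)
    refine ⟨τ, lt_of_le_of_ne hτ0 ?_, ?_, hle⟩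
    · rintro rfl
      exact hG0.ne hτ
    · obtain ⟨b, hb, hb'⟩ := Finset.exists_mem_eq_sup' hne'
        (fun j => power (c j) (ρ j) (z₀ + τ * u))
      exact ⟨b, by simpa using hb, hb'.symm.trans hτ⟩
  choose τ hτ hb hle using hray
  by_contra! hno
  have hbad : Set.range (fun s => z₀ + τ s * (⟨1, s⟩ : ℂ)) ⊆
      ⋃ b ∈ S, ⋃ j ∈ {j ∈ S | c j ≠ c b},
        {z | power (c b) (ρ b) z = 0 ∧ power (c j) (ρ j) z = 0} := by
    rintro _ ⟨s, rfl⟩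
    obtain ⟨b, hbS, hb0⟩ := hb s
    obtain ⟨j, hjS, hj, hj'⟩ := hno b hbS _ hb0
    have hj0 := le_antisymm (hle s j hjS) hj
    simp only [Set.mem_iUnion]
    refine ⟨b, hbS, j, ⟨hjS, fun hcc => hj' hcc ?_⟩, hb0, hj0⟩
    rw [hcc] at hj0
    unfold power at hb0 hj0
    linarith
  refine Set.infinite_range_of_injective (f := fun s => z₀ + τ s * (⟨1, s⟩ : ℂ)) ?_
    (Set.Finite.subset ?_ hbad)
  · intro s s' h
    have h1 := add_left_cancel h
    have h2 := congrArg Complex.re h1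
    have h3 := congrArg Complex.im h1
    simp at h2 h3
    rw [← h2] at h3
    exact mul_left_cancel₀ (hτ s).ne' h3
  · refine hS.biUnion fun b _ => Set.Finite.biUnion (hS.subset (Set.sep_subset _ _)) ?_
    intro j hj
    exact finite_common_points hj.2 _ _

theorem Crossing.symm {ρ ρ' D : ℝ} (h : Crossing ρ ρ' D) : Crossing ρ' ρ D := by
  unfold Crossing at *
  rw [add_comm ρ' ρ, mul_comm ρ' ρ]
  exact h

section
variable {n : ℕ} {g₁ g₂ : ℚ}

theorem Disk.within_of_eq {b b' : Disk n} (h : b'.centre g₁ g₂ = b.centre g₁ g₂)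
    (hr : (b'.radSq : ℝ) = b.radSq) (hb : 0 < b.radSq) : b.Within g₁ g₂ b' := by
  have hb' : (0 : ℝ) < b.radSq := by exact_mod_cast hb
  unfold Disk.Within Inside Crossing
  rw [h, hr, sub_self, norm_zero]
  refine ⟨?_, by linarith, le_rfl⟩
  rw [not_lt]
  apply le_of_eq
  ring

theorem Disk.not_within_of_crosses {b b' : Disk n} (h : b.Crosses g₁ g₂ b') :
    ¬ b.Within g₁ g₂ b' := fun h' => h'.1 h

/-- Two disks with a common point `z₀`, such that a point `z` of the circle of the first one lies
in the second one: either they cross or the second contains the first. -/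
theorem Disk.crosses_or_within {b b' : Disk n} (hb' : 0 < b'.radSq) {z₀ z : ℂ}
    (h0 : b.power g₁ g₂ z₀ < 0) (h0' : b'.power g₁ g₂ z₀ < 0) (hz : b.power g₁ g₂ z = 0)
    (hz' : b'.power g₁ g₂ z < 0) : b.Crosses g₁ g₂ b' ∨ b.Within g₁ g₂ b' := by
  by_contra! h
  obtain ⟨h1, h2⟩ := h
  unfold Disk.Crosses at h1
  unfold Disk.Within Inside at h2
  have hs : 0 ≤ (b.radSq : ℝ) + b'.radSq - ‖b'.centre g₁ g₂ - b.centre g₁ g₂‖ ^ 2 := by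
    by_contra! h3
    exact absurd (power_nonneg_of_apart h1 h3 h0) (not_le.2 h0')
  have h3 : (b'.radSq : ℝ) < b.radSq := by
    by_contra! h3
    exact h2 ⟨h1, hs, h3⟩
  have hin : Inside (b'.radSq : ℝ) b.radSq (‖b.centre g₁ g₂ - b'.centre g₁ g₂‖ ^ 2) := by
    rw [norm_sub_rev]
    exact ⟨fun hc => h1 hc.symm, by linarith, h3.le⟩
  have h4 := hin.power_le (t := z) (by exact_mod_cast hb') hz'.le
  unfold Disk.power at hz hz'
  linarith

theorem exists_split_key {l : List (Event n)} (h : l.Pairwise (Event.Before g₁ g₂)) (θ : ℝ) :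
    ∃ p q, l = p ++ q ∧ (∀ e ∈ p, e.key g₁ g₂ < θ) ∧ ∀ e ∈ q, θ ≤ e.key g₁ g₂ := by
  induction l with
  | nil => exact ⟨[], [], rfl, by simp, by simp⟩
  | cons e l ih =>
    rw [List.pairwise_cons] at h
    by_cases he : e.key g₁ g₂ < θ
    · obtain ⟨p, q, rfl, h1, h2⟩ := ih h.2
      refine ⟨e :: p, q, rfl, ?_, h2⟩
      simpa [he] using h1
    · refine ⟨[], e :: l, rfl, by simp, ?_⟩
      intro f hf
      rcases List.mem_cons.1 hf with rfl | hf
      · exact not_lt.1 he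
      · exact (not_lt.1 he).trans (h.1 f hf).key_le

open scoped Classical in
/-- The number of disks that contain the point `z`. -/
noncomputable def diskDepth (g₁ g₂ : ℚ) (disks : List (Disk n)) (z : ℂ) : ℕ :=
  disks.countP fun b => b.power g₁ g₂ z < 0

theorem mem_containing_iff (h₁ : 0 < g₁) (h₂ : 0 < g₂) {disks : List (Disk n)} {b x : Disk n} :
    x ∈ (view g₁ g₂ disks b).val.containing ↔ x ∈ disks ∧ b.Within g₁ g₂ x := by
  classical
  rw [view_val h₁ h₂]
  simp

theorem mem_chords_iff (h₁ : 0 < g₁) (h₂ : 0 < g₂) {disks : List (Disk n)} {b : Disk n}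
    {c : Chord n} : c ∈ (view g₁ g₂ disks b).val.chords ↔
      ∃ x ∈ disks, b.Crosses g₁ g₂ x ∧ c = chordOf g₁ g₂ b x := by
  classical
  rw [view_val h₁ h₂]
  simp only [List.mem_reverse, List.mem_map, List.mem_filter, decide_eq_true_eq]
  constructor
  · rintro ⟨x, ⟨h1, h2⟩, rfl⟩
    exact ⟨x, h1, h2, rfl⟩
  · rintro ⟨x, h1, h2, rfl⟩
    exact ⟨x, ⟨h1, h2⟩, rfl⟩

/-- The best arc of some circle is at least as good as any given point. -/
theorem exists_bestArc_ge (h₁ : 0 < g₁) (h₂ : 0 < g₂) {disks : List (Disk n)}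
    (hid : (disks.map Disk.id).Nodup) (hpos : ∀ b ∈ disks, 0 < b.radSq) (hne : disks ≠ []) (z₀ : ℂ) :
    ∃ b ∈ disks, diskDepth g₁ g₂ disks z₀ ≤ (bestArc g₁ g₂ disks b).val.count := by
  classical
  rcases Nat.eq_zero_or_pos (diskDepth g₁ g₂ disks z₀) with h0 | h0
  · obtain ⟨b, hb⟩ := List.exists_mem_of_ne_nil _ hne
    exact ⟨b, hb, by omega⟩
  set S : Set (Disk n) := {b | b ∈ disks ∧ b.power g₁ g₂ z₀ < 0} with hS
  have hSfin : S.Finite := disks.finite_toSet.subset fun b hb => hb.1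
  have hSne : S.Nonempty := by
    obtain ⟨b, hb, hb'⟩ := List.countP_pos_iff.1 h0
    exact ⟨b, hb, by simpa using hb'⟩
  obtain ⟨b, ⟨hb, hbz₀⟩, z, hz, hall⟩ := exists_boundary_point hSfin hSne
    (c := fun b => b.centre g₁ g₂) (ρ := fun b => (b.radSq : ℝ)) (z₀ := z₀) fun j hj => hj.2
  refine ⟨b, hb, ?_⟩
  have hbpos := hpos b hb
  obtain ⟨-, hV, pre, suf, hE, -, hfid, hfm, hcount, hmax⟩ := bestArc_spec h₁ h₂ hid hbpos
  set A := (bestArc g₁ g₂ disks b).val with hA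
  obtain ⟨p, q, hpq, hp, hq⟩ := exists_split_key hE.sorted (-(z - b.centre g₁ g₂).arg)
  have hE' : EventList g₁ g₂ A.view.chords (p ++ q) := hpq ▸ hE
  obtain ⟨hR1, hR2, hR3⟩ := hE'.replay_spec hfid hfm p q rfl
  set R := p.foldl replayStep A.first with hR
  have hle : diskDepth g₁ g₂ disks z₀ ≤ (A.view.containing ++ R).length := by
    rw [diskDepth, List.countP_eq_length_filter]
    apply List.Subperm.length_le
    apply List.subperm_of_subset ((List.Nodup.of_map _ hid).filter _)
    intro x hx
    rw [List.mem_filter, decide_eq_true_eq] at hx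
    rw [List.mem_append]
    rcases hall x ⟨hx.1, hx.2⟩ with hxz | ⟨hxc, hxr⟩
    · rcases Disk.crosses_or_within (hpos x hx.1) hbz₀ hx.2 hz hxz with hcr | hin
      · right
        have hc : chordOf g₁ g₂ b x ∈ A.view.chords := by
          rw [hV, mem_chords_iff h₁ h₂]
          exact ⟨x, hx.1, hcr, rfl⟩
        refine (hR2 x).2 ⟨_, hc, rfl, hE'.active_of_between hp hq hc ?_⟩
        have hnorm : ‖z - b.centre g₁ g₂‖ = √b.radSq := by
          rw [eq_comm, Real.sqrt_eq_iff_eq_sq (by exact_mod_cast hbpos.le) (norm_nonneg _)]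
          unfold power at hz
          linarith
        refine (power_neg_iff_between h₁ h₂ hbpos hcr hnorm).1 ?_
        rwa [add_sub_cancel]
      · left
        rw [hV, mem_containing_iff h₁ h₂]
        exact ⟨hx.1, hin⟩
    · left
      rw [hV, mem_containing_iff h₁ h₂]
      exact ⟨hx.1, Disk.within_of_eq hxc hxr hbpos⟩
  have := hmax p q hpq
  rw [List.length_append, ← hR3] at hle
  omega

theorem exists_plane_point_of_arg {r θ : ℝ} (hr : 0 < r) (h1 : -Real.pi < θ) (h2 : θ < Real.pi) :
    ∃ z : ℂ, ‖z‖ = r ∧ -z.arg = θ := by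
  refine ⟨r * (Complex.cos ((-θ : ℝ) : ℂ) + Complex.sin ((-θ : ℝ) : ℂ) * Complex.I), ?_, ?_⟩
  · rw [norm_mul, Complex.norm_cos_add_sin_mul_I, mul_one, Complex.norm_real, Real.norm_eq_abs,
      abs_of_pos hr]
  · rw [Complex.arg_mul_cos_add_sin_mul_I hr ⟨by linarith, by linarith⟩, neg_neg]

/-- What the best arc of a circle stands for: distinct disks, which have a common point where the
disk of the circle has the largest power. -/
theorem members_spec (h₁ : 0 < g₁) (h₂ : 0 < g₂) {disks : List (Disk n)}
    (hid : (disks.map Disk.id).Nodup) {b : Disk n} (hbm : b ∈ disks) (hb : 0 < b.radSq) :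
    let A := (bestArc g₁ g₂ disks b).val
    let S := (members A).val
    (S.map Disk.id).Nodup ∧ (∀ x ∈ S, x ∈ disks) ∧ S.length = A.count ∧ b ∈ S ∧
      (∀ x ∈ S, b.Crosses g₁ g₂ x ∨ b.Within g₁ g₂ x) ∧
      ∃ t, b.power g₁ g₂ t < 0 ∧ ∀ x ∈ S, x.power g₁ g₂ t ≤ b.power g₁ g₂ t := by
  classical
  intro A S
  obtain ⟨-, hV, pre, suf, hE, hpast, hfid, hfm, hcount, hmax⟩ := bestArc_spec h₁ h₂ hid hb
  change A.view = _ at hV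
  change EventList g₁ g₂ A.view.chords (pre ++ suf) at hE
  obtain ⟨hR1, hR2, hR3⟩ := hE.replay_spec hfid hfm pre suf rfl
  change pre.foldl countStep A.first.length = _ at hR3
  change A.count = _ at hcount
  have hS : S = A.view.containing.reverse ++ pre.foldl replayStep A.first := by
    change (members A).val = _
    rw [members_val, show A.past = pre.reverse from hpast, List.reverse_reverse]
  set R := pre.foldl replayStep A.first with hR
  have hRc : ∀ x ∈ R, ∃ c ∈ A.view.chords, c = chordOf g₁ g₂ b x ∧ x ∈ disks ∧
      b.Crosses g₁ g₂ x ∧ c.Active g₁ g₂ pre := by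
    intro x hx
    obtain ⟨c, hc, rfl, hact⟩ := (hR2 x).1 hx
    have hc' := hc
    rw [hV, mem_chords_iff h₁ h₂] at hc'
    obtain ⟨y, hy, hcr, rfl⟩ := hc'
    exact ⟨_, hc, rfl, hy, hcr, hact⟩
  have hCc : ∀ x ∈ A.view.containing.reverse, x ∈ disks ∧ b.Within g₁ g₂ x := by
    intro x hx
    rwa [List.mem_reverse, hV, mem_containing_iff h₁ h₂] at hx
  have hbR : (0 : ℝ) < b.radSq := by exact_mod_cast hb
  refine ⟨?_, ?_, ?_, ?_, ?_, ?_⟩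
  · rw [hS, List.map_append, List.nodup_append]
    refine ⟨?_, hR1, ?_⟩
    · rw [hV, view_val h₁ h₂]
      simp only [List.reverse_reverse]
      exact hid.sublist (List.filter_sublist.map _)
    · intro i hi i' hi' hii
      obtain ⟨x, hx, rfl⟩ := List.mem_map.1 hi
      obtain ⟨y, hy, rfl⟩ := List.mem_map.1 hi'
      obtain ⟨c, -, -, hyd, hcr, -⟩ := hRc y hy
      obtain ⟨hxd, hin⟩ := hCc x hx
      obtain rfl := List.inj_on_of_nodup_map hid hxd hyd hii
      exact Disk.not_within_of_crosses hcr hin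
  · intro x hx
    rw [hS, List.mem_append] at hx
    rcases hx with hx | hx
    · exact (hCc x hx).1
    · obtain ⟨-, -, -, h, -⟩ := hRc x hx
      exact h
  · rw [hS, List.length_append, List.length_reverse, ← hR3, hcount]
  · rw [hS, List.mem_append, List.mem_reverse, hV, mem_containing_iff h₁ h₂]
    exact Or.inl ⟨hbm, Disk.within_of_eq rfl rfl hb⟩
  · intro x hx
    rw [hS, List.mem_append] at hx
    rcases hx with hx | hx
    · exact Or.inr (hCc x hx).2
    · obtain ⟨-, -, -, -, h, -⟩ := hRc x hx
      exact Or.inl h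
  · -- the arc at the start and the arc after all events are the same
    obtain ⟨p, q, hE', hsep, hact, hnil⟩ : ∃ p q, EventList g₁ g₂ A.view.chords (p ++ q) ∧
        (∀ e ∈ p, ∀ f ∈ q, e.key g₁ g₂ < f.key g₁ g₂) ∧
        (∀ c ∈ A.view.chords, c.Active g₁ g₂ pre → c.Active g₁ g₂ p) ∧ (p = [] → q = []) := by
      by_cases hpre : pre = []
      · refine ⟨pre ++ suf, [], by rwa [List.append_nil], by simp, ?_, by simp⟩
        intro c hc h
        rw [hpre] at h
        unfold Chord.Active at h ⊢
        split_ifs at h ⊢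
        · exact fun _ => (hE.mem_iff _).2 ⟨c, hc, Or.inl rfl⟩
        · simp at h
      · exact ⟨pre, suf, hE, hE.key_lt_of_max hfid hfm hmax, fun _ _ h => h,
          fun h => absurd h hpre⟩
    have hkey : ∀ e : Event n, -Real.pi ≤ e.key g₁ g₂ ∧ e.key g₁ g₂ < Real.pi := fun e =>
      ⟨neg_le_neg (Complex.arg_le_pi _), by
        have := Complex.neg_pi_lt_arg (e.point g₁ g₂)
        unfold Event.key
        linarith⟩
    obtain ⟨θ, hθ1, hθ2⟩ := Order.exists_between_finsets
      (insert (-Real.pi) (p.map (Event.key g₁ g₂)).toFinset)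
      (insert Real.pi (q.map (Event.key g₁ g₂)).toFinset) (by
        intro x hx y hy
        simp only [Finset.mem_insert, List.mem_toFinset, List.mem_map] at hx hy
        rcases hx with rfl | ⟨e, he, rfl⟩ <;> rcases hy with rfl | ⟨f, hf, rfl⟩
        · linarith [Real.pi_pos]
        · obtain ⟨e, he⟩ := List.exists_mem_of_ne_nil p fun h => by simp [hnil h] at hf
          exact (hkey e).1.trans_lt (hsep e he f hf)
        · exact (hkey e).2
        · exact hsep e he f hf)
    simp only [Finset.mem_insert, List.mem_toFinset, List.mem_map, forall_eq_or_imp,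
      forall_exists_index, and_imp, forall_apply_eq_imp_iff₂] at hθ1 hθ2
    obtain ⟨z, hz, hzθ⟩ := exists_plane_point_of_arg (Real.sqrt_pos.2 hbR) hθ1.1 hθ2.1
    set P := b.centre g₁ g₂ + z with hP
    have hbP : b.power g₁ g₂ P = 0 := by
      rw [Disk.power, power, hP, add_sub_cancel_left, hz, Real.sq_sqrt hbR.le, sub_self]
    have hRP : ∀ x ∈ R, x.power g₁ g₂ P < 0 := by
      intro x hx
      obtain ⟨c, hc, rfl, hxd, hcr, hac⟩ := hRc x hx
      refine (power_neg_iff_between h₁ h₂ hb hcr hz).2 ?_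
      rw [hzθ]
      exact hE'.between_of_active hθ1.2 hθ2.2 hc (hact _ hc hac)
    -- move from the arc a little towards the centre
    set t : ℝ → ℂ := fun ε => P + ε • (b.centre g₁ g₂ - P) with ht
    have hbt : ∀ ε, 0 < ε → ε < 1 → b.power g₁ g₂ (t ε) < 0 := by
      intro ε h0 h1
      refine lt_of_le_of_lt (power_segment_le h0.le h1.le) ?_
      have hc : power (b.centre g₁ g₂) b.radSq (b.centre g₁ g₂) = -b.radSq := by
        simp [power]
      rw [show power (b.centre g₁ g₂) b.radSq P = 0 from hbP, hc]
      nlinarith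
    have hev : ∀ᶠ ε in nhdsWithin (0 : ℝ) (Set.Ioi 0), ∀ x ∈ {x | x ∈ R},
        x.power g₁ g₂ (t ε) < b.power g₁ g₂ (t ε) := by
      rw [Filter.eventually_all_finite R.finite_toSet]
      intro x hx
      have hc1 : Continuous fun ε => x.power g₁ g₂ (t ε) := by
        unfold Disk.power power
        fun_prop
      have hc2 : Continuous fun ε => b.power g₁ g₂ (t ε) := by
        unfold Disk.power power
        fun_prop
      have ht0 : t 0 = P := by simp [ht]
      refine nhdsWithin_le_nhds ((isOpen_lt hc1 hc2).mem_nhds ?_)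
      change x.power g₁ g₂ (t 0) < b.power g₁ g₂ (t 0)
      rw [ht0, hbP]
      exact hRP x hx
    obtain ⟨ε, hε, hε0, hε1⟩ := (hev.and (Ioo_mem_nhdsGT (zero_lt_one' ℝ))).exists
    refine ⟨t ε, hbt ε hε0 hε1, ?_⟩
    intro x hx
    rw [hS, List.mem_append] at hx
    rcases hx with hx | hx
    · exact (hCc x hx).2.power_le hbR (hbt ε hε0 hε1).le
    · exact (hε x hx).le

end

end OCP

namespace OCP

section
variable {n : ℕ} {g₁ g₂ : ℚ}

/-! ### A rational point of the best arc -/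

/-- On the line of a chord, the power with respect to a disk is a quadratic polynomial with
leading coefficient `‖w'‖²`, whose negative values form the trace of the disk. -/
theorem power_trace (h₁ : 0 < g₁) (h₂ : 0 < g₂) (b : Disk n) {c : Chord n}
    (hE : c.normSq' = g₁ * (c.p' * c.p') + g₂ * (c.q' * c.q')) (hE0 : 0 < c.normSq') (j : Disk n)
    (u : ℝ) :
    j.power g₁ g₂ (planePoint g₁ g₂ (b.x + c.α * c.p + u * c.p') (b.y + c.α * c.q + u * c.q')) =
      c.normSq' * ((u - (trace g₁ g₂ b c j).val.s) ^ 2 - (trace g₁ g₂ b c j).val.σ) := by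
  rw [Disk.power_planePoint h₁ h₂]
  simp only [trace, bind_val, qmul_val, qadd_val, qsub_val, qdiv_val, innerC_val, pure_val]
  have hER : (c.normSq' : ℝ) = g₁ * (c.p' * c.p') + g₂ * (c.q' * c.q') := by exact_mod_cast hE
  have hE1 : (c.normSq' : ℝ) ≠ 0 := by exact_mod_cast hE0.ne'
  push_cast
  field_simp
  linear_combination (-u ^ 2 * c.normSq' : ℝ) * hER

theorem power_trace_neg_iff (h₁ : 0 < g₁) (h₂ : 0 < g₂) (b : Disk n) {c : Chord n}
    (hE : c.normSq' = g₁ * (c.p' * c.p') + g₂ * (c.q' * c.q')) (hE0 : 0 < c.normSq') (j : Disk n)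
    (u : ℝ) :
    j.power g₁ g₂ (planePoint g₁ g₂ (b.x + c.α * c.p + u * c.p') (b.y + c.α * c.q + u * c.q')) < 0 ↔
      (u - (trace g₁ g₂ b c j).val.s) ^ 2 < (trace g₁ g₂ b c j).val.σ := by
  have hE1 : (0 : ℝ) < c.normSq' := by exact_mod_cast hE0
  rw [power_trace h₁ h₂ b hE hE0, ← smul_eq_mul, smul_neg_iff_of_pos_left hE1, sub_neg]

/-- The point that `arcPoint` finds on the line of one chord. -/
def chordPoint (g₁ g₂ : ℚ) (b : Disk n) (c : Chord n) (S : List (Disk n)) : Option (ℚ × ℚ) :=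
  match S.map fun j => (trace g₁ g₂ b c j).val with
  | [] => none
  | J :: Js => if (J :: Js).all fun K => decide (0 < K.σ) then
      (commonPoint J Js).val.map fun a =>
        (b.x + c.α * c.p + a * c.p', b.y + c.α * c.q + a * c.q')
    else none

theorem arcPoint_val (b : Disk n) {chords : List (Chord n)} (hne : chords ≠ [])
    (S : List (Disk n)) : (arcPoint g₁ g₂ b chords S).val =
      chords.foldl (fun found c => (chordPoint g₁ g₂ b c S).or found) none := by
  match chords, hne with
  | c :: chords, _ =>
    simp only [arcPoint, foldC_val, bind_val, mapC_val]
    congr 1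
    funext found c
    unfold chordPoint
    rcases S.map (fun j => (trace g₁ g₂ b c j).val) with _ | ⟨J, Js⟩
    · rfl
    · simp only [bind_val, allC_val, ite_val, pure_val, qlt_val]
      split_ifs with h
      · cases (commonPoint J Js).val <;> rfl
      · rfl

theorem power_neg_of_chordPoint (h₁ : 0 < g₁) (h₂ : 0 < g₂) {b : Disk n} {c : Chord n}
    (hE : c.normSq' = g₁ * (c.p' * c.p') + g₂ * (c.q' * c.q')) (hE0 : 0 < c.normSq')
    {S : List (Disk n)} {x y : ℚ} (h : chordPoint g₁ g₂ b c S = some (x, y)) :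
    ∀ j ∈ S, j.power g₁ g₂ (planePoint g₁ g₂ x y) < 0 := by
  intro j hj
  unfold chordPoint at h
  have hmem : (trace g₁ g₂ b c j).val ∈ S.map fun j => (trace g₁ g₂ b c j).val :=
    List.mem_map_of_mem hj
  rcases hJ : S.map (fun j => (trace g₁ g₂ b c j).val) with _ | ⟨J, Js⟩
  · rw [hJ] at hmem
    simp at hmem
  · rw [hJ] at h hmem
    simp only at h
    split_ifs at h
    obtain ⟨a, ha, hxy⟩ := Option.map_eq_some_iff.1 h
    have hlt := commonPoint_mem ha _ hmem
    simp only [Prod.mk.injEq] at hxy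
    obtain ⟨rfl, rfl⟩ := hxy
    have := (power_trace_neg_iff h₁ h₂ b hE hE0 j a).2 (by rw [sq]; exact_mod_cast hlt)
    push_cast
    exact this

theorem exists_chordPoint (h₁ : 0 < g₁) (h₂ : 0 < g₂) {b : Disk n} {c : Chord n}
    (hE : c.normSq' = g₁ * (c.p' * c.p') + g₂ * (c.q' * c.q')) (hE0 : 0 < c.normSq')
    {S : List (Disk n)} (hne : S ≠ []) {u : ℝ} (hu : ∀ j ∈ S, j.power g₁ g₂
      (planePoint g₁ g₂ (b.x + c.α * c.p + u * c.p') (b.y + c.α * c.q + u * c.q')) < 0) :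
    ∃ z, chordPoint g₁ g₂ b c S = some z := by
  have hall : ∀ K ∈ S.map (fun j => (trace g₁ g₂ b c j).val), (u - K.s) ^ 2 < K.σ := by
    intro K hK
    obtain ⟨j, hj, rfl⟩ := List.mem_map.1 hK
    exact (power_trace_neg_iff h₁ h₂ b hE hE0 j u).1 (hu j hj)
  unfold chordPoint
  rcases hJ : S.map (fun j => (trace g₁ g₂ b c j).val) with _ | ⟨J, Js⟩
  · simp [hne] at hJ
  · rw [hJ] at hall
    have hσ : ∀ K ∈ J :: Js, 0 < K.σ := fun K hK => by
      have : (0 : ℝ) < K.σ := lt_of_le_of_lt (sq_nonneg _) (hall K hK)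
      exact_mod_cast this
    obtain ⟨a, ha⟩ := exists_commonPoint hσ hall
    simp only
    rw [if_pos (List.all_eq_true.2 fun K hK => by simpa using hσ K hK), ha]
    exact ⟨_, rfl⟩

theorem foldl_or_spec {α γ : Type} (f : α → Option γ) (P : γ → Prop) (l : List α)
    (hP : ∀ a ∈ l, ∀ z, f a = some z → P z) :
    ∀ o : Option γ, (∀ z, o = some z → P z) → ((∃ z, o = some z) ∨ ∃ a ∈ l, ∃ z, f a = some z) →
      ∃ z, l.foldl (fun found a => (f a).or found) o = some z ∧ P z := by
  induction l with
  | nil =>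
    intro o ho h
    obtain ⟨z, hz⟩ := h.resolve_right (by simp)
    exact ⟨z, hz, ho z hz⟩
  | cons a l ih =>
    intro o ho h
    rw [List.foldl_cons]
    refine ih (fun x hx => hP x (List.mem_cons_of_mem _ hx)) _ ?_ ?_
    · intro z hz
      cases hf : f a with
      | none =>
        rw [hf, Option.none_or] at hz
        exact ho z hz
      | some z' =>
        rw [hf, Option.some_or] at hz
        exact hP a (by simp) z (hf.trans hz)
    · cases hf : f a with
      | none =>
        rw [Option.none_or]
        refine h.imp id ?_
        rintro ⟨x, hx, z, hz⟩
        rcases List.mem_cons.1 hx with rfl | hx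
        · rw [hf] at hz
          simp at hz
        · exact ⟨x, hx, z, hz⟩
      | some z' => exact Or.inl ⟨z', rfl⟩

theorem length_le_diskDepth {disks T : List (Disk n)} (hT : T.Nodup) (hd : ∀ x ∈ T, x ∈ disks)
    {z : ℂ} (hz : ∀ x ∈ T, x.power g₁ g₂ z < 0) : T.length ≤ diskDepth g₁ g₂ disks z := by
  classical
  rw [diskDepth, List.countP_eq_length_filter]
  apply List.Subperm.length_le
  apply List.subperm_of_subset hT
  intro x hx
  exact List.mem_filter.2 ⟨hd x hx, by simpa using hz x hx⟩

theorem chordOf_normSq (b b' : Disk n) : (chordOf g₁ g₂ b b').normSq' =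
    g₁ * ((chordOf g₁ g₂ b b').p' * (chordOf g₁ g₂ b b').p') +
      g₂ * ((chordOf g₁ g₂ b b').q' * (chordOf g₁ g₂ b b').q') := rfl

/-- Every point of equal power with respect to two crossing disks lies on the line of their
chord. -/
theorem exists_parameter (h₁ : 0 < g₁) (h₂ : 0 < g₂) {b k : Disk n} (hc : b.Crosses g₁ g₂ k)
    {t : ℂ} (ht : b.power g₁ g₂ t = k.power g₁ g₂ t) :
    let c := chordOf g₁ g₂ b k
    ∃ u : ℝ, t = planePoint g₁ g₂ (b.x + c.α * c.p + u * c.p') (b.y + c.α * c.q + u * c.q') := by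
  intro c
  obtain ⟨hD, -, -, hα, -⟩ := chordOf_spec h₁ h₂ hc
  set w := k.centre g₁ g₂ - b.centre g₁ g₂ with hw
  have hw0 : w ≠ 0 := by
    rintro h
    simp [h] at hD
  have hpow := power_sub_power (b.centre g₁ g₂) (k.centre g₁ g₂) b.radSq k.radSq t
  unfold Disk.power at ht
  rw [ht, sub_self, ← hw] at hpow
  obtain ⟨v, hv⟩ : ∃ v, v = (t - b.centre g₁ g₂) / w := ⟨_, rfl⟩
  have hvw : t - b.centre g₁ g₂ = v * w := by rw [hv, div_mul_cancel₀ _ hw0]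
  have hre : v.re = c.α := by
    have h1 : inner ℝ (t - b.centre g₁ g₂) w = v.re * ‖w‖ ^ 2 := by
      rw [hvw, complex_inner_eq, complex_norm_sq, Complex.mul_re, Complex.mul_im]
      ring
    have h2 : v.re * ‖w‖ ^ 2 = c.α * ‖w‖ ^ 2 := by
      rw [← h1]
      linarith
    exact mul_right_cancel₀ hD.ne' h2
  have hg₁ : (0 : ℝ) < g₁ := by exact_mod_cast h₁
  have hg₂ : (0 : ℝ) < g₂ := by exact_mod_cast h₂
  have s1 := (Real.sqrt_pos.2 hg₁).ne'
  have s2 := (Real.sqrt_pos.2 hg₂).ne'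
  have hwp : w = planePoint g₁ g₂ ((k.x - b.x : ℚ) : ℝ) ((k.y - b.y : ℚ) : ℝ) :=
    Disk.centre_sub b k
  have ht' : t = b.centre g₁ g₂ + v * w := by rw [← hvw]; ring
  have hp : c.p = k.x - b.x := rfl
  have hq : c.q = k.y - b.y := rfl
  have hp' : c.p' = 0 - g₂ * (k.y - b.y) := rfl
  have hq' : c.q' = g₁ * (k.x - b.x) := rfl
  have hu1 : v.im / (√g₁ * √g₂) * g₂ * √g₁ = v.im * √g₂ := by
    field_simp
    rw [Real.sq_sqrt hg₂.le]
  have hu2 : v.im / (√g₁ * √g₂) * g₁ * √g₂ = v.im * √g₁ := by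
    field_simp
    rw [Real.sq_sqrt hg₁.le]
  refine ⟨v.im / (√g₁ * √g₂), ?_⟩
  rw [ht', hwp, Disk.centre, hp, hq, hp', hq']
  apply Complex.ext
  · simp only [planePoint, Complex.add_re, Complex.mul_re, hre]
    push_cast
    linear_combination ((k.y : ℝ) - b.y) * hu1
  · simp only [planePoint, Complex.add_im, Complex.mul_im, hre]
    push_cast
    linear_combination (-((k.x : ℝ) - b.x)) * hu2

/-- If the best arc of a circle is best among all points of the plane, then one of the chords of
this circle yields a rational point with the same disks. -/
theorem arcPoint_spec (h₁ : 0 < g₁) (h₂ : 0 < g₂) {disks : List (Disk n)}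
    (hid : (disks.map Disk.id).Nodup) (hpos : ∀ b ∈ disks, 0 < b.radSq) {b : Disk n}
    (hbm : b ∈ disks)
    (hopt : ∀ z, diskDepth g₁ g₂ disks z ≤ (bestArc g₁ g₂ disks b).val.count) :
    let A := (bestArc g₁ g₂ disks b).val
    let S := (members A).val
    ∃ x y, (arcPoint g₁ g₂ b A.view.chords S).val = some (x, y) ∧
      ∀ j ∈ S, j.power g₁ g₂ (planePoint g₁ g₂ x y) < 0 := by
  intro A S
  have hb := hpos b hbm
  have hbR : (0 : ℝ) < b.radSq := by exact_mod_cast hb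
  obtain ⟨hSid, hSd, hSl, hbS, hSc, t, hbt, ht⟩ := members_spec h₁ h₂ hid hbm hb
  change (S.map Disk.id).Nodup at hSid
  change ∀ x ∈ S, x ∈ disks at hSd
  change S.length = A.count at hSl
  change b ∈ S at hbS
  change ∀ x ∈ S, _ at hSc
  change ∀ x ∈ S, _ at ht
  change ∀ z, _ ≤ A.count at hopt
  have hV : A.view = (view g₁ g₂ disks b).val := (bestArc_spec h₁ h₂ hid hb).2.1
  have hchords : ∀ c, c ∈ A.view.chords ↔
      ∃ x ∈ disks, b.Crosses g₁ g₂ x ∧ c = chordOf g₁ g₂ b x := by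
    intro c
    rw [hV]
    exact mem_chords_iff h₁ h₂
  by_cases hnil : A.view.chords = []
  · rw [hnil]
    refine ⟨b.x, b.y, rfl, fun j hj => ?_⟩
    have hw : b.Within g₁ g₂ j := (hSc j hj).resolve_left fun h => by
      have := (hchords _).2 ⟨j, hSd j hj, h, rfl⟩
      simp [hnil] at this
    have hc : power (b.centre g₁ g₂) b.radSq (b.centre g₁ g₂) = -b.radSq := by
      simp [power]
    have := Inside.power_le (t := b.centre g₁ g₂) hw hbR (by rw [hc]; linarith)
    change power (j.centre g₁ g₂) j.radSq (b.centre g₁ g₂) < 0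
    linarith
  · have hval : ∃ c ∈ A.view.chords, ∃ z, chordPoint g₁ g₂ b c S = some z := by
      rcases exists_crossing_or_inside (S := {x | x ∈ S}) (List.finite_toSet S)
        (c := fun x => x.centre g₁ g₂) (ρ := fun x => (x.radSq : ℝ)) (F := Set.univ) (i := b) (t := t)
        (fun j hj => by exact_mod_cast hpos j (hSd j hj)) (by simp) (by simp) (by simp) hbS hbt ht
        with hin | ⟨k, hk, hcr, t', -, heq, ht'⟩
      · -- the foot of a chord with a further disk would lie in more disks than the best arc
        exfalso
        obtain ⟨c, hc⟩ := List.exists_mem_of_ne_nil _ hnil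
        obtain ⟨k, hk, hcr, rfl⟩ := (hchords c).1 hc
        have hkS : k ∉ S := fun h => Disk.not_within_of_crosses hcr (hin k h)
        obtain ⟨hD, -, -, hα, β, hβ, hαβ, -⟩ := chordOf_spec h₁ h₂ hcr
        obtain ⟨α, hα'⟩ : ∃ α : ℝ, α = (chordOf g₁ g₂ b k).α := ⟨_, rfl⟩
        rw [← hα'] at hα hαβ
        set w := k.centre g₁ g₂ - b.centre g₁ g₂ with hw
        set q := b.centre g₁ g₂ + α • w with hq
        have hbq : power (b.centre g₁ g₂) b.radSq q = -(β ^ 2 * ‖w‖ ^ 2) := by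
          rw [power, hq, add_sub_cancel_left, norm_smul, mul_pow, Real.norm_eq_abs, sq_abs]
          linarith
        have hneg : power (b.centre g₁ g₂) b.radSq q < 0 := by
          rw [hbq]
          have : 0 < β ^ 2 * ‖w‖ ^ 2 := by positivity
          linarith
        have hkq : power (k.centre g₁ g₂) k.radSq q < 0 := by
          have := power_sub_power (b.centre g₁ g₂) (k.centre g₁ g₂) b.radSq k.radSq q
          rw [← hw, hq, add_sub_cancel_left, real_inner_smul_left, real_inner_self_eq_norm_sq,
            ← hq] at this
          linarith
        have hle := length_le_diskDepth (g₁ := g₁) (g₂ := g₂) (disks := disks) (T := k :: S)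
          (List.nodup_cons.2 ⟨hkS, hSid.of_map⟩) (by
            intro x hx
            rcases List.mem_cons.1 hx with rfl | hx
            exacts [hk, hSd x hx]) (z := q) (by
            intro x hx
            rcases List.mem_cons.1 hx with rfl | hx
            · exact hkq
            · exact (Inside.power_le (hin x hx) hbR hneg.le).trans_lt hneg)
        have := hopt q
        rw [List.length_cons, hSl] at hle
        omega
      · obtain ⟨u, hu⟩ := exists_parameter h₁ h₂ (b := b) (k := k) hcr heq
        obtain ⟨-, -, hE0, -⟩ := chordOf_spec h₁ h₂ (b := b) (b' := k) hcr
        refine ⟨_, (hchords _).2 ⟨k, hSd k hk, hcr, rfl⟩, ?_⟩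
        refine exists_chordPoint h₁ h₂ (chordOf_normSq b k) hE0
          (List.ne_nil_of_mem hbS) (u := u) ?_
        rw [← hu]
        exact ht'
    obtain ⟨⟨x, y⟩, h1, h2⟩ := foldl_or_spec (fun c => chordPoint g₁ g₂ b c S)
      (fun z => ∀ j ∈ S, j.power g₁ g₂ (planePoint g₁ g₂ z.1 z.2) < 0) A.view.chords (by
        rintro c hc ⟨x, y⟩ hxy
        obtain ⟨k, hk, hcr, rfl⟩ := (hchords c).1 hc
        obtain ⟨-, -, hE0, -⟩ := chordOf_spec h₁ h₂ hcr
        exact power_neg_of_chordPoint h₁ h₂ (chordOf_normSq b k) hE0 hxy) none (by simp)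
        (Or.inr hval)
    refine ⟨x, y, ?_, h2⟩
    rw [arcPoint_val b hnil]
    exact h1

/-- The choice of the best arc in `modifiedBALLS1`. -/
theorem foldl_best {α : Type} (f : α → ℕ) (l : List α) (hl : l ≠ []) :
    ∃ a ∈ l, l.foldl (fun (best : Option α) b => match best with
        | none => some b
        | some a => some (if f a < f b then b else a)) none = some a ∧ ∀ b ∈ l, f b ≤ f a := by
  match l, hl with
  | a :: l, _ =>
    have h : ∀ (l : List α) (a : α), l.foldl (fun (best : Option α) b => match best with
        | none => some b
        | some a => some (if f a < f b then b else a)) (some a) =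
          some (l.foldl (fun a b => if f a < f b then b else a) a) := by
      intro l
      induction l with
      | nil => simp
      | cons b l ih => intro a; rw [List.foldl_cons, ih]; rfl
    rw [List.foldl_cons, h l a]
    obtain ⟨h1, h2⟩ := foldl_max (fun a => (f a : ℝ)) (fun _ => True)
      (fun a b => if f a < f b then b else a) (by simp) l a (by simp)
    exact ⟨_, h1, rfl, fun b hb => by exact_mod_cast h2 b hb⟩

end

end OCP

namespace OCP

section
variable {d : ℕ}

/-! ### Rational vectors in Euclidean space -/

theorem embed_add (u v : Fin d → ℚ) : embed (u + v) = embed u + embed v := by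
  ext k
  simp [embed]

theorem embed_sub (u v : Fin d → ℚ) : embed (u - v) = embed u - embed v := by
  ext k
  simp [embed]

theorem embed_smul (c : ℚ) (v : Fin d → ℚ) : embed (c • v) = (c : ℝ) • embed v := by
  ext k
  simp [embed]

theorem inner_embed (u v : Fin d → ℚ) : inner ℝ (embed u) (embed v) = ((u ⬝ᵥ v : ℚ) : ℝ) := by
  simp [embed, PiLp.inner_apply, dotProduct, mul_comm]

theorem norm_embed_sq (u : Fin d → ℚ) : ‖embed u‖ ^ 2 = ((u ⬝ᵥ u : ℚ) : ℝ) := by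
  rw [← real_inner_self_eq_norm_sq, inner_embed]

/-! ### Orthogonalisation of the standard basis -/

/-- Pairwise orthogonal nonzero vectors, stored with their squared norms. -/
structure OrthogonalFamily (L : List ((Fin d → ℚ) × ℚ)) : Prop where
  pairwise : L.Pairwise fun a b => a.1 ⬝ᵥ b.1 = 0
  normSq_eq : ∀ a ∈ L, a.2 = a.1 ⬝ᵥ a.1
  normSq_pos : ∀ a ∈ L, 0 < a.2

/-- The component of the `k`-th standard basis vector orthogonal to the family `L`. -/
def residual (L : List ((Fin d → ℚ) × ℚ)) (k : Fin d) : Fin d → ℚ :=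
  Pi.single k 1 + (L.map fun a => (0 - a.1 k / a.2) • a.1).sum

theorem sum_smul_dot_eq_zero {L : List ((Fin d → ℚ) × ℚ)} {w : Fin d → ℚ}
    (hw : ∀ a ∈ L, a.1 ⬝ᵥ w = 0) (c : (Fin d → ℚ) × ℚ → ℚ) :
    (L.map fun a => c a • a.1).sum ⬝ᵥ w = 0 := by
  induction L with
  | nil => simp
  | cons a L ih =>
    rw [List.map_cons, List.sum_cons, add_dotProduct, smul_dotProduct, hw a (by simp),
      ih fun b hb => hw b (by simp [hb])]
    simp

theorem OrthogonalFamily.sum_smul_dot {L : List ((Fin d → ℚ) × ℚ)} (h : OrthogonalFamily L)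
    (c : (Fin d → ℚ) × ℚ → ℚ) :
    ∀ b ∈ L, (L.map fun a => c a • a.1).sum ⬝ᵥ b.1 = c b * b.2 := by
  induction L with
  | nil => simp
  | cons a L ih =>
    obtain ⟨h1, h2⟩ := List.pairwise_cons.1 h.pairwise
    have hL : OrthogonalFamily L := ⟨h2, fun x hx => h.normSq_eq x (by simp [hx]),
      fun x hx => h.normSq_pos x (by simp [hx])⟩
    intro b hb
    rw [List.map_cons, List.sum_cons, add_dotProduct, smul_dotProduct, smul_eq_mul]
    rcases List.mem_cons.1 hb with rfl | hb
    · rw [sum_smul_dot_eq_zero fun x hx => by rw [dotProduct_comm]; exact h1 x hx,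
        ← h.normSq_eq _ (by simp), add_zero]
    · rw [h1 b hb, ih hL b hb, mul_zero, zero_add]

theorem OrthogonalFamily.residual_dot {L : List ((Fin d → ℚ) × ℚ)} (h : OrthogonalFamily L)
    (k : Fin d) : ∀ b ∈ L, residual L k ⬝ᵥ b.1 = 0 := by
  intro b hb
  have hb0 := (h.normSq_pos b hb).ne'
  rw [residual, add_dotProduct, h.sum_smul_dot (fun a => 0 - a.1 k / a.2) b hb,
    single_one_dotProduct]
  field_simp
  ring

theorem residual_cons (a : (Fin d → ℚ) × ℚ) (L : List ((Fin d → ℚ) × ℚ)) (k : Fin d) :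
    residual (a :: L) k = residual L k + (0 - a.1 k / a.2) • a.1 := by
  rw [residual, residual, List.map_cons, List.sum_cons]
  abel

/-- Adding a vector that is orthogonal to the family keeps standard basis vectors in the span. -/
theorem residual_cons_eq_zero {L : List ((Fin d → ℚ) × ℚ)} {a : (Fin d → ℚ) × ℚ}
    (ha : ∀ b ∈ L, a.1 ⬝ᵥ b.1 = 0) {k : Fin d} (hk : residual L k = 0) :
    residual (a :: L) k = 0 := by
  have h1 : residual L k ⬝ᵥ a.1 = a.1 k := by
    rw [residual, add_dotProduct, single_one_dotProduct, sum_smul_dot_eq_zero, add_zero]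
    intro b hb
    rw [dotProduct_comm]
    exact ha b hb
  rw [hk, zero_dotProduct] at h1
  rw [residual_cons, hk, ← h1]
  simp

theorem OrthogonalFamily.cons_residual {L : List ((Fin d → ℚ) × ℚ)} (h : OrthogonalFamily L)
    {k : Fin d} (hk : 0 < residual L k ⬝ᵥ residual L k) :
    OrthogonalFamily ((residual L k, residual L k ⬝ᵥ residual L k) :: L) ∧
      residual ((residual L k, residual L k ⬝ᵥ residual L k) :: L) k = 0 := by
  refine ⟨⟨List.pairwise_cons.2 ⟨h.residual_dot k, h.pairwise⟩, ?_, ?_⟩, ?_⟩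
  · intro a ha
    rcases List.mem_cons.1 ha with rfl | ha
    exacts [rfl, h.normSq_eq a ha]
  · intro a ha
    rcases List.mem_cons.1 ha with rfl | ha
    exacts [hk, h.normSq_pos a ha]
  · rw [residual_cons]
    set r := residual L k with hr
    have h1 : r ⬝ᵥ r = r k := by
      have h2 : r ⬝ᵥ r = (Pi.single k 1 : Fin d → ℚ) ⬝ᵥ r +
          (L.map fun a => (0 - a.1 k / a.2) • a.1).sum ⬝ᵥ r := by
        rw [← add_dotProduct, ← residual, ← hr]
      rw [h2, single_one_dotProduct, sum_smul_dot_eq_zero, add_zero]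
      intro b hb
      rw [dotProduct_comm]
      exact h.residual_dot k b hb
    simp only
    rw [← h1, div_self hk.ne']
    simp

theorem foldl_remove (k : Fin d) (L : List ((Fin d → ℚ) × ℚ)) (v : Fin d → ℚ) :
    L.foldl (fun v a => v + (0 - a.1 k / a.2) • a.1) v =
      v + (L.map fun a => (0 - a.1 k / a.2) • a.1).sum := by
  induction L generalizing v with
  | nil => simp
  | cons a L ih => rw [List.foldl_cons, ih, List.map_cons, List.sum_cons, add_assoc]

theorem directionBasis_val (H : List (Hyperplane d)) : (directionBasis H).val =
    (List.finRange d).foldl (fun found k =>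
      let r := residual (found ++ H.map fun h => (h.normal, h.normSq)) k
      if 0 < r ⬝ᵥ r then (r, r ⬝ᵥ r) :: found else found) [] := by
  simp only [directionBasis, bind_val, foldC_val, mapC_val, pure_val, vaddMul_val, qdiv_val,
    qsub_val, tabulate_val, dotC_val, qlt_val, foldl_remove, decide_eq_true_eq]
  congr 1
  funext found k
  have : (fun j => if j = k then (1 : ℚ) else 0) +
      ((H.map fun h => (h.normal, h.normSq)).map fun a => (0 - a.1 k / a.2) • a.1).sum +
      (found.map fun a => (0 - a.1 k / a.2) • a.1).sum =
      residual (found ++ H.map fun h => (h.normal, h.normSq)) k := by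
    rw [residual, List.map_append, List.sum_append]
    have : (fun j => if j = k then (1 : ℚ) else 0) = Pi.single k 1 := by
      ext j
      rw [Pi.single_apply]
    rw [this]
    abel
  rw [this]

theorem directionBasis_spec {H : List (Hyperplane d)}
    (hH : OrthogonalFamily (H.map fun h => (h.normal, h.normSq))) :
    OrthogonalFamily ((directionBasis H).val ++ H.map fun h => (h.normal, h.normSq)) ∧
      ∀ k, residual ((directionBasis H).val ++ H.map fun h => (h.normal, h.normSq)) k = 0 := by
  rw [directionBasis_val]
  set N := H.map fun h => (h.normal, h.normSq)
  have key : ∀ (ks : List (Fin d)) (found : List ((Fin d → ℚ) × ℚ)), OrthogonalFamily (found ++ N) →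
      let res := ks.foldl (fun found k =>
        let r := residual (found ++ N) k
        if 0 < r ⬝ᵥ r then (r, r ⬝ᵥ r) :: found else found) found
      OrthogonalFamily (res ++ N) ∧ (∀ k, residual (found ++ N) k = 0 → residual (res ++ N) k = 0) ∧
        ∀ k ∈ ks, residual (res ++ N) k = 0 := by
    intro ks
    induction ks with
    | nil => exact fun found h => ⟨h, fun _ => id, by simp⟩
    | cons k ks ih =>
      intro found h
      simp only [List.foldl_cons]
      split_ifs with hpos
      · obtain ⟨h1, h2⟩ := h.cons_residual hpos
        rw [← List.cons_append] at h1 h2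
        obtain ⟨h3, h4, h5⟩ := ih _ h1
        refine ⟨h3, fun j hj => h4 j ?_, ?_⟩
        · exact residual_cons_eq_zero (h.residual_dot k) hj
        · intro j hj
          rcases List.mem_cons.1 hj with rfl | hj
          exacts [h4 _ h2, h5 j hj]
      · obtain ⟨h3, h4, h5⟩ := ih _ h
        refine ⟨h3, h4, ?_⟩
        intro j hj
        rcases List.mem_cons.1 hj with rfl | hj
        · refine h4 _ (dotProduct_self_eq_zero.1 (le_antisymm (not_lt.1 hpos) ?_))
          exact Finset.sum_nonneg fun i _ => mul_self_nonneg _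
        · exact h5 j hj
  obtain ⟨h1, -, h3⟩ := key (List.finRange d) [] hH
  exact ⟨h1, fun k => h3 k (List.mem_finRange k)⟩

/-- The identity matrix is the sum of the projections to the vectors of the family. -/
theorem sum_projection {L : List ((Fin d → ℚ) × ℚ)} (h : ∀ k, residual L k = 0) (k j : Fin d) :
    (L.map fun a => a.1 k / a.2 * a.1 j).sum = if j = k then 1 else 0 := by
  have h1 := congrFun (h k) j
  have h2 : ∀ L : List ((Fin d → ℚ) × ℚ), ((L.map fun a => (0 - a.1 k / a.2) • a.1).sum : Fin d → ℚ) j =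
      -(L.map fun a => a.1 k / a.2 * a.1 j).sum := by
    intro L
    induction L with
    | nil => simp
    | cons a L ih =>
      simp only [List.map_cons, List.sum_cons, Pi.add_apply, Pi.smul_apply, smul_eq_mul, ih]
      ring
  rw [residual, Pi.add_apply, h2, Pi.single_apply, Pi.zero_apply] at h1
  linarith

/-- A spanning orthogonal family has `d` members: compare the traces in the decomposition of the
identity into projections. -/
theorem OrthogonalFamily.length_eq {L : List ((Fin d → ℚ) × ℚ)} (hL : OrthogonalFamily L)
    (h : ∀ k, residual L k = 0) : L.length = d := by
  have h1 : ∑ k : Fin d, (L.map fun a => a.1 k / a.2 * a.1 k).sum = (d : ℚ) := by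
    simp [sum_projection h]
  have h2 : ∀ L : List ((Fin d → ℚ) × ℚ), OrthogonalFamily L →
      ∑ k : Fin d, (L.map fun a => a.1 k / a.2 * a.1 k).sum = (L.length : ℚ) := by
    intro L
    induction L with
    | nil => simp
    | cons a L ih =>
      intro hL
      have hL' : OrthogonalFamily L := ⟨(List.pairwise_cons.1 hL.pairwise).2,
        fun x hx => hL.normSq_eq x (by simp [hx]), fun x hx => hL.normSq_pos x (by simp [hx])⟩
      have ha : ∑ k, a.1 k / a.2 * a.1 k = 1 := by
        have : ∑ k, a.1 k / a.2 * a.1 k = (a.1 ⬝ᵥ a.1) / a.2 := by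
          rw [dotProduct, Finset.sum_div]
          exact Finset.sum_congr rfl fun k _ => by ring
        rw [this, ← hL.normSq_eq a (by simp), div_self (hL.normSq_pos a (by simp)).ne']
      simp only [List.map_cons, List.sum_cons, Finset.sum_add_distrib, ih hL', ha,
        List.length_cons]
      push_cast
      ring
  rw [h2 L hL] at h1
  exact_mod_cast h1

/-- A point of Euclidean space is the sum of its projections to the vectors of a spanning
orthogonal family. -/
theorem eq_sum_projection {L : List ((Fin d → ℚ) × ℚ)} (h : ∀ k, residual L k = 0)
    (t : EuclideanSpace ℝ (Fin d)) :
    t = (L.map fun a => (inner ℝ (embed a.1) t / (a.2 : ℝ)) • embed a.1).sum := by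
  have h1 : ∀ (L : List ((Fin d → ℚ) × ℚ)) (j : Fin d),
      (L.map fun a => (inner ℝ (embed a.1) t / (a.2 : ℝ)) • embed a.1).sum j =
        ∑ k, t k * (((L.map fun a => a.1 k / a.2 * a.1 j).sum : ℚ) : ℝ) := by
    intro L j
    induction L with
    | nil => simp
    | cons a L ih =>
      simp only [List.map_cons, List.sum_cons, PiLp.add_apply, PiLp.smul_apply, ih, smul_eq_mul]
      push_cast
      simp only [mul_add, Finset.sum_add_distrib]
      congr 1
      rw [PiLp.inner_apply, Finset.sum_div, Finset.sum_mul]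
      refine Finset.sum_congr rfl fun k _ => ?_
      simp [embed]
      ring
  ext j
  rw [h1]
  rw [Finset.sum_eq_single j]
  · simp [sum_projection h]
  · intro k _ hk
    simp [sum_projection h, hk.symm]
  · simp

/-! ### Coordinates of a plane -/

/-- The hyperplanes have pairwise orthogonal nonzero normals, whose squared norms are stored
correctly. -/
def OrthogonalNormals (H : List (Hyperplane d)) : Prop :=
  OrthogonalFamily (H.map fun h => (h.normal, h.normSq))

/-- The intersection of the hyperplanes `H`. -/
def flat (H : List (Hyperplane d)) : Set (EuclideanSpace ℝ (Fin d)) :=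
  {t | ∀ h ∈ H, inner ℝ (embed h.normal) t = (h.offset : ℝ)}

theorem directionBasis_plane {H : List (Hyperplane d)} (hH : OrthogonalNormals H)
    (hd : H.length + 2 = d) : ∃ e₁ g₁ e₂ g₂, (directionBasis H).val = [(e₁, g₁), (e₂, g₂)] ∧
      0 < g₁ ∧ 0 < g₂ ∧ g₁ = e₁ ⬝ᵥ e₁ ∧ g₂ = e₂ ⬝ᵥ e₂ ∧ e₁ ⬝ᵥ e₂ = 0 ∧
      (∀ h ∈ H, e₁ ⬝ᵥ h.normal = 0 ∧ e₂ ⬝ᵥ h.normal = 0) ∧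
      ∀ z : EuclideanSpace ℝ (Fin d), (∀ h ∈ H, inner ℝ (embed h.normal) z = 0) →
        z = (inner ℝ (embed e₁) z / (g₁ : ℝ)) • embed e₁ +
          (inner ℝ (embed e₂) z / (g₂ : ℝ)) • embed e₂ := by
  obtain ⟨h1, h2⟩ := directionBasis_spec hH
  have h3 := h1.length_eq h2
  rw [List.length_append, List.length_map] at h3
  obtain ⟨⟨e₁, g₁⟩, ⟨e₂, g₂⟩, hb⟩ := List.length_eq_two.1 (show (directionBasis H).val.length = 2 by
    omega)
  rw [hb] at h1 h2
  have hp := h1.pairwise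
  simp only [List.cons_append, List.nil_append, List.pairwise_cons, List.mem_cons, List.mem_map,
    forall_eq_or_imp, forall_exists_index, and_imp, forall_apply_eq_imp_iff₂] at hp
  refine ⟨e₁, g₁, e₂, g₂, hb, h1.normSq_pos (e₁, g₁) (by simp), h1.normSq_pos (e₂, g₂) (by simp),
    h1.normSq_eq (e₁, g₁) (by simp), h1.normSq_eq (e₂, g₂) (by simp), hp.1.1,
    fun h hh => ⟨hp.1.2 h hh, hp.2.1 h hh⟩, fun z hz => ?_⟩
  have h4 := eq_sum_projection h2 z
  rw [List.map_append, List.sum_append, List.map_map] at h4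
  have h5 : (H.map ((fun a : (Fin d → ℚ) × ℚ => (inner ℝ (embed a.1) z / (a.2 : ℝ)) • embed a.1) ∘
      fun h => (h.normal, h.normSq))).sum = 0 := by
    apply List.sum_eq_zero
    intro x hx
    obtain ⟨h, hh, rfl⟩ := List.mem_map.1 hx
    simp [hz h hh]
  rw [h5, add_zero] at h4
  simpa using h4

end

end OCP

namespace OCP

section
variable {d n : ℕ}

/-! ### Correctness of the planar base case -/

/-- The power of a point with respect to the boundary sphere of a ball. -/
noncomputable def Ball.power (b : Ball d n) (t : EuclideanSpace ℝ (Fin d)) : ℝ :=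
  OCP.power (embed b.centre) b.radSq t

open scoped Classical in
/-- The number of balls of the list that contain a point. -/
noncomputable def depth (balls : List (Ball d n)) (t : EuclideanSpace ℝ (Fin d)) : ℕ :=
  balls.countP fun b => b.power t < 0

/-- The balls of distinct voters, centred on the flat that is the intersection of hyperplanes with
orthogonal normals. -/
structure Valid (H : List (Hyperplane d)) (balls : List (Ball d n)) : Prop where
  normals : OrthogonalNormals H
  ids : (balls.map Ball.id).Nodup
  radSq_pos : ∀ b ∈ balls, 0 < b.radSq
  centre_mem : ∀ b ∈ balls, embed b.centre ∈ flat H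

/-- The answer is a point of the flat with distinct voters, whose balls contain the point. -/
structure Sound (H : List (Hyperplane d)) (balls : List (Ball d n)) (ans : Answer d n) :
    Prop where
  point_mem : embed ans.point ∈ flat H
  nodup : ans.voters.Nodup
  voters_mem : ∀ i ∈ ans.voters, ∃ b ∈ balls, b.id = i ∧ b.power (embed ans.point) < 0
  count_eq : ans.count = ans.voters.length

/-- A sound answer such that no point of the flat lies in more balls. -/
structure Correct (H : List (Hyperplane d)) (balls : List (Ball d n)) (ans : Answer d n) : Prop
    extends Sound H balls ans where
  depth_le : ∀ t ∈ flat H, depth balls t ≤ ans.count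

theorem inner_normal_sub {H : List (Hyperplane d)} {x y : EuclideanSpace ℝ (Fin d)}
    (hx : x ∈ flat H) (hy : y ∈ flat H) : ∀ h ∈ H, inner ℝ (embed h.normal) (x - y) = 0 := by
  intro h hh
  rw [inner_sub_right, hx h hh, hy h hh, sub_self]

/-- The disk of a ball in the coordinates of the plane spanned by `e₁` and `e₂`, with the point
`c₀` as the origin. -/
def Ball.toDisk (c₀ e₁ e₂ : Fin d → ℚ) (g₁ g₂ : ℚ) (b : Ball d n) : Disk n :=
  ⟨b.id, (b.centre - c₀) ⬝ᵥ e₁ / g₁, (b.centre - c₀) ⬝ᵥ e₂ / g₂, b.radSq⟩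

/-- The coordinates with respect to an orthogonal basis of the plane preserve powers. -/
theorem Ball.power_toDisk {H : List (Hyperplane d)} {e₁ e₂ : Fin d → ℚ} {g₁ g₂ : ℚ}
    (h₁ : 0 < g₁) (h₂ : 0 < g₂) (hg₁ : g₁ = e₁ ⬝ᵥ e₁) (hg₂ : g₂ = e₂ ⬝ᵥ e₂) (he : e₁ ⬝ᵥ e₂ = 0)
    (hspan : ∀ z : EuclideanSpace ℝ (Fin d), (∀ h ∈ H, inner ℝ (embed h.normal) z = 0) →
        z = (inner ℝ (embed e₁) z / (g₁ : ℝ)) • embed e₁ +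
          (inner ℝ (embed e₂) z / (g₂ : ℝ)) • embed e₂)
    (c₀ : Fin d → ℚ) {b : Ball d n} (hb : embed b.centre ∈ flat H)
    {t : EuclideanSpace ℝ (Fin d)} (ht : t ∈ flat H) :
    (b.toDisk c₀ e₁ e₂ g₁ g₂).power g₁ g₂ (planePoint g₁ g₂
      (inner ℝ (embed e₁) (t - embed c₀) / (g₁ : ℝ))
      (inner ℝ (embed e₂) (t - embed c₀) / (g₂ : ℝ))) = b.power t := by
  have hz := hspan _ (inner_normal_sub ht hb)
  have hx : ∀ (e : Fin d → ℚ) (g : ℚ), inner ℝ (embed e) (t - embed c₀) / (g : ℝ) -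
      (((b.centre - c₀) ⬝ᵥ e / g : ℚ) : ℝ) = inner ℝ (embed e) (t - embed b.centre) / (g : ℝ) := by
    intro e g
    rw [Rat.cast_div, ← inner_embed, embed_sub, real_inner_comm (embed e), ← sub_div,
      ← inner_sub_right]
    congr 2
    abel
  rw [Disk.power_planePoint h₁ h₂]
  simp only [Ball.toDisk, hx]
  rw [Ball.power, OCP.power]
  conv_rhs => rw [hz]
  rw [norm_add_sq_real, norm_smul, norm_smul, mul_pow, mul_pow, norm_embed_sq, norm_embed_sq,
    ← hg₁, ← hg₂, real_inner_smul_left, real_inner_smul_right, inner_embed, he, Real.norm_eq_abs,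
    Real.norm_eq_abs, sq_abs, sq_abs]
  push_cast
  ring

theorem modifiedBALLS1_correct {H : List (Hyperplane d)} {balls : List (Ball d n)}
    (hv : Valid H balls) (hd : H.length + 2 = d) (hne : balls ≠ []) :
    ∃ ans, (modifiedBALLS1 H balls).val = some ans ∧ Correct H balls ans := by
  classical
  obtain ⟨e₁, g₁, e₂, g₂, hb, h₁, h₂, hg₁, hg₂, he, hperp, hspan⟩ :=
    directionBasis_plane hv.normals hd
  match balls, hne, hv with
  | b₀ :: bs, _, hv =>
    set disks := (b₀ :: bs).map (Ball.toDisk b₀.centre e₁ e₂ g₁ g₂) with hdisks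
    have hid : (disks.map Disk.id).Nodup := by
      rw [hdisks, List.map_map]
      exact hv.ids
    have hpos : ∀ b ∈ disks, 0 < b.radSq := by
      intro x hx
      obtain ⟨b, hb, rfl⟩ := List.mem_map.1 hx
      exact hv.radSq_pos b hb
    have hpow : ∀ b ∈ b₀ :: bs, ∀ t ∈ flat H, (b.toDisk b₀.centre e₁ e₂ g₁ g₂).power g₁ g₂
        (planePoint g₁ g₂ (inner ℝ (embed e₁) (t - embed b₀.centre) / (g₁ : ℝ))
          (inner ℝ (embed e₂) (t - embed b₀.centre) / (g₂ : ℝ))) = b.power t := fun b hb t ht =>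
      Ball.power_toDisk h₁ h₂ hg₁ hg₂ he hspan b₀.centre (hv.centre_mem b hb) ht
    obtain ⟨A, hA, hfold, hmax⟩ := foldl_best BestArc.count
      (disks.map fun b => (bestArc g₁ g₂ disks b).val) (by simp [hdisks])
    obtain ⟨b, hbm, rfl⟩ := List.mem_map.1 hA
    have hopt : ∀ z, diskDepth g₁ g₂ disks z ≤ (bestArc g₁ g₂ disks b).val.count := by
      intro z
      obtain ⟨x, hx, hle⟩ := exists_bestArc_ge h₁ h₂ hid hpos (by simp [hdisks]) z
      exact hle.trans (hmax _ (List.mem_map_of_mem hx))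
    obtain ⟨hAd, -⟩ := bestArc_spec h₁ h₂ hid (hpos b hbm)
    obtain ⟨x, y, hxy, hin⟩ := arcPoint_spec h₁ h₂ hid hpos hbm hopt
    obtain ⟨hSid, hSd, hSl, -⟩ := members_spec h₁ h₂ hid hbm (hpos b hbm)
    set A := (bestArc g₁ g₂ disks b).val
    set S := (members A).val
    rw [List.foldl_map] at hfold
    have hfold' : ∀ F : Option (BestArc n) → Disk n → Option (BestArc n),
        (∀ o b, F o b = match o with
          | none => some (bestArc g₁ g₂ disks b).val
          | some A' => some (if A'.count < (bestArc g₁ g₂ disks b).val.count then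
              (bestArc g₁ g₂ disks b).val else A')) → disks.foldl F none = some A := by
      intro F hF
      rw [← hfold]
      congr 1
      funext o b
      rw [hF]
      cases o <;> rfl
    have hval : (modifiedBALLS1 H (b₀ :: bs)).val =
        some ⟨b₀.centre + x • e₁ + y • e₂, S.map Disk.id, A.count⟩ := by
      have hdisks' : ((b₀ :: bs).map fun b : Ball d n => Disk.mk b.id
          ((b.centre - b₀.centre) ⬝ᵥ e₁ / g₁) ((b.centre - b₀.centre) ⬝ᵥ e₂ / g₂) b.radSq) =
          disks := rfl
      simp only [modifiedBALLS1, bind_val, hb, mapC_val, vsub_val, dotC_val, qdiv_val, pure_val,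
        hdisks', foldC_val]
      rw [hfold']
      · simp only [bind_val, mapC_val, pure_val]
        rw [show A.disk = b from hAd, hxy]
        rfl
      · intro o b
        cases o <;> simp
    refine ⟨_, hval, ?_⟩
    set v := b₀.centre + x • e₁ + y • e₂ with hvdef
    have hvsub : embed v - embed b₀.centre = (x : ℝ) • embed e₁ + (y : ℝ) • embed e₂ := by
      rw [hvdef, embed_add, embed_add, embed_smul, embed_smul]
      abel
    have hvF : embed v ∈ flat H := by
      intro h hh
      rw [← sub_add_cancel (embed v) (embed b₀.centre), hvsub, inner_add_right, inner_add_right,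
        inner_smul_right, inner_smul_right, inner_embed, inner_embed, dotProduct_comm,
        (hperp h hh).1, dotProduct_comm, (hperp h hh).2,
        hv.centre_mem b₀ (by simp) h hh]
      simp
    have hX : inner ℝ (embed e₁) (embed v - embed b₀.centre) / (g₁ : ℝ) = x := by
      rw [hvsub, inner_add_right, inner_smul_right, inner_smul_right, inner_embed, inner_embed, he,
        ← hg₁]
      have : (g₁ : ℝ) ≠ 0 := by exact_mod_cast h₁.ne'
      push_cast
      field_simp
      ring
    have hY : inner ℝ (embed e₂) (embed v - embed b₀.centre) / (g₂ : ℝ) = y := by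
      rw [hvsub, inner_add_right, inner_smul_right, inner_smul_right, inner_embed, inner_embed,
        dotProduct_comm e₂ e₁, he, ← hg₂]
      have : (g₂ : ℝ) ≠ 0 := by exact_mod_cast h₂.ne'
      push_cast
      field_simp
      ring
    refine ⟨⟨hvF, hSid, ?_, ?_⟩, ?_⟩
    · intro i hi
      obtain ⟨j, hj, rfl⟩ := List.mem_map.1 hi
      obtain ⟨a, ha, hja⟩ := List.mem_map.1 (hSd j hj)
      refine ⟨a, ha, by rw [← hja]; rfl, ?_⟩
      rw [← hpow a ha _ hvF, hX, hY, hja]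
      exact hin j hj
    · change A.count = (S.map Disk.id).length
      rw [List.length_map]
      exact hSl.symm
    · intro t ht
      refine le_trans (le_of_eq ?_) (hopt (planePoint g₁ g₂
        (inner ℝ (embed e₁) (t - embed b₀.centre) / (g₁ : ℝ))
        (inner ℝ (embed e₂) (t - embed b₀.centre) / (g₂ : ℝ))))
      rw [depth, diskDepth, hdisks, List.countP_map]
      refine List.countP_congr fun a ha => ?_
      simp only [Function.comp_apply, decide_eq_true_eq]
      rw [hpow a ha t ht]

end

end OCP

namespace OCP

section
variable {d n : ℕ}

/-! ### The better of several answers -/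

theorem better_spec {P : Answer d n → Prop} {o o' : Option (Answer d n)}
    (ho : ∀ a, o = some a → P a) (ho' : ∀ a, o' = some a → P a) :
    (∀ a, (better o o').val = some a → P a) ∧ ∀ a, o = some a ∨ o' = some a →
      ∃ r, (better o o').val = some r ∧ a.count ≤ r.count := by
  match o, o' with
  | none, o' => exact ⟨ho', fun a ha => ⟨a, ha.resolve_left (by simp), le_rfl⟩⟩
  | some x, none => exact ⟨ho, fun a ha => ⟨a, ha.resolve_right (by simp), le_rfl⟩⟩
  | some x, some y =>
    have h : (better (some x) (some y)).val = some (if y.count < x.count then x else y) := by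
      simp [better]
    rw [h]
    refine ⟨?_, ?_⟩
    · rintro a ha
      rw [Option.some.injEq] at ha
      split_ifs at ha
      exacts [ha ▸ ho x rfl, ha ▸ ho' y rfl]
    · rintro a (ha | ha) <;> rw [Option.some.injEq] at ha <;> subst ha <;> refine ⟨_, rfl, ?_⟩ <;>
        split_ifs <;> omega

theorem foldl_better_spec {α : Type} {P : Answer d n → Prop} (f : α → Option (Answer d n))
    (l : List α) (hf : ∀ x ∈ l, ∀ a, f x = some a → P a) : ∀ o : Option (Answer d n),
    (∀ a, o = some a → P a) →
      (∀ a, l.foldl (fun best x => (better best (f x)).val) o = some a → P a) ∧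
      ∀ a, (o = some a ∨ ∃ x ∈ l, f x = some a) →
        ∃ r, l.foldl (fun best x => (better best (f x)).val) o = some r ∧ a.count ≤ r.count := by
  induction l with
  | nil => exact fun o ho => ⟨ho, fun a ha => ⟨a, by simpa using ha, le_rfl⟩⟩
  | cons x l ih =>
    intro o ho
    obtain ⟨h1, h2⟩ := better_spec ho (hf x (by simp))
    obtain ⟨h3, h4⟩ := ih (fun y hy => hf y (by simp [hy])) _ h1
    refine ⟨h3, ?_⟩
    intro a ha
    have ha' : (o = some a ∨ f x = some a) ∨ ∃ y ∈ l, f y = some a := by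
      rcases ha with ha | ⟨y, hy, hya⟩
      · exact Or.inl (Or.inl ha)
      · rcases List.mem_cons.1 hy with rfl | hy
        exacts [Or.inl (Or.inr hya), Or.inr ⟨y, hy, hya⟩]
    rcases ha' with ha' | ha'
    · obtain ⟨r, hr, hle⟩ := h2 a ha'
      obtain ⟨r', hr', hle'⟩ := h4 r (Or.inl hr)
      exact ⟨r', hr', hle.trans hle'⟩
    · exact h4 a (Or.inr ha')

/-! ### Crossing pairs and traces on their radical hyperplanes -/

theorem dist_centre_sq (b b' : Ball d n) : ‖embed b'.centre - embed b.centre‖ ^ 2 =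
    (((b'.centre - b.centre) ⬝ᵥ (b'.centre - b.centre) : ℚ) : ℝ) := by
  rw [← embed_sub, norm_embed_sq]

/-- The spheres of two balls cross. -/
def Ball.Crosses (b b' : Ball d n) : Prop :=
  Crossing (b.radSq : ℝ) b'.radSq (‖embed b'.centre - embed b.centre‖ ^ 2)

/-- The ball `b'` contains the ball `b`. -/
def Ball.Within (b b' : Ball d n) : Prop :=
  Inside (b.radSq : ℝ) b'.radSq (‖embed b'.centre - embed b.centre‖ ^ 2)

theorem ballPosition_crossing_iff {b b' : Ball d n} :
    (ballPosition b b').val = .crossing ↔ b.Crosses b' := by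
  rw [Ball.Crosses, dist_centre_sq, ← position_crossing_iff]
  simp [ballPosition]

theorem ballPosition_inside_iff {b b' : Ball d n} :
    (ballPosition b b').val = .inside ↔ b.Within b' := by
  rw [Ball.Within, dist_centre_sq, ← position_inside_iff]
  simp [ballPosition]

theorem mem_crossingPairs_iff {balls : List (Ball d n)} {p : Ball d n × Ball d n} :
    p ∈ (crossingPairs balls).val ↔ p.1 ∈ balls ∧ p.2 ∈ balls ∧ p.1.Crosses p.2 := by
  have hin : ∀ (b : Ball d n) (l : List (Ball d n)) (P : List (Ball d n × Ball d n)),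
      p ∈ (foldC (fun P b' => do
        let pos ← ballPosition b b'
        match pos with
        | .crossing => pure ((b, b') :: P)
        | _ => pure P) P l).val ↔ (p.1 = b ∧ p.2 ∈ l ∧ b.Crosses p.2) ∨ p ∈ P := by
    intro b l
    induction l with
    | nil => simp [foldC]
    | cons x l ih =>
      intro P
      unfold foldC
      simp only [bind_val]
      rw [ih]
      have hx := ballPosition_crossing_iff (b := b) (b' := x)
      have hsplit : (p.1 = b ∧ p.2 ∈ x :: l ∧ b.Crosses p.2) ↔
          (p = (b, x) ∧ b.Crosses x) ∨ (p.1 = b ∧ p.2 ∈ l ∧ b.Crosses p.2) := by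
        rw [List.mem_cons, Prod.ext_iff]
        constructor
        · rintro ⟨h1, h2 | h2, h3⟩
          · exact Or.inl ⟨⟨h1, h2⟩, h2 ▸ h3⟩
          · exact Or.inr ⟨h1, h2, h3⟩
        · rintro (⟨⟨h1, h2⟩, h3⟩ | ⟨h1, h2, h3⟩)
          · exact ⟨h1, Or.inl h2, by rw [h2]; exact h3⟩
          · exact ⟨h1, Or.inr h2, h3⟩
      rw [hsplit]
      cases hpos : (ballPosition b x).val with
      | crossing =>
        have := hx.1 hpos
        simp only [pure_val, List.mem_cons]
        tauto
      | inside | outside | apart =>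
        have : ¬ b.Crosses x := fun h => by simp [hx.2 h] at hpos
        simp only [pure_val]
        tauto
  have hout : ∀ (l : List (Ball d n)) (P : List (Ball d n × Ball d n)),
      p ∈ (foldC (fun P b => foldC (fun P b' => do
        let pos ← ballPosition b b'
        match pos with
        | .crossing => pure ((b, b') :: P)
        | _ => pure P) P balls) P l).val ↔
        (p.1 ∈ l ∧ p.2 ∈ balls ∧ p.1.Crosses p.2) ∨ p ∈ P := by
    intro l
    induction l with
    | nil => simp [foldC]
    | cons x l ih =>
      intro P
      unfold foldC
      simp only [bind_val]
      rw [ih, hin, List.mem_cons]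
      constructor
      · rintro (h | ⟨h1, h2, h3⟩ | h)
        · tauto
        · exact Or.inl ⟨Or.inl h1, h2, by rw [h1]; exact h3⟩
        · tauto
      · rintro (⟨h1 | h1, h2, h3⟩ | h)
        · exact Or.inr (Or.inl ⟨h1, h2, by rw [← h1]; exact h3⟩)
        · tauto
        · tauto
  exact (hout balls []).trans (or_iff_left (by simp))

/-- The radical hyperplane consists of the points of equal power. -/
theorem mem_radicalHyperplane_iff (b b' : Ball d n) (t : EuclideanSpace ℝ (Fin d)) :
    inner ℝ (embed (radicalHyperplane b b').val.normal) t =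
        ((radicalHyperplane b b').val.offset : ℝ) ↔ b.power t = b'.power t := by
  have h1 := power_sub_power (embed b.centre) (embed b'.centre) b.radSq b'.radSq t
  have h2 := dist_centre_sq b b'
  rw [h2, inner_sub_left, ← embed_sub, inner_embed, real_inner_comm] at h1
  simp only [radicalHyperplane, bind_val, vsub_val, dotC_val, qadd_val, qsub_val, qdiv_val,
    pure_val, Ball.power]
  push_cast at h1 ⊢
  constructor <;> intro h <;> linarith

theorem radicalHyperplane_normSq (b b' : Ball d n) : (radicalHyperplane b b').val.normSq =
    (radicalHyperplane b b').val.normal ⬝ᵥ (radicalHyperplane b b').val.normal := by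
  simp [radicalHyperplane]

theorem radicalHyperplane_normSq_pos {b b' : Ball d n} (h : b.Crosses b') :
    0 < (radicalHyperplane b b').val.normSq := by
  have h1 := Crossing.pos h (by positivity)
  rw [dist_centre_sq] at h1
  simpa [radicalHyperplane] using (by exact_mod_cast h1 :
    0 < (b'.centre - b.centre) ⬝ᵥ (b'.centre - b.centre))

/-- The trace of a ball on a hyperplane, with a squared radius that need not be positive. -/
def Ball.traceOn (h : Hyperplane d) (b : Ball d n) : Ball d n :=
  ⟨b.id, b.centre + ((h.offset - h.normal ⬝ᵥ b.centre) / h.normSq) • h.normal,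
    b.radSq - (h.offset - h.normal ⬝ᵥ b.centre) / h.normSq * (h.offset - h.normal ⬝ᵥ b.centre)⟩

theorem project_val (h : Hyperplane d) (b : Ball d n) :
    (project h b).val = if 0 < (b.traceOn h).radSq then some (b.traceOn h) else none := by
  simp [project, Ball.traceOn]

theorem Ball.power_traceOn {h : Hyperplane d} (hN : h.normSq = h.normal ⬝ᵥ h.normal)
    (h0 : 0 < h.normSq) (b : Ball d n) {t : EuclideanSpace ℝ (Fin d)}
    (ht : inner ℝ (embed h.normal) t = (h.offset : ℝ)) : (b.traceOn h).power t = b.power t := by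
  have h1 : (h.normSq : ℝ) ≠ 0 := by exact_mod_cast h0.ne'
  have h2 : inner ℝ (t - embed b.centre) (embed h.normal) =
      ((h.offset - h.normal ⬝ᵥ b.centre : ℚ) : ℝ) := by
    rw [inner_sub_left, real_inner_comm, ht, inner_embed, dotProduct_comm]
    push_cast
    ring
  simp only [Ball.power, Ball.traceOn, OCP.power]
  rw [embed_add, ← sub_sub, embed_smul, norm_sub_sq_real, inner_smul_right, norm_smul, mul_pow,
    norm_embed_sq, ← hN, Real.norm_eq_abs, sq_abs, h2]
  push_cast
  field_simp
  ring

theorem mem_project_iff {h : Hyperplane d} {balls : List (Ball d n)} {a : Ball d n} :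
    a ∈ balls.filterMap (fun b => (project h b).val) ↔
      ∃ b ∈ balls, 0 < (b.traceOn h).radSq ∧ a = b.traceOn h := by
  simp only [List.mem_filterMap, project_val]
  constructor
  · rintro ⟨b, hb, hba⟩
    split_ifs at hba with hpos
    exact ⟨b, hb, hpos, by simpa using hba.symm⟩
  · rintro ⟨b, hb, hpos, rfl⟩
    exact ⟨b, hb, by rw [if_pos hpos]⟩

/-- A sublist of the identifiers stays free of duplicates. -/
theorem nodup_filterMap {β γ : Type} {f : β → Option γ} {u : β → Fin n} {v : γ → Fin n}
    (hf : ∀ b c, f b = some c → v c = u b) {l : List β} (hl : (l.map u).Nodup) :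
    ((l.filterMap f).map v).Nodup := by
  refine hl.sublist ?_
  clear hl
  induction l with
  | nil => simp
  | cons b l ih =>
    rw [List.filterMap_cons, List.map_cons]
    cases hb : f b with
    | none => exact ih.cons _
    | some c =>
      simp only [List.map_cons]
      rw [hf b c hb]
      exact ih.cons_cons _

theorem Ball.radSq_pos_of_power_neg {b : Ball d n} {t : EuclideanSpace ℝ (Fin d)}
    (h : b.power t < 0) : 0 < b.radSq := by
  have h1 : (0 : ℝ) < b.radSq := by
    unfold Ball.power OCP.power at h
    linarith [sq_nonneg ‖t - embed b.centre‖]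
  exact_mod_cast h1

theorem depth_project {h : Hyperplane d} (hN : h.normSq = h.normal ⬝ᵥ h.normal)
    (h0 : 0 < h.normSq) (balls : List (Ball d n)) {t : EuclideanSpace ℝ (Fin d)}
    (ht : inner ℝ (embed h.normal) t = (h.offset : ℝ)) :
    depth (balls.filterMap fun b => (project h b).val) t = depth balls t := by
  rw [depth, depth, List.countP_filterMap]
  refine List.countP_congr fun b _ => ?_
  have hb := b.power_traceOn hN h0 ht
  rw [project_val]
  split_ifs with hpos
  · simp [hb]
  · have : ¬ b.power t < 0 := fun hneg => hpos (Ball.radSq_pos_of_power_neg (hb.trans_lt hneg))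
    simp [this]

theorem Valid.project {H : List (Hyperplane d)} {balls : List (Ball d n)} (hv : Valid H balls)
    {b b' : Ball d n} (hb : b ∈ balls) (hb' : b' ∈ balls) (hc : b.Crosses b') :
    let h := (radicalHyperplane b b').val
    Valid (h :: H) (balls.filterMap fun b => (OCP.project h b).val) ∧
      balls.filterMap (fun b => (OCP.project h b).val) ≠ [] := by
  intro h
  have hN : h.normSq = h.normal ⬝ᵥ h.normal := radicalHyperplane_normSq b b'
  have h0 : 0 < h.normSq := radicalHyperplane_normSq_pos hc
  have hperp : ∀ h' ∈ H, h'.normal ⬝ᵥ h.normal = 0 := by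
    intro h' hh'
    have h1 := inner_normal_sub (hv.centre_mem b' hb') (hv.centre_mem b hb) h' hh'
    rw [← embed_sub, inner_embed] at h1
    exact_mod_cast h1
  refine ⟨⟨⟨?_, ?_, ?_⟩, ?_, ?_, ?_⟩, ?_⟩
  · rw [List.map_cons, List.pairwise_cons]
    refine ⟨?_, hv.normals.pairwise⟩
    intro a ha
    obtain ⟨h', hh', rfl⟩ := List.mem_map.1 ha
    rw [dotProduct_comm]
    exact hperp h' hh'
  · rw [List.map_cons, List.forall_mem_cons]
    exact ⟨hN, hv.normals.normSq_eq⟩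
  · rw [List.map_cons, List.forall_mem_cons]
    exact ⟨h0, hv.normals.normSq_pos⟩
  · refine nodup_filterMap ?_ hv.ids
    intro a c hac
    rw [project_val] at hac
    split_ifs at hac
    rw [← Option.some.inj hac]
    rfl
  · intro a ha
    obtain ⟨x, -, hpos, rfl⟩ := mem_project_iff.1 ha
    exact hpos
  · intro a ha
    obtain ⟨x, hx, -, rfl⟩ := mem_project_iff.1 ha
    intro h' hh'
    rw [Ball.traceOn, embed_add, embed_smul, inner_add_right, inner_smul_right, inner_embed,
      inner_embed]
    rcases List.mem_cons.1 hh' with rfl | hh'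
    · rw [← hN]
      have : (h.normSq : ℝ) ≠ 0 := by exact_mod_cast h0.ne'
      push_cast
      field_simp
      ring
    · rw [hperp h' hh', ← inner_embed, hv.centre_mem x hx h' hh']
      simp
  · refine List.ne_nil_of_mem (mem_project_iff.2 ⟨b, hb, ?_, rfl⟩)
    have h1 := hc
    rw [Ball.Crosses, crossing_iff, dist_centre_sq] at h1
    have h2 : ((b'.centre - b.centre) ⬝ᵥ (b'.centre - b.centre) + b.radSq - b'.radSq) ^ 2 <
        4 * (b.radSq * ((b'.centre - b.centre) ⬝ᵥ (b'.centre - b.centre))) := by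
      exact_mod_cast h1
    have h3 : h.normSq = (b'.centre - b.centre) ⬝ᵥ (b'.centre - b.centre) := by
      simp [h, radicalHyperplane]
    have h4 : h.offset - h.normal ⬝ᵥ b.centre =
        ((b'.centre - b.centre) ⬝ᵥ (b'.centre - b.centre) + b.radSq - b'.radSq) / 2 := by
      simp only [h, radicalHyperplane, bind_val, vsub_val, dotC_val, qadd_val, qsub_val, qdiv_val,
        pure_val, dotProduct_comm b.centre]
      ring
    rw [← h3] at h2 h4
    simp only [Ball.traceOn, h4]
    rw [sub_pos, div_mul_eq_mul_div, div_lt_iff₀ h0]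
    linarith

/-! ### Correctness of the recursion -/

open scoped Classical in
theorem centreAnswer_val (balls : List (Ball d n)) (b : Ball d n) :
    (centreAnswer balls b).val = ⟨b.centre, (balls.filter fun b' => b.Within b').map Ball.id,
      balls.countP fun b' => b.Within b'⟩ := by
  have h : balls.filterMap (fun b' => (match (ballPosition b b').val with
      | .inside => (pure (some b'.id) : Comp (Option (Fin n)))
      | _ => pure none).val) = (balls.filter fun b' => b.Within b').map Ball.id := by
    induction balls with
    | nil => rfl
    | cons x l ih =>
      rw [List.filterMap_cons, List.filter_cons, ih]
      have hx := ballPosition_inside_iff (b := b) (b' := x)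
      by_cases hw : b.Within x
      · simp [hx.2 hw, hw]
      · cases hpos : (ballPosition b x).val with
        | inside => exact absurd (hx.1 hpos) hw
        | crossing | outside | apart => simp [hw]
  have h' := congrArg List.length h
  rw [List.length_map, ← List.countP_eq_length_filter] at h'
  rw [← h, ← h']
  simp only [centreAnswer, bind_val, lengthC_val, pure_val]
  exact congrArg (fun S => (⟨b.centre, S, S.length⟩ : Answer d n)) (filterMapC_val _ balls)

theorem Ball.power_centre (b : Ball d n) : b.power (embed b.centre) = -(b.radSq : ℝ) := by
  simp [Ball.power, OCP.power]

theorem centreAnswer_sound {H : List (Hyperplane d)} {balls : List (Ball d n)}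
    (hv : Valid H balls) {b : Ball d n} (hb : b ∈ balls) :
    Sound H balls (centreAnswer balls b).val := by
  classical
  have hρ : (0 : ℝ) < b.radSq := by exact_mod_cast hv.radSq_pos b hb
  rw [centreAnswer_val]
  refine ⟨hv.centre_mem b hb, hv.ids.sublist (List.filter_sublist.map _), ?_, ?_⟩
  · intro i hi
    obtain ⟨b', hb', rfl⟩ := List.mem_map.1 hi
    obtain ⟨h1, h2⟩ := List.mem_filter.1 hb'
    refine ⟨b', h1, rfl, ?_⟩
    have hc := b.power_centre
    have := Inside.power_le (t := embed b.centre) (of_decide_eq_true h2) hρ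
      (hc.trans_le (by linarith))
    change OCP.power _ _ _ < 0
    refine this.trans_lt ?_
    change b.power (embed b.centre) < 0
    linarith
  · rw [List.length_map, List.countP_eq_length_filter]

theorem Sound.of_project {H : List (Hyperplane d)} {balls : List (Ball d n)} {h : Hyperplane d}
    (hN : h.normSq = h.normal ⬝ᵥ h.normal) (h0 : 0 < h.normSq) {ans : Answer d n}
    (hs : Sound (h :: H) (balls.filterMap fun b => (project h b).val) ans) : Sound H balls ans := by
  refine ⟨fun h' hh' => hs.point_mem h' (by simp [hh']), hs.nodup, ?_, hs.count_eq⟩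
  intro i hi
  obtain ⟨a, ha, rfl, hneg⟩ := hs.voters_mem i hi
  obtain ⟨b, hb, -, rfl⟩ := mem_project_iff.1 ha
  refine ⟨b, hb, rfl, ?_⟩
  rwa [b.power_traceOn hN h0 (hs.point_mem h (by simp))] at hneg

/-- Every point of the flat is matched by the centre of a ball, or by a point of the radical
hyperplane of two crossing balls. -/
theorem exists_candidate {H : List (Hyperplane d)} {balls : List (Ball d n)}
    (hv : Valid H balls) (hne : balls ≠ []) {t : EuclideanSpace ℝ (Fin d)} (ht : t ∈ flat H) :
    (∃ b ∈ balls, depth balls t ≤ (centreAnswer balls b).val.count) ∨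
      ∃ b ∈ balls, ∃ b' ∈ balls, b.Crosses b' ∧
        ∃ t' ∈ flat ((radicalHyperplane b b').val :: H), depth balls t ≤ depth balls t' := by
  classical
  rcases Nat.eq_zero_or_pos (depth balls t) with h0 | h0
  · obtain ⟨b, hb⟩ := List.exists_mem_of_ne_nil _ hne
    exact Or.inl ⟨b, hb, by omega⟩
  set S : Set (Ball d n) := {b | b ∈ balls ∧ b.power t < 0} with hS
  have hSfin : S.Finite := balls.finite_toSet.subset fun b hb => hb.1
  have hSne : S.Nonempty := by
    obtain ⟨b, hb, hb'⟩ := List.countP_pos_iff.1 h0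
    exact ⟨b, hb, by simpa using hb'⟩
  obtain ⟨b, hbS, hmax⟩ := Set.exists_max_image S (fun b => b.power t) hSfin hSne
  rcases exists_crossing_or_inside hSfin (c := fun b => embed b.centre)
    (ρ := fun b => (b.radSq : ℝ)) (F := flat H) (i := b) (t := t)
    (fun j hj => by exact_mod_cast hv.radSq_pos j hj.1) (by
      intro x hx y hy τ h hh
      rw [inner_add_right, inner_smul_right, inner_normal_sub hy hx h hh, hx h hh]
      simp) (fun j hj => hv.centre_mem j hj.1) ht hbS hbS.2 hmax
    with hin | ⟨k, hk, hcr, t', ht', heq, hall⟩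
  · refine Or.inl ⟨b, hbS.1, ?_⟩
    rw [centreAnswer_val, depth]
    refine List.countP_mono_left fun x hx hxt => ?_
    exact decide_eq_true (hin x ⟨hx, by simpa using hxt⟩)
  · refine Or.inr ⟨b, hbS.1, k, hk.1, hcr, t', ?_, ?_⟩
    · intro h hh
      rcases List.mem_cons.1 hh with rfl | hh
      · exact (mem_radicalHyperplane_iff b k t').2 heq
      · exact ht' h hh
    · rw [depth, depth]
      refine List.countP_mono_left fun x hx hxt => ?_
      exact decide_eq_true (hall x ⟨hx, by simpa using hxt⟩)

theorem modifiedBALLS3_correct : ∀ (k : ℕ) (H : List (Hyperplane d)) (balls : List (Ball d n)),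
    Valid H balls → H.length + k + 2 = d → balls ≠ [] →
      ∃ ans, (modifiedBALLS3 k H balls).val = some ans ∧ Correct H balls ans := by
  intro k
  induction k with
  | zero => exact fun H balls hv hd hne => modifiedBALLS1_correct hv hd hne
  | succ k ih =>
    intro H balls hv hd hne
    have hrec : ∀ p ∈ (crossingPairs balls).val, ∃ ans,
        (modifiedBALLS3 k ((radicalHyperplane p.1 p.2).val :: H)
          (balls.filterMap fun b => (project (radicalHyperplane p.1 p.2).val b).val)).val =
            some ans ∧ Correct ((radicalHyperplane p.1 p.2).val :: H)
          (balls.filterMap fun b => (project (radicalHyperplane p.1 p.2).val b).val) ans := by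
      intro p hp
      obtain ⟨h1, h2, h3⟩ := mem_crossingPairs_iff.1 hp
      obtain ⟨h4, h5⟩ := hv.project h1 h2 h3
      exact ih _ _ h4 (by simp only [List.length_cons]; omega) h5
    obtain ⟨hP, hPc⟩ := foldl_better_spec (P := Sound H balls)
      (fun p : Ball d n × Ball d n => (modifiedBALLS3 k ((radicalHyperplane p.1 p.2).val :: H)
        (balls.filterMap fun b => (project (radicalHyperplane p.1 p.2).val b).val)).val)
      (crossingPairs balls).val (by
        intro p hp a ha
        obtain ⟨h1, h2, h3⟩ := mem_crossingPairs_iff.1 hp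
        obtain ⟨ans, hans, hc⟩ := hrec p hp
        obtain rfl : ans = a := Option.some.inj (hans.symm.trans ha)
        exact hc.toSound.of_project (radicalHyperplane_normSq _ _)
          (radicalHyperplane_normSq_pos h3)) none (by simp)
    obtain ⟨hC, hCc⟩ := foldl_better_spec (P := Sound H balls)
      (fun b => some (centreAnswer balls b).val) balls (by
        intro b hb a ha
        rw [← Option.some.inj ha]
        exact centreAnswer_sound hv hb) none (by simp)
    obtain ⟨hB, hBc⟩ := better_spec hC hP
    have hval : (modifiedBALLS3 (k + 1) H balls).val = (better
        (balls.foldl (fun best b => (better best (some (centreAnswer balls b).val)).val) none)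
        ((crossingPairs balls).val.foldl (fun best p => (better best
          (modifiedBALLS3 k ((radicalHyperplane p.1 p.2).val :: H)
            (balls.filterMap fun b => (project (radicalHyperplane p.1 p.2).val b).val)).val).val)
          none)).val := by
      simp only [modifiedBALLS3, bind_val, foldC_val, filterMapC_val]
    rw [← hval] at hB hBc
    have hcentre : ∀ b ∈ balls, ∃ r, (modifiedBALLS3 (k + 1) H balls).val = some r ∧
        (centreAnswer balls b).val.count ≤ r.count := by
      intro b hb
      obtain ⟨r, hr, hle⟩ := hCc _ (Or.inr ⟨b, hb, rfl⟩)
      obtain ⟨r', hr', hle'⟩ := hBc r (Or.inl hr)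
      exact ⟨r', hr', hle.trans hle'⟩
    obtain ⟨b₀, hb₀⟩ := List.exists_mem_of_ne_nil _ hne
    obtain ⟨ans, hans, -⟩ := hcentre b₀ hb₀
    refine ⟨ans, hans, hB ans hans, ?_⟩
    intro t ht
    rcases exists_candidate hv hne ht with ⟨b, hb, hle⟩ | ⟨b, hb, b', hb', hcr, t', ht', hle⟩
    · obtain ⟨r, hr, hle'⟩ := hcentre b hb
      obtain rfl : ans = r := Option.some.inj (hans.symm.trans hr)
      exact hle.trans hle'
    · have hp : (b, b') ∈ (crossingPairs balls).val := mem_crossingPairs_iff.2 ⟨hb, hb', hcr⟩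
      obtain ⟨a, ha, hc⟩ := hrec _ hp
      have h1 := hc.depth_le t' ht'
      rw [depth_project (radicalHyperplane_normSq _ _) (radicalHyperplane_normSq_pos hcr) balls
        (ht' _ (by simp))] at h1
      obtain ⟨r, hr, hle'⟩ := hPc a (Or.inr ⟨_, hp, ha⟩)
      obtain ⟨r', hr', hle''⟩ := hBc r (Or.inr hr)
      obtain rfl : ans = r' := Option.some.inj (hans.symm.trans hr')
      omega

/-! ### Election instances -/

section
variable {m : ℕ}

theorem norm_sub_cand_sq (I : Election d n m) (i : Fin n) (j : Fin m) :
    ‖embed (I.voter i) - embed (I.cand j)‖ ^ 2 =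
      (((I.voter i - I.cand j) ⬝ᵥ (I.voter i - I.cand j) : ℚ) : ℝ) := by
  rw [← embed_sub, norm_embed_sq]

/-- The squared radius is the smallest squared distance to a candidate. -/
theorem sqRadius_spec (I : Election d n m) (hm : 1 ≤ m) (i : Fin n) :
    (∃ j, (sqRadius I i).val = (I.voter i - I.cand j) ⬝ᵥ (I.voter i - I.cand j)) ∧
      ∀ j, (sqRadius I i).val ≤ (I.voter i - I.cand j) ⬝ᵥ (I.voter i - I.cand j) := by
  obtain ⟨m, rfl⟩ : ∃ k, m = k + 1 := ⟨m - 1, by omega⟩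
  set D : Fin (m + 1) → ℚ := fun j => (I.voter i - I.cand j) ⬝ᵥ (I.voter i - I.cand j) with hD
  obtain ⟨j₀, js, hjs⟩ : ∃ j₀ js, List.finRange (m + 1) = j₀ :: js :=
    ⟨_, _, List.finRange_succ⟩
  have hmem : ∀ j, j ∈ j₀ :: js := fun j => hjs ▸ List.mem_finRange j
  have hval : (sqRadius I i).val =
      (js.map D).foldl (fun r s => if s < r then s else r) (D j₀) := by
    rw [sqRadius, hjs, List.foldl_map]
    simp only [bind_val, foldC_val, pure_val, vsub_val, dotC_val, qlt_val, decide_eq_true_eq]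
    rfl
  obtain ⟨h1, h2⟩ := foldl_max (fun q : ℚ => -(q : ℝ)) (fun _ => True)
    (fun r s => if s < r then s else r) (by simp) (js.map D) (D j₀) (by simp)
  rw [← hval, ← List.map_cons (f := D)] at h1 h2
  obtain ⟨j, -, hj⟩ := List.mem_map.1 h1
  refine ⟨⟨j, hj.symm⟩, fun j => ?_⟩
  have := h2 (D j) (List.mem_map_of_mem (hmem j))
  exact_mod_cast neg_le_neg_iff.1 this

theorem sqRadius_pos (I : Election d n m) (hm : 1 ≤ m) (i : Fin n) : 0 < (sqRadius I i).val := by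
  obtain ⟨⟨j, hj⟩, -⟩ := sqRadius_spec I hm i
  rw [hj]
  refine lt_of_le_of_ne (Finset.sum_nonneg fun _ _ => mul_self_nonneg _) fun h => ?_
  exact I.disjoint i j (sub_eq_zero.1 (dotProduct_self_eq_zero.1 h.symm))

/-- The ball of a voter of an election. -/
def voterBall (I : Election d n m) (i : Fin n) : Ball d n := ⟨i, I.voter i, (sqRadius I i).val⟩

theorem mem_criticalRegion_iff (I : Election d n m) (hm : 1 ≤ m) (i : Fin n)
    (t : EuclideanSpace ℝ (Fin d)) : t ∈ criticalRegion I i ↔ (voterBall I i).power t < 0 := by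
  obtain ⟨⟨j₀, hj₀⟩, hle⟩ := sqRadius_spec I hm i
  have hp : (voterBall I i).power t = ‖embed (I.voter i) - t‖ ^ 2 - ((sqRadius I i).val : ℝ) := by
    rw [Ball.power, OCP.power, voterBall, norm_sub_rev]
  rw [hp, sub_neg, criticalRegion, Set.mem_ofPred_eq]
  constructor
  · intro h
    rw [hj₀, ← norm_sub_cand_sq]
    exact pow_lt_pow_left₀ (h j₀) (norm_nonneg _) two_ne_zero
  · intro h j
    refine lt_of_pow_lt_pow_left₀ 2 (norm_nonneg _) (h.trans_le ?_)
    rw [norm_sub_cand_sq]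
    exact_mod_cast hle j

theorem depth_voterBalls (I : Election d n m) (hm : 1 ≤ m) (t : EuclideanSpace ℝ (Fin d)) :
    depth ((List.finRange n).map (voterBall I)) t = voteCount I t := by
  classical
  rw [depth, List.countP_map, voteCount, Set.ncard_eq_toFinset_card', List.countP_eq_length_filter,
    ← List.toFinset_card_of_nodup ((List.nodup_finRange n).filter _)]
  congr 1
  ext i
  simp [mem_criticalRegion_iff I hm]

/-- All voters of the answer are won at its point, and their number is the largest vote count, so
they are the voters won there. -/
theorem solveElection_correct (I : Election d n m) (hd : 2 ≤ d) (hn : 1 ≤ n) (hm : 1 ≤ m) :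
    ∃ ans : Answer d n, (solveElection I).val = some ans ∧
      SolvesOCP voteCount I (embed ans.point) ∧ ans.voters.Nodup ∧
      (∀ i, i ∈ ans.voters ↔ embed ans.point ∈ criticalRegion I i) ∧
      ans.count = voteCount I (embed ans.point) := by
  classical
  set balls := (List.finRange n).map (voterBall I) with hballs
  have hval : (solveElection I).val = (modifiedBALLS3 (d - 2) [] balls).val := by
    simp only [solveElection, bind_val, mapC_val, pure_val]
    rfl
  have hv : Valid [] balls := by
    refine ⟨⟨by simp, by simp, by simp⟩, ?_, ?_, by simp [flat]⟩
    · rw [hballs, List.map_map]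
      exact (List.nodup_finRange n).map fun _ _ h => h
    · intro b hb
      obtain ⟨i, -, rfl⟩ := List.mem_map.1 hb
      exact sqRadius_pos I hm i
  have hne : balls ≠ [] := by
    rw [hballs, Ne, List.map_eq_nil_iff, List.finRange_eq_nil_iff]
    omega
  obtain ⟨ans, hans, hc⟩ := modifiedBALLS3_correct (d - 2) [] balls hv
    (by simp only [List.length_nil]; omega) hne
  have hle : ∀ t, voteCount I t ≤ ans.count := fun t => by
    rw [← depth_voterBalls I hm]
    exact hc.depth_le t (by simp [flat])
  have hsub : ans.voters.toFinset ⊆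
      ({i | embed ans.point ∈ criticalRegion I i} : Set (Fin n)).toFinset := by
    intro i hi
    obtain ⟨b, hb, rfl, hneg⟩ := hc.voters_mem i (List.mem_toFinset.1 hi)
    obtain ⟨i, -, rfl⟩ := List.mem_map.1 hb
    rw [Set.mem_toFinset]
    exact (mem_criticalRegion_iff I hm i _).2 hneg
  have hcard : ans.voters.toFinset.card = ans.count := by
    rw [List.toFinset_card_of_nodup hc.nodup, hc.count_eq]
  have hvc : voteCount I (embed ans.point) =
      ({i | embed ans.point ∈ criticalRegion I i} : Set (Fin n)).toFinset.card := by
    rw [voteCount, Set.ncard_eq_toFinset_card']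
  have heq := Finset.eq_of_subset_of_card_le hsub (by
    rw [← hvc, hcard]
    exact hle _)
  have hcount : ans.count = voteCount I (embed ans.point) := by rw [hvc, ← heq, hcard]
  refine ⟨ans, hval.trans hans, fun t => (hle t).trans hcount.le, hc.nodup, fun i => ?_, hcount⟩
  rw [← List.mem_toFinset, heq]
  simp

end

end

end OCP

theorem mainTheorem10 :
    -- the output is an optimal position, together with the voters it wins
    (∀ (d n m : ℕ), 2 ≤ d → 1 ≤ n → 1 ≤ m → ∀ I : OCP.Election d n m,
      ∃ ans : OCP.Answer d n, (OCP.solveElection I).val = some ans ∧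
        OCP.SolvesOCP OCP.voteCount I (OCP.embed ans.point) ∧
        ans.voters.Nodup ∧
        (∀ i, i ∈ ans.voters ↔ OCP.embed ans.point ∈ OCP.criticalRegion I i) ∧
        ans.count = OCP.voteCount I (OCP.embed ans.point)) ∧
    -- number of steps, with a constant that does not depend on the dimension
    (∃ C : ℝ, ∀ (d n m : ℕ), 2 ≤ d → 1 ≤ n → 1 ≤ m → ∀ I : OCP.Election d n m,
      ((OCP.solveElection I).steps : ℝ) ≤ C * (OCP.sweepBound n d + n * m * d)) ∧
    -- number of steps in a fixed dimension
    (∀ d : ℕ, 2 ≤ d → ∃ C : ℝ, ∀ (n m : ℕ), 1 ≤ n → 1 ≤ m → ∀ I : OCP.Election d n m,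
      ((OCP.solveElection I).steps : ℝ) ≤ C * (OCP.sweepBound n d + n * m)) ∧
    -- bit cost in a fixed dimension
    (∀ d : ℕ, 2 ≤ d → ∃ p : Polynomial ℕ, ∀ (n m : ℕ), 1 ≤ n → 1 ≤ m →
      ∀ I : OCP.Election d n m, (OCP.solveElection I).bits ≤ p.eval (OCP.inputBits I)) := by
  refine ⟨fun d n m hd hn hm I => OCP.solveElection_correct I hd hn hm,
    OCP.exists_uniform_steps_bound, OCP.exists_steps_bound_of_dimension,
    OCP.exists_polynomial_bits⟩
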